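/- Identify a real-valued, mean-zero distribution $\psi$ on $\mathbb{T}^2=(\mathbb{R}/2\pi\mathbb{Z})^2$ with its Fourier coefficients $(\psi_k)_{k\in\mathbb{Z}^2}$ in the basis $e^{ik\cdot x}$, so that $\psi_0=0$ and $\psi_{-k}=\overline{\psi_k}$. For $s\in\mathbb{R}$ let $H^s$ be the space of such $\psi$ with $\|\psi\|_{H^s}^2=\sum_{k\ne 0}|k|^{2s}|\psi_k|^2<\infty$, where $|k|$ is the Euclidean norm, and let $X^{-2}=\bigcap_{s<-2}H^s$. For $\beta>0$ let $\rho$ be the Gaussian probability measure $``\,d\rho(\psi)=Z^{-1}e^{-\beta\|\psi\|_{H^1}^2}\,d\psi\,"$ on $X^{-2}$. That is, for $k$ in a half lattice containing exactly one of $k,-k$ for each $k\neq0$, the $\psi_k$ are independent centered complex Gaussian variables with density proportional to $e^{-2\beta|k|^2|z|^2}$, and $\psi_{-k}=\overline{\psi_k}$. Let $0<\delta\le 1$. For $N\in\mathbb{N}$ let $\Pi_N$ be the projection onto the frequencies with $\max(|k_1|,|k_2|)\le N$, and set $$B(\psi)=-|D|^{-1}\bigl(\nabla^\perp|D|^{-\delta}\psi\cdot\nabla\bigr)|D|\psi,\qquad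 B^N(\psi)=\Pi_N B(\Pi_N\psi),$$ where $|D|=(-\Delta)^{1/2}$ and $\nabla^\perp=(-\partial_{x_2},\partial_{x_1})$. **Proposition (Tightness).** Let $T>0$, $s<-2$, $0<\delta\le1$ and $\beta>0$. For every $N\in\mathbb{N}$ and every $\psi\in X^{-2}$ there is exactly one path $\Psi^N(\cdot,\psi)\in C([0,T],H^s)$ with $$\partial_t\Psi^N=B^N(\Psi^N)\ \text{ on } [0,T],\qquad \Psi^N(0,\psi)=\psi,$$ where the equation is understood for each Fourier coefficient. The map $\psi\mapsto\Psi^N(\cdot,\psi)$ is measurable, so that its law under $\rho$, $$\nu_N(\Gamma)=\rho\bigl(\{\psi\in X^{-2}:\Psi^N(\cdot,\psi)\in\Gamma\}\bigr),\qquad \Gamma\subset C([0,T],H^s)\text{ Borel},$$ is a probability measure on $C([0,T],H^s)$. The family $(\nu_N)_{N\in\mathbb{N}}$ is tight on $C([0,T],H^s)$: for every $\epsilon>0$ there is a compact set $K_\epsilon\subset C([0,T],H^s)$ with $\nu_N(K_\epsilon)\ge1-\epsilon$ for all $N$. -/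

import Mathlib

open MeasureTheory ProbabilityTheory Set
open scoped ComplexConjugate ENNReal NNReal

noncomputable section

namespace MSQG

/-- Frequencies `k = (k₁, k₂) ∈ ℤ²`. A function (or distribution) on `𝕋² = (ℝ / 2πℤ)²` is
represented by its sequence of Fourier coefficients `k ↦ ψ̂(k)` with respect to
`e_k(x) = exp (i k · x)`, orthonormal in `L²(𝕋²)` for the normalized Lebesgue measure. -/
abbrev Freq : Type := ℤ × ℤ

/-- The Euclidean length `|k|`, the symbol of `|D| = (-Δ)^{1/2}`. -/
def absFreq (k : Freq) : ℝ := Real.sqrt ((k.1 : ℝ) ^ 2 + (k.2 : ℝ) ^ 2)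

/-- The square box `max (|k₁|, |k₂|) ≤ N`, which has `(2N+1)²` points. -/
def box (N : ℕ) : Set Freq := {k | max |k.1| |k.2| ≤ (N : ℤ)}

/-! ### Spaces of real-valued, mean-zero distributions -/

/-- Coefficient sequences of real-valued mean-zero distributions of Sobolev regularity `s`:
`ψ̂(0) = 0`, `ψ̂(-k) = conj ψ̂(k)`, and `∑ |k|^{2s} |ψ̂(k)|² < ∞`. -/
def IsSobolev (s : ℝ) (ψ : Freq → ℂ) : Prop :=
  ψ 0 = 0 ∧ (∀ k, ψ (-k) = conj (ψ k)) ∧ Summable fun k => absFreq k ^ (2 * s) * ‖ψ k‖ ^ 2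

theorem absFreq_nonneg (k : Freq) : 0 ≤ absFreq k := Real.sqrt_nonneg _

theorem absFreq_pos {k : Freq} (hk : k ≠ 0) : 0 < absFreq k := by
  unfold absFreq
  apply Real.sqrt_pos.2
  rcases k with ⟨a, b⟩
  by_cases ha : a = 0
  · have hb : b ≠ 0 := by
      rintro rfl
      exact hk (by rw [ha]; rfl)
    have : (b : ℝ) ≠ 0 := by exact_mod_cast hb
    positivity
  · have : (a : ℝ) ≠ 0 := by exact_mod_cast ha
    positivity

/-- The sequence `|k|^s ψ̂(k)`. -/
def weighted (s : ℝ) (ψ : Freq → ℂ) : Freq → ℂ := fun k => ((absFreq k ^ s : ℝ) : ℂ) * ψ k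

theorem norm_weighted_sq (s : ℝ) (ψ : Freq → ℂ) (k : Freq) :
    ‖weighted s ψ k‖ ^ 2 = absFreq k ^ (2 * s) * ‖ψ k‖ ^ 2 := by
  have h : absFreq k ^ (2 * s) = (absFreq k ^ s) ^ 2 := by
    rw [← Real.rpow_natCast, ← Real.rpow_mul (absFreq_nonneg k)]
    congr 1
    push_cast
    ring
  unfold weighted
  rw [norm_mul, mul_pow, Complex.norm_real, Real.norm_eq_abs, sq_abs, h]

theorem memℓp_weighted_iff (s : ℝ) (ψ : Freq → ℂ) :
    Memℓp (weighted s ψ) 2 ↔ Summable fun k => absFreq k ^ (2 * s) * ‖ψ k‖ ^ 2 := by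
  rw [memℓp_gen_iff (by norm_num)]
  simp only [ENNReal.toReal_ofNat, Real.rpow_two, norm_weighted_sq]

theorem weighted_add (s : ℝ) (f g : Freq → ℂ) :
    weighted s (f + g) = weighted s f + weighted s g := by
  funext k
  simp [weighted, mul_add]

theorem weighted_smul (s : ℝ) (c : ℝ) (f : Freq → ℂ) :
    weighted s (c • f) = c • weighted s f := by
  funext k
  simp [weighted]
  ring

/-- The coefficient sequences in `H^s` form a real vector space. -/
def sobolevSubmodule (s : ℝ) : Submodule ℝ (Freq → ℂ) where
  carrier := {ψ | IsSobolev s ψ}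
  zero_mem' := by simp [IsSobolev, summable_zero]
  add_mem' := by
    rintro f g ⟨f0, fr, fs⟩ ⟨g0, gr, gs⟩
    refine ⟨by simp [f0, g0], fun k => by simp [fr k, gr k], ?_⟩
    rw [← memℓp_weighted_iff] at fs gs ⊢
    rw [weighted_add]
    exact fs.add gs
  smul_mem' := by
    rintro c f ⟨f0, fr, fs⟩
    refine ⟨by simp [f0], fun k => by simp [fr k], ?_⟩
    rw [← memℓp_weighted_iff] at fs ⊢
    rw [weighted_smul]
    exact fs.const_smul c

/-- The Sobolev space `H^s(𝕋²)` of real-valued mean-zero distributions, with norm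
`‖ψ‖² = ∑ |k|^{2s} |ψ̂(k)|²` (see `Hs.norm_sq`). -/
def Hs (s : ℝ) : Type := ↥(sobolevSubmodule s)

namespace Hs

variable {s : ℝ}

/-- The Fourier coefficients of an element of `H^s`. -/
def coeff (f : Hs s) : Freq → ℂ := Subtype.val f

theorem isSobolev (f : Hs s) : IsSobolev s f.coeff := Subtype.property f

instance : AddCommGroup (Hs s) := inferInstanceAs (AddCommGroup ↥(sobolevSubmodule s))

instance : Module ℝ (Hs s) := inferInstanceAs (Module ℝ ↥(sobolevSubmodule s))

/-- The map `ψ ↦ (|k|^s ψ̂(k))_k` into `ℓ²`, through which the norm of `H^s` is defined. -/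
def toL2 (s : ℝ) : Hs s →ₗ[ℝ] lp (fun _ : Freq => ℂ) 2 where
  toFun f := ⟨weighted s f.coeff, (memℓp_weighted_iff s f.coeff).2 f.isSobolev.2.2⟩
  map_add' f g := Subtype.ext (weighted_add s f.coeff g.coeff)
  map_smul' c f := Subtype.ext (weighted_smul s c f.coeff)

theorem toL2_injective (s : ℝ) : Function.Injective (toL2 s) := by
  intro f g h
  apply Subtype.ext
  funext k
  change f.coeff k = g.coeff k
  by_cases hk : k = 0
  · rw [hk, f.isSobolev.1, g.isSobolev.1]
  · have h1 : weighted s f.coeff k = weighted s g.coeff k :=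
      congrFun (congrArg Subtype.val h) k
    have h2 : ((absFreq k ^ s : ℝ) : ℂ) ≠ 0 :=
      Complex.ofReal_ne_zero.2 (Real.rpow_pos_of_pos (absFreq_pos hk) s).ne'
    exact mul_left_cancel₀ h2 h1

instance : NormedAddCommGroup (Hs s) :=
  NormedAddCommGroup.induced (Hs s) (lp (fun _ : Freq => ℂ) 2) (toL2 s) (toL2_injective s)

instance : NormedSpace ℝ (Hs s) := NormedSpace.induced ℝ (Hs s) (lp (fun _ : Freq => ℂ) 2) (toL2 s)

theorem norm_sq (f : Hs s) :
    ‖f‖ ^ 2 = ∑' k, absFreq k ^ (2 * s) * ‖f.coeff k‖ ^ 2 := by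
  have h := lp.norm_rpow_eq_tsum (p := 2) (by norm_num) (toL2 s f)
  simp only [ENNReal.toReal_ofNat, Real.rpow_two] at h
  change ‖toL2 s f‖ ^ 2 = _
  rw [h]
  exact tsum_congr fun k => norm_weighted_sq s f.coeff k

end Hs

/-- `X^σ = ⋂_{s < σ} H^s`, with the σ-algebra generated by the Fourier coefficients. -/
def XSpace (σ : ℝ) : Type := {ψ : Freq → ℂ // ∀ s < σ, IsSobolev s ψ}

instance (σ : ℝ) : MeasurableSpace (XSpace σ) :=
  inferInstanceAs (MeasurableSpace {ψ : Freq → ℂ // ∀ s < σ, IsSobolev s ψ})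

/-- The Fourier coefficients of an element of `X^σ`. -/
def XSpace.coeff {σ : ℝ} (ψ : XSpace σ) : Freq → ℂ := Subtype.val ψ

/-! ### The Gaussian measure -/

/-- Half of `ℤ² \ {0}`: exactly one of `k`, `-k` belongs to it when `k ≠ 0`. -/
def halfLattice : Set Freq := {k | 0 < k.2 ∨ (k.2 = 0 ∧ 0 < k.1)}

/-- The centered Gaussian law on `ℂ` with density proportional to `exp (-2 β |k|² |z|²)`: real and
imaginary parts are independent, of variance `1 / (4 β |k|²)`. -/
def coordLaw (β : ℝ) (k : Freq) : Measure ℂ :=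
  ((gaussianReal 0 (1 / (4 * β * absFreq k ^ 2)).toNNReal).prod
    (gaussianReal 0 (1 / (4 * β * absFreq k ^ 2)).toNNReal)).map fun p => ⟨p.1, p.2⟩

open Classical in
/-- Extends coefficients given on the half lattice to those of a real mean-zero distribution. -/
def hermitianExtension (z : Freq → ℂ) : Freq → ℂ := fun k =>
  if k ∈ halfLattice then z k else if -k ∈ halfLattice then conj (z (-k)) else 0

theorem measurable_mk_complex : Measurable fun p : ℝ × ℝ => (⟨p.1, p.2⟩ : ℂ) :=
  Complex.measurableEquivRealProd.symm.measurable

instance (β : ℝ) (k : Freq) : IsProbabilityMeasure (coordLaw β k) :=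
  Measure.isProbabilityMeasure_map measurable_mk_complex.aemeasurable

theorem measurable_hermitianExtension : Measurable hermitianExtension := by
  refine measurable_pi_lambda _ fun k => ?_
  unfold hermitianExtension
  split_ifs
  · exact measurable_pi_apply k
  · exact Complex.continuous_conj.measurable.comp (measurable_pi_apply (-k))
  · exact measurable_const

/-- The Gaussian measure `dρ(ψ) = Z⁻¹ exp (-β ‖ψ‖²_{H¹}) dψ`, with
`‖ψ‖²_{H¹} = ∑_{k ≠ 0} |k|² |ψ̂(k)|²`, on the coefficient sequences of real-valued mean-zero
distributions: the coefficients in the half lattice are independent, and since `k` and `-k`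
contribute equally to the norm, `ψ̂(k)` has density proportional to `exp (-2 β |k|² |z|²)`. -/
def gaussianCoeff (β : ℝ) : Measure (Freq → ℂ) :=
  (Measure.infinitePi (coordLaw β)).map hermitianExtension

instance (β : ℝ) : IsProbabilityMeasure (gaussianCoeff β) :=
  Measure.isProbabilityMeasure_map measurable_hermitianExtension.aemeasurable

/-- The Gaussian measure `ρ` on `X^σ`. -/
def rho (β σ : ℝ) : Measure (XSpace σ) := (gaussianCoeff β).comap XSpace.coeff

/-! ### The nonlinearity and the truncated flow -/

/-- The Fourier multiplier `|D|^r` on mean-zero sequences. -/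
def absD (r : ℝ) (f : Freq → ℂ) : Freq → ℂ := fun k =>
  if k = 0 then 0 else ((absFreq k ^ r : ℝ) : ℂ) * f k

/-- `∂/∂x₁`. -/
def partial₁ (f : Freq → ℂ) : Freq → ℂ := fun k => Complex.I * (k.1 : ℂ) * f k

/-- `∂/∂x₂`. -/
def partial₂ (f : Freq → ℂ) : Freq → ℂ := fun k => Complex.I * (k.2 : ℂ) * f k

/-- Fourier coefficients of a pointwise product (below the factors are trigonometric polynomials,
so that the sum is finite). -/
def fourierMul (f g : Freq → ℂ) : Freq → ℂ := fun k => ∑' h, f h * g (k - h)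

/-- `B(ψ) = -|D|⁻¹ (∇^⊥ |D|^{-δ} ψ · ∇) |D| ψ` with `∇^⊥ = (-∂₂, ∂₁)`, for trigonometric
polynomials `ψ`. -/
def nonlinearity (δ : ℝ) (ψ : Freq → ℂ) : Freq → ℂ :=
  -absD (-1)
    (fourierMul (-partial₂ (absD (-δ) ψ)) (partial₁ (absD 1 ψ)) +
      fourierMul (partial₁ (absD (-δ) ψ)) (partial₂ (absD 1 ψ)))

/-- The projection `Π_N` onto the frequencies in the box. -/
def proj (N : ℕ) (ψ : Freq → ℂ) : Freq → ℂ := (box N).indicator ψ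

/-- `B^N(ψ) = Π_N B(Π_N ψ)`. -/
def truncNonlinearity (δ : ℝ) (N : ℕ) (ψ : Freq → ℂ) : Freq → ℂ :=
  proj N (nonlinearity δ (proj N ψ))

/-- The path `u ∈ C([0,T], H^s)` solves `∂ₜ u = B^N(u)`, `u(0) = ψ` on `[0,T]`; the equation is
read as a system of ordinary differential equations for the Fourier coefficients (one-sided
derivatives at the end points). -/
structure IsTruncatedSolution (δ : ℝ) (N : ℕ) {T s : ℝ} (hT : 0 ≤ T) (ψ : Freq → ℂ)
    (u : C(Icc (0 : ℝ) T, Hs s)) : Prop where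
  initial : (u ⟨0, left_mem_Icc.2 hT⟩).coeff = ψ
  equation : ∀ (t : Icc (0 : ℝ) T) (k : Freq),
    HasDerivWithinAt (IccExtend hT fun τ => (u τ).coeff k)
      (truncNonlinearity δ N (u t).coeff k) (Icc 0 T) t

/-- `C([0,T], H^s)`, with the topology of the supremum norm, carries its Borel σ-algebra. -/
instance (T s : ℝ) : MeasurableSpace C(Icc (0 : ℝ) T, Hs s) := borel _

instance (T s : ℝ) : BorelSpace C(Icc (0 : ℝ) T, Hs s) := ⟨rfl⟩

/-- The law `ν_N` on `C([0,T], H^s)` of the flow map `Ψ^N` under `ρ` on `X^{-2}`: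
`ν_N(Γ) = ρ {ψ ∈ X^{-2} : Ψ^N(·, ψ) ∈ Γ}`. -/
def flowLaw (β : ℝ) {T s : ℝ} (Ψ : XSpace (-2) → C(Icc (0 : ℝ) T, Hs s)) :
    Measure C(Icc (0 : ℝ) T, Hs s) :=
  (rho β (-2)).map Ψ

end MSQG

end

noncomputable section

namespace MSQG

open Filter Topology

/-! ### Autonomous ordinary differential equations in finite dimension -/

/-! The truncated equation moves only the coefficients in the box and freezes all others. On the box
it is a quadratic ordinary differential equation with two structural properties. It conserves the
`H¹` norm (`sum_conj_mul_truncNonlinearity`), which gives global existence and uniqueness. It is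
also divergence-free, because the coefficients at `±k` never enter the equation at `k`
(`truncField_add_single`). By Liouville's theorem Lebesgue measure is preserved, hence so is the
Gaussian law of the box coefficients, whose density is a function of the conserved norm. Only the
inequality in `lintegral_phaseLaw_flow_le` is needed: the mean of a nonnegative `C¹` observable does
not exceed its initial value.

It therefore suffices to bound the second moment of `B^N(ψ)_k` under the Gaussian law at a single
time. The products `ψ_h ψ_{k-h}` are orthogonal for different unordered pairs with `h` not parallel
to `k`, and parallel pairs have zero kernel. What remains is a sum over `h` of the squared kernel
divided by `|h|² |k-h|²`. After symmetrization under `h ↦ k - h` the kernel is at most `|k| m^{1-δ}`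
with `m = min(|h|, |k-h|)`. The sum is then at most a constant times `|k|² ∑ |h|^{-2-2δ}`, finite
because `δ > 0` and independent of `N` (`exists_integral_norm_sq_truncNonlinearity_le`).

For `s' < -2` it follows that the mean of the time integral of `‖B^N‖²` in `H^{s'}` is at most `C T
∑ |k|^{2s'+2}`, which is finite. By Cauchy–Schwarz in time, the paths are `1/2`-Hölder in `H^{s'}`
with a random constant whose square has bounded mean (`exists_lintegral_pathBound_le`). Taking `s <
s' < -2`, sets of such paths are compact in `C([0,T], H^s)` by Rellich and Arzelà–Ascoli
(`isCompact_holderPaths`), and Markov's inequality gives tightness. -/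

/-- `x` solves `x' = B x` on `[0, T]`. -/
def IsODESol {V : Type*} [NormedAddCommGroup V] [NormedSpace ℝ V] (B : V → V) (T : ℝ)
    (x : ℝ → V) : Prop :=
  ∀ t ∈ Icc (0 : ℝ) T, HasDerivWithinAt x (B (x t)) (Icc 0 T) t

section ODE

variable {V : Type*} [NormedAddCommGroup V] [NormedSpace ℝ V] {B : V → V} {T : ℝ}

theorem hasDerivWithinAt_Ici_of_Icc {x : ℝ → V} {x' : V} {T t : ℝ}
    (h : HasDerivWithinAt x x' (Icc 0 T) t) (ht : t ∈ Ico 0 T) : HasDerivWithinAt x x' (Ici t) t :=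
  h.mono_of_mem_nhdsWithin (Filter.mem_of_superset (Icc_mem_nhdsGE ht.2) (Icc_subset_Icc_left ht.1))

theorem IsODESol.continuousOn {x : ℝ → V} (h : IsODESol B T x) : ContinuousOn x (Icc 0 T) :=
  fun t ht => (h t ht).continuousWithinAt

theorem IsODESol.dist_le {K : ℝ≥0} (hB : LipschitzWith K B) {x y : ℝ → V} (hx : IsODESol B T x)
    (hy : IsODESol B T y) {t : ℝ} (ht : t ∈ Icc 0 T) :
    dist (x t) (y t) ≤ dist (x 0) (y 0) * Real.exp (K * t) := by
  have := dist_le_of_trajectories_ODE (v := fun _ => B) (a := 0) (b := T) (fun _ => hB)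
    hx.continuousOn (fun t ht => hasDerivWithinAt_Ici_of_Icc (hx t (Ico_subset_Icc_self ht)) ht)
    hy.continuousOn (fun t ht => hasDerivWithinAt_Ici_of_Icc (hy t (Ico_subset_Icc_self ht)) ht)
    le_rfl t ht
  simpa using this

theorem IsODESol.eq_of_lipschitz {K : ℝ≥0} (hB : LipschitzWith K B) {x y : ℝ → V}
    (hx : IsODESol B T x) (hy : IsODESol B T y) (h0 : x 0 = y 0) {t : ℝ} (ht : t ∈ Icc 0 T) :
    x t = y t := by
  have := hx.dist_le hB hy ht
  rw [h0, dist_self, zero_mul] at this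
  exact dist_le_zero.1 this

theorem IsODESol.mono {x : ℝ → V} (hx : IsODESol B T x) {S : ℝ} (hS : S ≤ T) : IsODESol B S x :=
  fun t ht => (hx t ⟨ht.1, ht.2.trans hS⟩).mono (Icc_subset_Icc_right hS)

theorem IsODESol.shift {x : ℝ → V} (hx : IsODESol B T x) {S h : ℝ} (hh : 0 ≤ h)
    (hS : S + h ≤ T) : IsODESol B S (fun t => x (t + h)) := by
  intro t ht
  have h1 := hx (t + h) ⟨by linarith [ht.1], by linarith [ht.2]⟩
  have h2 : HasDerivWithinAt (fun t : ℝ => t + h) 1 (Icc 0 S) t :=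
    (hasDerivWithinAt_id t _).add_const h
  have hmaps : MapsTo (fun t : ℝ => t + h) (Icc 0 S) (Icc 0 T) := fun u hu =>
    ⟨by linarith [hu.1], by linarith [hu.2]⟩
  have := h1.scomp t h2 hmaps
  rw [one_smul] at this
  exact this

theorem isODESol_const {x : V} (hx : B x = 0) : IsODESol B T (fun _ => x) := fun t _ => by
  simpa [hx] using hasDerivWithinAt_const t (Icc 0 T) x

theorem exists_isODESol_of_lipschitz [CompleteSpace V] {K : ℝ≥0} (hB : LipschitzWith K B) {L : ℝ≥0}
    (hL : ∀ x, ‖B x‖ ≤ L) (hT : 0 ≤ T) (x₀ : V) : ∃ x : ℝ → V, x 0 = x₀ ∧ IsODESol B T x := by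
  -- Radius `L T`: a field bounded by `L` cannot leave this ball before time `T`, so one application
  -- of Picard–Lindelöf covers all of `[0, T]`.
  have hp : IsPicardLindelof (fun _ : ℝ => B) (tmin := 0) (tmax := T) ⟨0, left_mem_Icc.2 hT⟩ x₀
      (L * ⟨T, hT⟩) 0 L K :=
    { lipschitzOnWith := fun _ _ => hB.lipschitzOnWith
      continuousOn := fun _ _ => continuousOn_const
      norm_le := fun _ _ x _ => hL x
      mul_max_le := by simp [hT]; rfl }
  obtain ⟨x, hx0, hx⟩ := hp.exists_eq_forall_mem_Icc_hasDerivWithinAt₀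
  exact ⟨x, hx0, hx⟩

theorem IsODESol.norm_sub_le {L : ℝ} (hL : ∀ x, ‖B x‖ ≤ L) {x : ℝ → V} (hx : IsODESol B T x)
    {t : ℝ} (ht : t ∈ Icc 0 T) : ‖x t - x 0‖ ≤ L * t := by
  have := norm_image_sub_le_of_norm_deriv_le_segment' (f := x) (f' := fun t => B (x t)) (a := 0)
    (b := T) (C := L) hx (fun t _ => hL _) t ht
  simpa using this

theorem IsODESol.congr_field {B' : V → V} {x : ℝ → V} (hx : IsODESol B T x)
    (h : ∀ t ∈ Icc 0 T, B' (x t) = B (x t)) : IsODESol B' T x := fun t ht => by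
  rw [h t ht]
  exact hx t ht

end ODE

/-! ### Liouville's theorem for compactly supported fields -/

section Liouville

variable {V : Type*} [NormedAddCommGroup V] [NormedSpace ℝ V] [FiniteDimensional ℝ V]
  [MeasurableSpace V] [BorelSpace V] {B : V → V} {T : ℝ}

/-- Integration by parts: the integral of `∇g · B` is minus that of `g div B`. The function `g` is
only Lipschitz because the intended case is `g = f ∘ φ_t`, where the flow map `φ_t` is known to be
Lipschitz but not differentiable; Rademacher's theorem supplies the derivative almost everywhere. -/
theorem integral_fderiv_apply_eq_zero {μ : Measure V} [μ.IsAddHaarMeasure] (hB : ContDiff ℝ 1 B)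
    (hBc : HasCompactSupport B) {ι : Type*} [Fintype ι] (b : Module.Basis ι ℝ V)
    (hdiv : ∀ x, ∑ j, b.repr (fderiv ℝ B x (b j)) j = 0) {g : V → ℝ} {C : ℝ≥0}
    (hg : LipschitzWith C g) : ∫ x, fderiv ℝ g x (B x) ∂μ = 0 := by
  let c : ι → V →L[ℝ] ℝ := fun j => LinearMap.toContinuousLinearMap (b.coord j)
  have hc : ∀ j v, c j v = b.repr v j := fun j v => rfl
  have hBj : ∀ j, ContDiff ℝ 1 (fun x => c j (B x)) := fun j => (c j).contDiff.comp hB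
  have hBjc : ∀ j, HasCompactSupport (fun x => c j (B x)) := fun j =>
    hBc.comp_left (g := c j) (map_zero _)
  have hfd : ∀ j x v, fderiv ℝ (fun x => c j (B x)) x v = c j (fderiv ℝ B x v) := fun j x v => by
    have := ((c j).hasFDerivAt.comp x ((hB.differentiable (by simp)) x).hasFDerivAt).fderiv
    change fderiv ℝ (c j ∘ B) x v = _
    rw [this]; rfl
  have hexp : ∀ x, fderiv ℝ g x (B x) = ∑ j, fderiv ℝ g x (b j) * c j (B x) := fun x => by
    conv_lhs => rw [← b.sum_repr (B x), map_sum]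
    exact Finset.sum_congr rfl fun j _ => by rw [map_smul, hc, smul_eq_mul, mul_comm]
  have hae : ∀ᵐ x ∂μ, fderiv ℝ g x (B x) = ∑ j, lineDeriv ℝ g x (b j) * c j (B x) := by
    filter_upwards [hg.ae_differentiableAt (μ := μ)] with x hx
    rw [hexp]
    exact Finset.sum_congr rfl fun j _ => by rw [hx.lineDeriv_eq_fderiv]
  have hint : ∀ j, Integrable (fun x => lineDeriv ℝ g x (b j) * c j (B x)) μ := fun j => by
    obtain ⟨M, hM⟩ := (hBjc j).exists_bound_of_continuous (hBj j).continuous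
    have h1 : Integrable (fun x => c j (B x)) μ :=
      (hBj j).continuous.integrable_of_hasCompactSupport (hBjc j)
    refine h1.bdd_mul (c := C * ‖b j‖) (measurable_lineDeriv hg.continuous).aestronglyMeasurable ?_
    exact ae_of_all _ fun x => norm_lineDeriv_le_of_lipschitz ℝ hg
  have hint2 : ∀ j, Integrable (fun x => b.repr (fderiv ℝ B x (b j)) j * g x) μ := fun j => by
    refine Continuous.integrable_of_hasCompactSupport ?_ ?_
    · refine Continuous.mul ?_ hg.continuous
      exact (c j).continuous.comp ((hB.continuous_fderiv (by simp)).clm_apply continuous_const)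
    · refine HasCompactSupport.mul_right ?_
      exact (hBc.fderiv (𝕜 := ℝ)).comp_left (g := fun L : V →L[ℝ] V => b.repr (L (b j)) j) (by simp)
  rw [integral_congr_ae hae, integral_finsetSum _ fun j _ => hint j]
  have : ∀ j, ∫ x, lineDeriv ℝ g x (b j) * c j (B x) ∂μ
      = - ∫ x, b.repr (fderiv ℝ B x (b j)) j * g x ∂μ := fun j => by
    -- The compact support needed for the integration by parts is carried by the component of `B`,
    -- not by `g`.
    obtain ⟨D, hD⟩ := (hBj j).lipschitzWith_of_hasCompactSupport (hBjc j) (by simp)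
    rw [LipschitzWith.integral_lineDeriv_mul_eq hg hD (hBjc j), ← integral_neg]
    refine integral_congr_ae (ae_of_all _ fun x => ?_)
    simp only
    rw [((hBj j).differentiable (by simp)).differentiableAt.lineDeriv_eq_fderiv, hfd, map_neg,
      map_neg, hc, neg_mul]
  simp_rw [this]
  rw [Finset.sum_neg_distrib, ← integral_finsetSum _ fun j _ => hint2 j]
  simp_rw [← Finset.sum_mul, hdiv]
  simp

/-- Liouville's theorem for the flow of a compactly supported divergence-free vector field. -/
theorem integral_comp_flow_eq {μ : Measure V} [μ.IsAddHaarMeasure] (hB : ContDiff ℝ 1 B)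
    (hBc : HasCompactSupport B) {ι : Type*} [Fintype ι] (b : Module.Basis ι ℝ V)
    (hdiv : ∀ x, ∑ j, b.repr (fderiv ℝ B x (b j)) j = 0) {φ : ℝ → V → V} (h0 : ∀ x, φ 0 x = x)
    (hφ : ∀ x, IsODESol B T fun t => φ t x) {f : V → ℝ} {C : ℝ≥0} (hf : LipschitzWith C f)
    (hfc : HasCompactSupport f) {t : ℝ} (ht : t ∈ Icc 0 T) :
    ∫ x, f (φ t x) ∂μ = ∫ x, f x ∂μ := by
  obtain ⟨K, hK⟩ := hB.lipschitzWith_of_hasCompactSupport hBc (by simp)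
  obtain ⟨L, hL⟩ := hBc.exists_bound_of_continuous hB.continuous
  obtain ⟨M, hM⟩ := hfc.exists_bound_of_continuous hf.continuous
  have hL0 : 0 ≤ L := (norm_nonneg _).trans (hL 0)
  have hlip : ∀ t ∈ Icc 0 T, LipschitzWith (Real.exp (K * t)).toNNReal (φ t) := fun t ht =>
    LipschitzWith.of_dist_le_mul fun x y => by
      have := (hφ x).dist_le hK (hφ y) ht
      rw [h0, h0] at this
      rw [Real.coe_toNNReal _ (Real.exp_pos _).le, mul_comm]
      exact this
  -- The semigroup law follows from uniqueness, applied to the time-shifted trajectory.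
  have hsemi : ∀ t h, 0 ≤ t → 0 ≤ h → t + h ≤ T → ∀ x, φ (t + h) x = φ t (φ h x) :=
    fun t h ht hh hth x =>
      ((hφ x).shift hh hth).eq_of_lipschitz hK ((hφ (φ h x)).mono (by linarith))
        (by simp [h0]) (right_mem_Icc.2 ht)
  -- Points outside the support of `B` do not move, so all `f ∘ φ_t` vanish off one fixed compact
  -- set. This provides the dominating functions below.
  have hfix : ∀ t ∈ Icc 0 T, ∀ x, x ∉ tsupport B → φ t x = x := fun t ht x hx =>
    (hφ x).eq_of_lipschitz hK (isODESol_const (image_eq_zero_of_notMem_tsupport hx)) (h0 x) ht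
  set S : Set V := tsupport f ∪ tsupport B with hSdef
  have hS : IsCompact S := IsCompact.union hfc hBc
  have hout : ∀ t ∈ Icc 0 T, ∀ x, x ∉ S → f (φ t x) = 0 := fun t ht x hx => by
    rw [hfix t ht x fun h => hx (Or.inr h)]
    exact image_eq_zero_of_notMem_tsupport fun h => hx (Or.inl h)
  have hintS : ∀ A : ℝ, Integrable (S.indicator fun _ => A) μ := fun A =>
    (integrableOn_const hS.measure_lt_top.ne).integrable_indicator hS.measurableSet
  have hmeas : ∀ t ∈ Icc 0 T, AEStronglyMeasurable (fun x => f (φ t x)) μ := fun t ht =>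
    (hf.continuous.comp (hlip t ht).continuous).aestronglyMeasurable
  have hbdM : ∀ t ∈ Icc 0 T, ∀ᵐ x ∂μ, ‖f (φ t x)‖ ≤ S.indicator (fun _ => M) x := fun t ht =>
    ae_of_all _ fun x => by
      by_cases hx : x ∈ S
      · rw [indicator_of_mem hx]; exact hM _
      · rw [indicator_of_notMem hx, hout t ht x hx, norm_zero]
  have hintf : ∀ t ∈ Icc 0 T, Integrable (fun x => f (φ t x)) μ := fun t ht =>
    (hintS M).mono' (hmeas t ht) (hbdM t ht)
  have hcont : ContinuousOn (fun t => ∫ x, f (φ t x) ∂μ) (Icc 0 T) :=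
    continuousOn_of_dominated hmeas hbdM (hintS M)
      (ae_of_all _ fun x => hf.continuous.comp_continuousOn (hφ x).continuousOn)
  -- With `φ_y = φ_t ∘ φ_{y-t}`, the difference quotient is that of the fixed Lipschitz function `f
  -- ∘ φ_t` along the flow for the short time `y - t`. Its limit is the derivative of `f ∘ φ_t` in
  -- the direction `B`, whose integral is zero. No differentiability of the flow in the initial
  -- datum is needed.
  have hderiv : ∀ t ∈ Ico 0 T,
      HasDerivWithinAt (fun t => ∫ x, f (φ t x) ∂μ) 0 (Ici t) t := by
    intro t ht
    have htI := Ico_subset_Icc_self ht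
    have hg : LipschitzWith (C * (Real.exp (K * t)).toNNReal) (f ∘ φ t) := hf.comp (hlip t htI)
    set D : ℝ≥0 := C * (Real.exp (K * t)).toNNReal
    rw [← integral_fderiv_apply_eq_zero (μ := μ) hB hBc b hdiv hg,
      hasDerivWithinAt_iff_tendsto_slope, Ici_sdiff_left]
    have hev : ∀ᶠ y in 𝓝[>] t, y ∈ Ioc t T :=
      Filter.mem_of_superset (Ioo_mem_nhdsGT ht.2) Ioo_subset_Ioc_self
    have hstep : ∀ y ∈ Ioc t T, ∀ x, φ y x = φ t (φ (y - t) x) := fun y hy x => by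
      rw [← hsemi t (y - t) ht.1 (by linarith [hy.1]) (by linarith [hy.2])]
      congr 1; ring
    have hslope : (fun y => ∫ x, (y - t)⁻¹ * (f (φ y x) - f (φ t x)) ∂μ) =ᶠ[𝓝[>] t]
        slope (fun t => ∫ x, f (φ t x) ∂μ) t := by
      filter_upwards [hev] with y hy
      rw [slope_def_module, integral_const_mul,
        integral_sub (hintf y ⟨ht.1.trans hy.1.le, hy.2⟩) (hintf t htI), smul_eq_mul]
    refine Tendsto.congr' hslope ?_
    refine tendsto_integral_filter_of_dominated_convergence (S.indicator fun _ => D * L) ?_ ?_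
      (hintS _) ?_
    · filter_upwards [hev] with y hy
      exact ((hmeas y ⟨ht.1.trans hy.1.le, hy.2⟩).sub (hmeas t htI)).const_mul _
    · filter_upwards [hev] with y hy
      refine ae_of_all _ fun x => ?_
      have hyI : y ∈ Icc 0 T := ⟨ht.1.trans hy.1.le, hy.2⟩
      by_cases hx : x ∈ S
      · rw [indicator_of_mem hx, hstep y hy x]
        have h1 : ‖f (φ t (φ (y - t) x)) - f (φ t x)‖ ≤ D * ‖φ (y - t) x - x‖ :=
          hg.norm_sub_le _ _
        have h2 : ‖φ (y - t) x - x‖ ≤ L * (y - t) := by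
          have := (hφ x).norm_sub_le hL (t := y - t)
            ⟨by linarith [hy.1], by linarith [hy.2, ht.1]⟩
          rwa [h0] at this
        have hpos : 0 < y - t := by linarith [hy.1]
        rw [norm_mul, norm_inv, Real.norm_of_nonneg hpos.le, inv_mul_le_iff₀ hpos]
        calc _ ≤ D * ‖φ (y - t) x - x‖ := h1
          _ ≤ D * (L * (y - t)) := by gcongr
          _ = _ := by ring
      · rw [indicator_of_notMem hx, hout y hyI x hx, hout t htI x hx]
        simp
    · filter_upwards [hg.ae_differentiableAt (μ := μ)] with x hx
      have hT0 : (0 : ℝ) ∈ Ico 0 T := ⟨le_rfl, ht.1.trans_lt ht.2⟩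
      have h1 : HasDerivWithinAt (fun h => φ h x) (B x) (Ici 0) 0 := by
        have := hasDerivWithinAt_Ici_of_Icc (hφ x 0 (Ico_subset_Icc_self hT0)) hT0
        simpa [h0] using this
      have h2 : HasDerivWithinAt (fun y => φ (y - t) x) (B x) (Ici t) t := by
        have h3 : HasDerivWithinAt (fun y : ℝ => y - t) 1 (Ici t) t :=
          (hasDerivWithinAt_id t _).sub_const t
        have := HasDerivWithinAt.scomp (g₁ := fun h => φ h x) (t' := Ici 0) t
          (by simpa using h1) h3 (fun u hu => sub_nonneg.2 hu)
        rw [one_smul] at this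
        exact this
      have h4 : HasDerivWithinAt (fun y => (f ∘ φ t) (φ (y - t) x)) (fderiv ℝ (f ∘ φ t) x (B x))
          (Ici t) t := by
        have hx' : HasFDerivAt (f ∘ φ t) (fderiv ℝ (f ∘ φ t) x) (φ (t - t) x) := by
          rw [sub_self, h0]; exact hx.hasFDerivAt
        exact HasFDerivAt.comp_hasDerivWithinAt (l := f ∘ φ t) t hx' h2
      rw [hasDerivWithinAt_iff_tendsto_slope, Ici_sdiff_left] at h4
      refine Tendsto.congr' ?_ h4
      filter_upwards [hev] with y hy
      rw [slope_def_module, smul_eq_mul, hstep y hy x]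
      simp [h0]
  have hconst := constant_of_has_deriv_right_zero hcont hderiv t ht
  simpa [h0] using hconst

end Liouville

/-! ### Vector fields with a proper conserved quantity -/

/-- A `C¹` vector field on a finite-dimensional space that is divergence-free (in the basis `b`)
and conserves the proper function `Q`. -/
structure IsConservative {V : Type*} [NormedAddCommGroup V] [NormedSpace ℝ V] {ι : Type*}
    [Fintype ι] (b : Module.Basis ι ℝ V) (B : V → V) (Q : V → ℝ) : Prop where
  field : ContDiff ℝ 1 B
  quantity : ContDiff ℝ 1 Q
  conserved : ∀ x, fderiv ℝ Q x (B x) = 0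
  bounded : ∀ R, Bornology.IsBounded {x | Q x ≤ R}
  divergence : ∀ x, ∑ j, b.repr (fderiv ℝ B x (b j)) j = 0

/-- The vector field `B` cut off outside `{Q ≤ R + 1}`. -/
def cutoff {V : Type*} [NormedAddCommGroup V] [NormedSpace ℝ V] (B : V → V) (Q : V → ℝ) (R : ℝ) :
    V → V := fun x => Real.smoothTransition (R + 1 - Q x) • B x

theorem cutoff_eq {V : Type*} [NormedAddCommGroup V] [NormedSpace ℝ V] {B : V → V} {Q : V → ℝ}
    {R : ℝ} {x : V} (h : Q x ≤ R) : cutoff B Q R x = B x := by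
  rw [cutoff, Real.smoothTransition.one_of_one_le (by linarith), one_smul]

namespace IsConservative

variable {V : Type*} [NormedAddCommGroup V] [NormedSpace ℝ V] {ι : Type*} [Fintype ι]
  {b : Module.Basis ι ℝ V} {B : V → V} {Q : V → ℝ} {T : ℝ}

theorem contDiff_transition (H : IsConservative b B Q) (R : ℝ) :
    ContDiff ℝ 1 fun x => Real.smoothTransition (R + 1 - Q x) :=
  (Real.smoothTransition.contDiff (n := 1)).comp (contDiff_const.sub H.quantity)

theorem contDiff_cutoff (H : IsConservative b B Q) (R : ℝ) : ContDiff ℝ 1 (cutoff B Q R) :=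
  (H.contDiff_transition R).smul H.field

/-- By the product rule the divergence of `χ(Q) B` is `χ(Q) div B + χ'(Q) dQ(B)`, and both terms
vanish. This is why the cutoff is a function of the conserved quantity. -/
theorem divergence_cutoff (H : IsConservative b B Q) (R : ℝ) (x : V) :
    ∑ j, b.repr (fderiv ℝ (cutoff B Q R) x (b j)) j = 0 := by
  have hQ : HasFDerivAt Q (fderiv ℝ Q x) x := ((H.quantity.differentiable (by simp)) x).hasFDerivAt
  have hB : HasFDerivAt B (fderiv ℝ B x) x := ((H.field.differentiable (by simp)) x).hasFDerivAt
  have hs : HasDerivAt Real.smoothTransition (deriv Real.smoothTransition (R + 1 - Q x))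
      (R + 1 - Q x) :=
    (((Real.smoothTransition.contDiff (n := 1)).differentiable (by simp)) _).hasDerivAt
  have hc := (hs.comp_hasFDerivAt x (hQ.const_sub (R + 1))).smul hB
  have hfd := HasFDerivAt.fderiv (f := cutoff B Q R) hc
  rw [hfd]
  set d := deriv Real.smoothTransition (R + 1 - Q x)
  have : ∀ v : V, ∀ j, b.repr (((Real.smoothTransition ∘ fun x => R + 1 - Q x) x • fderiv ℝ B x +
      (d • -fderiv ℝ Q x).smulRight (B x)) v) j =
      Real.smoothTransition (R + 1 - Q x) * b.repr (fderiv ℝ B x v) j -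
        d * (fderiv ℝ Q x v * b.repr (B x) j) := fun v j => by
    simp
    ring
  simp_rw [this, Finset.sum_sub_distrib, ← Finset.mul_sum, H.divergence]
  have h2 : ∑ j, fderiv ℝ Q x (b j) * b.repr (B x) j = fderiv ℝ Q x (B x) := by
    conv_rhs => rw [← b.sum_repr (B x), map_sum]
    exact Finset.sum_congr rfl fun j _ => by rw [map_smul, smul_eq_mul, mul_comm]
  rw [h2, H.conserved]
  simp

/-- Conservation only needs the velocity to be parallel to `B`. The scalar factor `c` lets one proof
serve both `B` and its cutoffs. -/
theorem quantity_eq_of_smul (H : IsConservative b B Q) {c : V → ℝ} {x : ℝ → V}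
    (hx : IsODESol (fun y => c y • B y) T x) {t : ℝ} (ht : t ∈ Icc 0 T) : Q (x t) = Q (x 0) := by
  refine constant_of_has_deriv_right_zero (f := fun t => Q (x t)) (a := 0) (b := T)
    (H.quantity.continuous.comp_continuousOn hx.continuousOn) (fun t ht => ?_) t ht
  have h1 : HasFDerivAt Q (fderiv ℝ Q (x t)) (x t) :=
    ((H.quantity.differentiable (by simp)) _).hasFDerivAt
  have h2 := hasDerivWithinAt_Ici_of_Icc (hx t (Ico_subset_Icc_self ht)) ht
  have := h1.comp_hasDerivWithinAt t h2
  rw [map_smul, H.conserved, smul_zero] at this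
  exact this

theorem quantity_eq (H : IsConservative b B Q) {x : ℝ → V} (hx : IsODESol B T x) {t : ℝ}
    (ht : t ∈ Icc 0 T) : Q (x t) = Q (x 0) :=
  H.quantity_eq_of_smul (c := fun _ => 1) (by simpa using hx) ht

theorem isODESol_cutoff (H : IsConservative b B Q) {x : ℝ → V} (hx : IsODESol B T x) {R : ℝ}
    (hR : Q (x 0) ≤ R) : IsODESol (cutoff B Q R) T x :=
  hx.congr_field fun _ ht => cutoff_eq ((H.quantity_eq hx ht).trans_le hR)

/-- A trajectory of the cutoff field keeps its value of `Q`, so it never leaves the region where the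
cutoff equals one. -/
theorem isODESol_of_cutoff (H : IsConservative b B Q) {x : ℝ → V} {R : ℝ}
    (hx : IsODESol (cutoff B Q R) T x) (hR : Q (x 0) ≤ R) : IsODESol B T x :=
  hx.congr_field fun _ ht => (cutoff_eq ((H.quantity_eq_of_smul hx ht).trans_le hR)).symm

variable [FiniteDimensional ℝ V]

theorem isCompact_sublevel (H : IsConservative b B Q) (R : ℝ) : IsCompact {x | Q x ≤ R} :=
  Metric.isCompact_of_isClosed_isBounded (isClosed_le H.quantity.continuous continuous_const)
    (H.bounded R)

theorem hasCompactSupport_transition (H : IsConservative b B Q) (R : ℝ) :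
    HasCompactSupport fun x => Real.smoothTransition (R + 1 - Q x) := by
  refine HasCompactSupport.intro (H.isCompact_sublevel (R + 1)) fun x hx => ?_
  simp only [mem_ofPred_eq, not_le] at hx
  exact Real.smoothTransition.zero_of_nonpos (by linarith)

theorem hasCompactSupport_cutoff (H : IsConservative b B Q) (R : ℝ) :
    HasCompactSupport (cutoff B Q R) :=
  (H.hasCompactSupport_transition R).smul_right

theorem eq_of_isODESol (H : IsConservative b B Q) {x y : ℝ → V} (hx : IsODESol B T x)
    (hy : IsODESol B T y) (h0 : x 0 = y 0) {t : ℝ} (ht : t ∈ Icc 0 T) : x t = y t := by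
  obtain ⟨K, hK⟩ := (H.contDiff_cutoff (Q (x 0))).lipschitzWith_of_hasCompactSupport
    (H.hasCompactSupport_cutoff _) (by simp)
  exact (H.isODESol_cutoff hx le_rfl).eq_of_lipschitz hK (H.isODESol_cutoff hy (by rw [h0])) h0 ht

theorem exists_cutoff (H : IsConservative b B Q) (hT : 0 ≤ T) (R : ℝ) (x₀ : V) :
    ∃ x : ℝ → V, x 0 = x₀ ∧ IsODESol (cutoff B Q R) T x := by
  obtain ⟨K, hK⟩ := (H.contDiff_cutoff R).lipschitzWith_of_hasCompactSupport
    (H.hasCompactSupport_cutoff _) (by simp)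
  obtain ⟨L, hL⟩ := (H.hasCompactSupport_cutoff R).exists_bound_of_continuous
    (H.contDiff_cutoff R).continuous
  exact exists_isODESol_of_lipschitz hK (L := L.toNNReal)
    (fun x => (hL x).trans (Real.le_coe_toNNReal L)) hT x₀

theorem exists_isODESol (H : IsConservative b B Q) (hT : 0 ≤ T) (x₀ : V) :
    ∃ x : ℝ → V, x 0 = x₀ ∧ IsODESol B T x := by
  obtain ⟨x, hx0, hx⟩ := H.exists_cutoff hT (Q x₀) x₀
  exact ⟨x, hx0, H.isODESol_of_cutoff hx (by rw [hx0])⟩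

/-- The flow of a conservative vector field on `[0, T]`. -/
def flow (H : IsConservative b B Q) (hT : 0 ≤ T) (t : ℝ) (x₀ : V) : V :=
  (H.exists_isODESol hT x₀).choose t

theorem flow_zero (H : IsConservative b B Q) (hT : 0 ≤ T) (x₀ : V) : H.flow hT 0 x₀ = x₀ :=
  (H.exists_isODESol hT x₀).choose_spec.1

theorem isODESol_flow (H : IsConservative b B Q) (hT : 0 ≤ T) (x₀ : V) :
    IsODESol B T fun t => H.flow hT t x₀ :=
  (H.exists_isODESol hT x₀).choose_spec.2

theorem quantity_flow (H : IsConservative b B Q) (hT : 0 ≤ T) (x₀ : V) {t : ℝ}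
    (ht : t ∈ Icc 0 T) : Q (H.flow hT t x₀) = Q x₀ := by
  rw [H.quantity_eq (H.isODESol_flow hT x₀) ht, H.flow_zero]

/-- The flow as a path in `C([0, T], V)`. -/
def flowPath (H : IsConservative b B Q) (hT : 0 ≤ T) (x₀ : V) : C(Icc (0 : ℝ) T, V) :=
  ⟨fun t => H.flow hT t x₀, (H.isODESol_flow hT x₀).continuousOn.domRestrict⟩

/-- For data near `x₀` all trajectories solve the same cutoff equation at level `Q x₀ + 1`. That
field is globally Lipschitz, so Grönwall bounds the distance of the paths uniformly in time. -/
theorem continuous_flowPath (H : IsConservative b B Q) (hT : 0 ≤ T) :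
    Continuous (H.flowPath hT) := by
  refine continuous_iff_continuousAt.2 fun x₀ => ?_
  obtain ⟨K, hK⟩ := (H.contDiff_cutoff (Q x₀ + 1)).lipschitzWith_of_hasCompactSupport
    (H.hasCompactSupport_cutoff _) (by simp)
  have hU : {x | Q x < Q x₀ + 1} ∈ 𝓝 x₀ :=
    (isOpen_lt H.quantity.continuous continuous_const).mem_nhds (by simp)
  have hlip : LipschitzOnWith (Real.exp (K * T)).toNNReal (H.flowPath hT)
      {x | Q x < Q x₀ + 1} := by
    refine LipschitzOnWith.of_dist_le_mul fun x hx y hy => ?_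
    rw [Real.coe_toNNReal _ (Real.exp_pos _).le]
    refine (ContinuousMap.dist_le (by positivity)).2 fun t => ?_
    have h := (H.isODESol_cutoff (R := Q x₀ + 1) (H.isODESol_flow hT x)
      (by rw [H.flow_zero]; exact le_of_lt hx)).dist_le hK
      (H.isODESol_cutoff (H.isODESol_flow hT y) (by rw [H.flow_zero]; exact le_of_lt hy)) t.2
    simp only [H.flow_zero] at h
    calc _ ≤ dist x y * Real.exp (K * t) := h
      _ ≤ dist x y * Real.exp (K * T) := by
        gcongr
        exact t.2.2
      _ = _ := mul_comm _ _
  exact hlip.continuousOn.continuousAt hU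

/-! ### Lebesgue measure under a conservative flow -/

variable [MeasurableSpace V] [BorelSpace V] {μ : Measure V} [μ.IsAddHaarMeasure]

/-- On `{Q ≤ R}` the flow agrees with that of the cutoff field, to which Liouville's theorem
applies. On `{Q > R}` both flows preserve `Q`, so `f` vanishes along either. -/
theorem integral_comp_flow (H : IsConservative b B Q) (hT : 0 ≤ T) {f : V → ℝ}
    (hf : ContDiff ℝ 1 f) {R : ℝ} (hfR : ∀ x, R < Q x → f x = 0) {t : ℝ} (ht : t ∈ Icc 0 T) :
    ∫ x, f (H.flow hT t x) ∂μ = ∫ x, f x ∂μ := by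
  have hfc : HasCompactSupport f := HasCompactSupport.intro (H.isCompact_sublevel R) fun x hx =>
    hfR x (not_le.1 hx)
  obtain ⟨C, hC⟩ := hf.lipschitzWith_of_hasCompactSupport hfc (by simp)
  choose φ hφ0 hφ using fun x₀ => H.exists_cutoff hT R x₀
  rw [← integral_comp_flow_eq (μ := μ) (H.contDiff_cutoff R) (H.hasCompactSupport_cutoff R) b
    (H.divergence_cutoff R) (φ := fun t x => φ x t) hφ0 hφ hC hfc ht]
  refine integral_congr_ae (ae_of_all _ fun x => ?_)
  simp only
  rcases le_or_gt (Q x) R with hx | hx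
  · rw [H.eq_of_isODESol (H.isODESol_flow hT x) (H.isODESol_of_cutoff (hφ x) (by rwa [hφ0]))
      (by rw [hφ0, H.flow_zero]) ht]
  · rw [hfR _ (by rwa [H.quantity_flow hT x ht]),
      hfR _ (by rwa [H.quantity_eq_of_smul (hφ x) ht, hφ0])]

/-- The observable need not have bounded support: it is multiplied by cutoffs in `Q`, for which
equality holds, and Fatou's lemma passes to the limit. An inequality is all that the moment bounds
require. -/
theorem lintegral_comp_flow_le (H : IsConservative b B Q) (hT : 0 ≤ T) {f : V → ℝ}
    (hf : ContDiff ℝ 1 f) (hf0 : ∀ x, 0 ≤ f x) {t : ℝ} (ht : t ∈ Icc 0 T) :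
    ∫⁻ x, ENNReal.ofReal (f (H.flow hT t x)) ∂μ ≤ ∫⁻ x, ENNReal.ofReal (f x) ∂μ := by
  let F : ℕ → V → ℝ := fun n x => Real.smoothTransition (n + 1 - Q x) * f x
  have hF : ∀ n, ContDiff ℝ 1 (F n) := fun n => (H.contDiff_transition n).mul hf
  have hF0 : ∀ n x, 0 ≤ F n x := fun n x => mul_nonneg (Real.smoothTransition.nonneg _) (hf0 x)
  have hFR : ∀ (n : ℕ) x, (n : ℝ) + 1 < Q x → F n x = 0 := fun n x hx => by
    simp only [F]
    rw [Real.smoothTransition.zero_of_nonpos (by linarith), zero_mul]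
  have hflow : Continuous fun x => H.flow hT t x :=
    (continuous_eval_const (F := C(Icc (0 : ℝ) T, V)) (⟨t, ht⟩ : Icc (0 : ℝ) T)).comp
      (H.continuous_flowPath hT)
  have hcs : ∀ n, HasCompactSupport (F n) := fun n =>
    (H.hasCompactSupport_transition n).mul_right
  have hcs' : ∀ n, HasCompactSupport fun x => F n (H.flow hT t x) := fun n =>
    HasCompactSupport.intro (H.isCompact_sublevel (n + 1)) fun x hx =>
      hFR n _ (by rw [H.quantity_flow hT x ht]; exact not_le.1 hx)
  have heq : ∀ n, ∫⁻ x, ENNReal.ofReal (F n (H.flow hT t x)) ∂μ ≤ ∫⁻ x, ENNReal.ofReal (f x) ∂μ := by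
    intro n
    have hi : Integrable (fun x => F n (H.flow hT t x)) μ :=
      ((hF n).continuous.comp hflow).integrable_of_hasCompactSupport (hcs' n)
    rw [← ofReal_integral_eq_lintegral_ofReal hi
      (ae_of_all _ fun x => hF0 n _), H.integral_comp_flow hT (hF n) (hFR n) ht,
      ofReal_integral_eq_lintegral_ofReal
      ((hF n).continuous.integrable_of_hasCompactSupport (hcs n)) (ae_of_all _ fun x => hF0 n _)]
    refine lintegral_mono fun x => ENNReal.ofReal_le_ofReal ?_
    exact mul_le_of_le_one_left (hf0 x) (Real.smoothTransition.le_one _)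
  have hlim : ∀ x, liminf (fun n => ENNReal.ofReal (F n (H.flow hT t x))) atTop =
      ENNReal.ofReal (f (H.flow hT t x)) := fun x => by
    refine Tendsto.liminf_eq (tendsto_const_nhds.congr' ?_)
    filter_upwards [eventually_ge_atTop ⌈Q (H.flow hT t x)⌉₊] with n hn
    have : Q (H.flow hT t x) ≤ n := (Nat.le_ceil _).trans (by exact_mod_cast hn)
    simp only [F]
    rw [Real.smoothTransition.one_of_one_le (by linarith), one_mul]
  calc _ = ∫⁻ x, liminf (fun n => ENNReal.ofReal (F n (H.flow hT t x))) atTop ∂μ := by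
        simp_rw [hlim]
    _ ≤ liminf (fun n => ∫⁻ x, ENNReal.ofReal (F n (H.flow hT t x)) ∂μ) atTop :=
        lintegral_liminf_le fun n =>
          (((hF n).continuous.comp hflow).measurable).ennreal_ofReal
    _ ≤ _ := liminf_le_of_le (by isBoundedDefault) fun c hc => by
        obtain ⟨n, hn⟩ := hc.exists
        exact hn.trans (heq n)

end IsConservative

/-! ### Frequencies -/

theorem absFreq_neg (k : Freq) : absFreq (-k) = absFreq k := by simp [absFreq]

@[simp] theorem absFreq_zero : absFreq 0 = 0 := by simp [absFreq]

theorem absFreq_sq (k : Freq) : absFreq k ^ 2 = (k.1 : ℝ) ^ 2 + (k.2 : ℝ) ^ 2 :=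
  Real.sq_sqrt (by positivity)

theorem one_le_absFreq {k : Freq} (hk : k ≠ 0) : 1 ≤ absFreq k := by
  have h1 : 0 < absFreq k ^ 2 := by have := absFreq_pos hk; positivity
  rw [absFreq_sq] at h1
  have h2 : (1 : ℝ) ≤ (k.1 : ℝ) ^ 2 + (k.2 : ℝ) ^ 2 := by
    have : (0 : ℤ) < k.1 ^ 2 + k.2 ^ 2 := by exact_mod_cast h1
    exact_mod_cast this
  exact Real.one_le_sqrt.2 h2

theorem absFreq_add_le (h k : Freq) : absFreq (h + k) ≤ absFreq h + absFreq k := by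
  have hh := absFreq_nonneg h
  have hk := absFreq_nonneg k
  refine le_of_abs_le (abs_le_of_sq_le_sq ?_ (by positivity))
  have h1 := absFreq_sq h
  have h2 := absFreq_sq k
  have h3 := absFreq_sq (h + k)
  simp only [Prod.fst_add, Prod.snd_add, Int.cast_add] at h3
  have h4 : (h.1 : ℝ) * k.1 + h.2 * k.2 ≤ absFreq h * absFreq k := by
    refine abs_le_of_sq_le_sq' ?_ (by positivity) |>.2
    rw [mul_pow, h1, h2]
    nlinarith [sq_nonneg ((h.1 : ℝ) * k.2 - h.2 * k.1)]
  nlinarith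

theorem abs_absFreq_sub_le (h k : Freq) : |absFreq (k - h) - absFreq h| ≤ absFreq k := by
  have h1 := absFreq_add_le (k - h) h
  have h2 := absFreq_add_le k (-h)
  have h3 := absFreq_add_le (h - k) k
  rw [absFreq_neg] at h2
  rw [sub_add_cancel] at h1 h3
  have h4 : absFreq (h - k) = absFreq (k - h) := by rw [← absFreq_neg, neg_sub]
  have h5 : absFreq (k - h) ≤ absFreq k + absFreq h := by rwa [sub_eq_add_neg]
  rw [abs_le]
  constructor <;> linarith

theorem neg_mem_box {N : ℕ} {k : Freq} : -k ∈ box N ↔ k ∈ box N := by simp [box]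

theorem finite_box (N : ℕ) : (box N).Finite := by
  refine (Set.finite_Icc ((-N, -N) : ℤ × ℤ) (N, N)).subset fun k hk => ?_
  have h := max_le_iff.1 (show max |k.1| |k.2| ≤ (N : ℤ) from hk)
  rw [abs_le, abs_le] at h
  exact ⟨⟨h.1.1, h.2.1⟩, ⟨h.1.2, h.2.2⟩⟩

/-- The box as a finite set. -/
def boxFinset (N : ℕ) : Finset Freq := (finite_box N).toFinset

@[simp] theorem mem_boxFinset {N : ℕ} {k : Freq} : k ∈ boxFinset N ↔ k ∈ box N :=
  (finite_box N).mem_toFinset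

theorem neg_notMem_halfLattice {k : Freq} (hk : k ∈ halfLattice) : -k ∉ halfLattice := by
  simp only [halfLattice, mem_ofPred_eq, Prod.fst_neg, Prod.snd_neg] at *
  omega

theorem mem_halfLattice_or {k : Freq} (hk : k ≠ 0) : k ∈ halfLattice ∨ -k ∈ halfLattice := by
  have : k.1 ≠ 0 ∨ k.2 ≠ 0 := by
    by_contra! h
    exact hk (Prod.ext h.1 h.2)
  simp only [halfLattice, mem_ofPred_eq, Prod.fst_neg, Prod.snd_neg]
  omega

theorem ne_zero_of_mem_halfLattice {k : Freq} (hk : k ∈ halfLattice) : k ≠ 0 := by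
  rintro rfl
  simp [halfLattice] at hk

theorem hermitianExtension_of_mem {z : Freq → ℂ} {k : Freq} (hk : k ∈ halfLattice) :
    hermitianExtension z k = z k := if_pos hk

theorem hermitianExtension_zero (z : Freq → ℂ) : hermitianExtension z 0 = 0 := by
  have h0 : (0 : Freq) ∉ halfLattice := fun h => ne_zero_of_mem_halfLattice h rfl
  simp [hermitianExtension, h0]

theorem hermitianExtension_neg (z : Freq → ℂ) (k : Freq) :
    hermitianExtension z (-k) = conj (hermitianExtension z k) := by
  rcases eq_or_ne k 0 with rfl | hk
  · simp [hermitianExtension_zero]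
  · rcases mem_halfLattice_or hk with h | h
    · simp [hermitianExtension, h, neg_notMem_halfLattice h]
    · have h' : k ∉ halfLattice := by simpa using neg_notMem_halfLattice h
      simp [hermitianExtension, h, h']

/-- Coefficient sequences of real mean-zero distributions. -/
def IsHermitian (ψ : Freq → ℂ) : Prop := ψ 0 = 0 ∧ ∀ k, ψ (-k) = conj (ψ k)

theorem isHermitian_hermitianExtension (z : Freq → ℂ) : IsHermitian (hermitianExtension z) :=
  ⟨hermitianExtension_zero z, hermitianExtension_neg z⟩

theorem IsHermitian.hermitianExtension_eq {ψ : Freq → ℂ} (hψ : IsHermitian ψ) {z : Freq → ℂ}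
    (h : ∀ k ∈ halfLattice, z k = ψ k) : hermitianExtension z = ψ := by
  funext k
  rcases eq_or_ne k 0 with rfl | hk
  · rw [hermitianExtension_zero, hψ.1]
  · rcases mem_halfLattice_or hk with h' | h'
    · rw [hermitianExtension_of_mem h', h k h']
    · have := hermitianExtension_neg z (-k)
      rw [neg_neg] at this
      rw [this, hermitianExtension_of_mem h', h _ h', hψ.2, Complex.conj_conj]

theorem IsHermitian.proj {ψ : Freq → ℂ} (hψ : IsHermitian ψ) (N : ℕ) : IsHermitian (proj N ψ) := by
  constructor
  · by_cases h : (0 : Freq) ∈ box N <;> simp [MSQG.proj, h, hψ.1]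
  · intro k
    by_cases h : k ∈ box N
    · have h' := neg_mem_box.2 h
      simp [MSQG.proj, h, h', hψ.2]
    · have h' := mt neg_mem_box.1 h
      simp [MSQG.proj, h, h']

/-! ### The truncated nonlinearity as a finite sum -/

/-- `h^⊥ · k` up to sign. -/
def cross (h k : Freq) : ℝ := h.2 * k.1 - h.1 * k.2

theorem cross_sub_left (h k : Freq) : cross (k - h) k = -cross h k := by
  simp [cross]; ring

@[simp] theorem cross_self (k : Freq) : cross k k = 0 := by simp [cross]; ring

@[simp] theorem cross_neg_left (h k : Freq) : cross (-h) k = -cross h k := by simp [cross]; ring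

@[simp] theorem cross_neg_right (h k : Freq) : cross h (-k) = -cross h k := by simp [cross]; ring

@[simp] theorem cross_zero_left (k : Freq) : cross 0 k = 0 := by simp [cross]

@[simp] theorem cross_zero_right (h : Freq) : cross h 0 = 0 := by simp [cross]

theorem cross_sub_right (h k : Freq) : cross h (k - h) = cross h k := by
  simp [cross]; ring

theorem abs_cross_le (h k : Freq) : |cross h k| ≤ absFreq h * absFreq k := by
  refine abs_le_of_sq_le_sq ?_ (mul_nonneg (absFreq_nonneg _) (absFreq_nonneg _))
  rw [mul_pow, absFreq_sq, absFreq_sq, cross]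
  nlinarith [sq_nonneg ((h.1 : ℝ) * k.1 + h.2 * k.2)]

/-- The coefficient of `ψ̂(h) ψ̂(k - h)` in `B(ψ)`. -/
def kernel (δ : ℝ) (k h : Freq) : ℝ :=
  -(absFreq k ^ (-1 : ℝ) * (cross h k * (absFreq h ^ (-δ) * absFreq (k - h))))

/-- The symmetrization of `kernel` under `h ↦ k - h`. -/
def symmKernel (δ : ℝ) (k h : Freq) : ℝ := (kernel δ k h + kernel δ k (k - h)) / 2

theorem kernel_neg (δ : ℝ) (k h : Freq) : kernel δ (-k) (-h) = kernel δ k h := by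
  have : -k - -h = -(k - h) := by ring
  rw [kernel, kernel, this]
  rw [absFreq_neg, absFreq_neg, absFreq_neg, cross_neg_left, cross_neg_right, neg_neg]

theorem proj_of_mem {N : ℕ} {ψ : Freq → ℂ} {k : Freq} (h : k ∈ box N) : proj N ψ k = ψ k :=
  indicator_of_mem h _

theorem proj_of_notMem {N : ℕ} {ψ : Freq → ℂ} {k : Freq} (h : k ∉ box N) : proj N ψ k = 0 :=
  indicator_of_notMem h _

theorem truncNonlinearity_of_notMem {δ : ℝ} {N : ℕ} {ψ : Freq → ℂ} {k : Freq} (h : k ∉ box N) :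
    truncNonlinearity δ N ψ k = 0 := proj_of_notMem h

theorem truncNonlinearity_eq {δ : ℝ} {N : ℕ} {ψ : Freq → ℂ} {k : Freq} (hk : k ∈ box N) :
    truncNonlinearity δ N ψ k =
      ∑ h ∈ boxFinset N, (kernel δ k h : ℂ) * (proj N ψ h * proj N ψ (k - h)) := by
  rw [truncNonlinearity, proj_of_mem hk]
  set p := proj N ψ with hp
  have hsum : ∀ f : Freq → ℂ, (∀ h, p h = 0 → f h = 0) → ∑' h, f h = ∑ h ∈ boxFinset N, f h :=
    fun f hf => tsum_eq_sum fun h hh =>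
      hf h (proj_of_notMem fun h' => hh (mem_boxFinset.2 h'))
  simp only [nonlinearity, fourierMul, Pi.neg_apply, Pi.add_apply, absD]
  rw [hsum _ fun h hh => by simp [partial₂, absD, hh], hsum _ fun h hh => by simp [partial₁, absD, hh],
    ← Finset.sum_add_distrib]
  rcases eq_or_ne k 0 with rfl | hk0
  · simp [kernel]
  · rw [if_neg hk0, Finset.mul_sum, ← Finset.sum_neg_distrib]
    refine Finset.sum_congr rfl fun h _ => ?_
    rcases eq_or_ne h 0 with rfl | hh
    · simp [partial₁, partial₂, kernel]
    rcases eq_or_ne (k - h) 0 with hkh | hkh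
    · rw [sub_eq_zero] at hkh
      subst hkh
      simp [partial₁, partial₂, kernel]
    · have hI : Complex.I * Complex.I = -1 := Complex.I_mul_I
      simp only [partial₁, partial₂, absD, if_neg hh, if_neg hkh, kernel, cross,
        Real.rpow_one]
      push_cast [Prod.fst_sub, Prod.snd_sub]
      linear_combination (-(((absFreq k ^ (-1 : ℝ) : ℝ) : ℂ) * ((absFreq h ^ (-δ) : ℝ) : ℂ) *
        (absFreq (k - h) : ℂ) * p h * p (k - h) * ((h.1 : ℂ) * k.2 - h.2 * k.1))) * hI

/-- The box is not invariant under `h ↦ k - h`, but terms with `h` or `k - h` outside it vanish. The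
sum therefore extends to the whole lattice, where the reflection is a bijection. -/
theorem sum_box_reindex {N : ℕ} (k : Freq) (f : Freq → Freq → ℂ)
    (hf : ∀ h, h ∉ box N ∨ k - h ∉ box N → f h (k - h) = 0) :
    ∑ h ∈ boxFinset N, f h (k - h) = ∑ h ∈ boxFinset N, f (k - h) h := by
  have h1 : ∑ h ∈ boxFinset N, f h (k - h) = ∑' h, f h (k - h) :=
    (tsum_eq_sum fun h hh => hf h (Or.inl fun h' => hh (mem_boxFinset.2 h'))).symm
  have h2 : ∑ h ∈ boxFinset N, f (k - h) h = ∑' h, f (k - h) h :=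
    (tsum_eq_sum fun h hh => by
      have := hf (k - h) (Or.inr fun h' => hh (mem_boxFinset.2 (by simpa using h')))
      simpa using this).symm
  rw [h1, h2, ← (Equiv.subLeft k).tsum_eq]
  simp

/-- The product `ψ_h ψ_{k-h}` is symmetric under `h ↦ k - h`, so the kernel may be averaged. Since
`cross` changes sign under the reflection, the average contains a difference of two terms, and this
is the source of the cancellation. -/
theorem truncNonlinearity_eq_symm {δ : ℝ} {N : ℕ} {ψ : Freq → ℂ} {k : Freq} (hk : k ∈ box N) :
    truncNonlinearity δ N ψ k =
      ∑ h ∈ boxFinset N, (symmKernel δ k h : ℂ) * (proj N ψ h * proj N ψ (k - h)) := by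
  have h1 := truncNonlinearity_eq (δ := δ) (ψ := ψ) hk
  have h2 := sum_box_reindex (N := N) k
    (fun h l => (kernel δ k h : ℂ) * (proj N ψ h * proj N ψ l)) fun h hh => by
      rcases hh with hh | hh <;> simp [proj_of_notMem hh]
  have h3 : ∑ h ∈ boxFinset N, (symmKernel δ k h : ℂ) * (proj N ψ h * proj N ψ (k - h)) =
      (∑ h ∈ boxFinset N, (kernel δ k h : ℂ) * (proj N ψ h * proj N ψ (k - h)) +
      ∑ h ∈ boxFinset N, (kernel δ k (k - h) : ℂ) * (proj N ψ (k - h) * proj N ψ h)) / 2 := by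
    rw [← Finset.sum_add_distrib, Finset.sum_div]
    refine Finset.sum_congr rfl fun h _ => ?_
    rw [symmKernel]
    push_cast
    ring
  rw [h3, ← h2, ← h1]
  ring

theorem truncNonlinearity_zero {δ : ℝ} {N : ℕ} {ψ : Freq → ℂ} :
    truncNonlinearity δ N ψ 0 = 0 := by
  rw [truncNonlinearity_eq (by simp [box])]
  simp [kernel]

theorem isHermitian_truncNonlinearity {δ : ℝ} {N : ℕ} {ψ : Freq → ℂ} (hψ : IsHermitian ψ) :
    IsHermitian (truncNonlinearity δ N ψ) := by
  refine ⟨truncNonlinearity_zero, fun k => ?_⟩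
  by_cases hk : k ∈ box N
  · rw [truncNonlinearity_eq hk, truncNonlinearity_eq (neg_mem_box.2 hk), map_sum]
    refine Finset.sum_nbij' (fun h => -h) (fun h => -h) (fun h hh => ?_) (fun h hh => ?_)
      (fun h _ => neg_neg h) (fun h _ => neg_neg h) fun h _ => ?_
    · simpa [neg_mem_box] using hh
    · simpa [neg_mem_box] using hh
    · have h1 : -k - h = -(k - -h) := by ring
      have h2 : kernel δ (-k) h = kernel δ k (-h) := by
        rw [← kernel_neg δ k (-h), neg_neg]
      have h3 := (hψ.proj N).2 (-h)
      rw [neg_neg] at h3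
      rw [h1, (hψ.proj N).2 (k - -h), h2, map_mul, map_mul, Complex.conj_ofReal, h3]
  · rw [truncNonlinearity_of_notMem hk, truncNonlinearity_of_notMem (mt neg_mem_box.1 hk), map_zero]

theorem proj_proj (N : ℕ) (ψ : Freq → ℂ) : proj N (proj N ψ) = proj N ψ := by
  simp [proj, indicator_indicator]

theorem truncNonlinearity_proj (δ : ℝ) (N : ℕ) (ψ : Freq → ℂ) :
    truncNonlinearity δ N (proj N ψ) = truncNonlinearity δ N ψ := by
  rw [truncNonlinearity, truncNonlinearity, proj_proj]

/-- Conservation of the `H¹` norm. -/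
theorem sum_conj_mul_truncNonlinearity {δ : ℝ} {N : ℕ} {ψ : Freq → ℂ} (hψ : IsHermitian ψ) :
    ∑ k ∈ boxFinset N, ((absFreq k ^ 2 : ℝ) : ℂ) * (conj (ψ k) * truncNonlinearity δ N ψ k) = 0 := by
  set p := proj N ψ with hp
  let θ : Freq → ℂ := fun k => (absFreq k : ℂ) * p k
  have hθ : ∀ k, k ∉ box N → θ k = 0 := fun k hk => by simp [θ, hp, proj_of_notMem hk]
  have h1 : ∀ k ∈ boxFinset N,
      ((absFreq k ^ 2 : ℝ) : ℂ) * (conj (ψ k) * truncNonlinearity δ N ψ k) =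
      ∑ h ∈ boxFinset N, -(((absFreq h ^ (-δ) : ℝ) : ℂ) * p h) *
        ((cross h k : ℂ) * (θ (-k) * θ (k - h))) := fun k hk => by
    have hk' := mem_boxFinset.1 hk
    rw [truncNonlinearity_eq hk', Finset.mul_sum, Finset.mul_sum]
    refine Finset.sum_congr rfl fun h _ => ?_
    have hc : conj (ψ k) = p (-k) := by rw [hp, (hψ.proj N).2, proj_of_mem hk']
    have hker : absFreq k ^ 2 * kernel δ k h =
        -(absFreq h ^ (-δ)) * (cross h k * (absFreq k * absFreq (k - h))) := by
      rcases eq_or_ne k 0 with rfl | hk0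
      · simp
      · have := absFreq_pos hk0
        rw [kernel, Real.rpow_neg_one]
        field_simp
    rw [hc]
    simp only [θ, absFreq_neg]
    have hker' : ((absFreq k ^ 2 : ℝ) : ℂ) * (kernel δ k h : ℂ) =
        -((absFreq h ^ (-δ) : ℝ) : ℂ) * ((cross h k : ℂ) * ((absFreq k : ℂ) *
          (absFreq (k - h) : ℂ))) := by exact_mod_cast hker
    linear_combination (p (-k) * p h * p (k - h)) * hker'
  rw [Finset.sum_congr rfl h1, Finset.sum_comm]
  refine Finset.sum_eq_zero fun h _ => ?_
  rw [← Finset.mul_sum]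
  refine mul_eq_zero_of_right _ ?_
  have h2 : ∀ f : Freq → ℂ, (∀ k, k ∉ box N → f k = 0) → ∑ k ∈ boxFinset N, f k = ∑' k, f k :=
    fun f hf => (tsum_eq_sum fun k hk => hf k fun h' => hk (mem_boxFinset.2 h')).symm
  rw [h2 _ fun k hk => by simp [hθ (-k) (mt neg_mem_box.1 hk)]]
  -- The reflection `k ↦ h - k` exchanges the two factors `θ` and reverses the sign of `cross h k`,
  -- so the sum equals its own negative.
  have h3 : ∑' k, (cross h k : ℂ) * (θ (-k) * θ (k - h)) =
      - ∑' k, (cross h k : ℂ) * (θ (-k) * θ (k - h)) := by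
    conv_lhs => rw [← (Equiv.subLeft h).tsum_eq]
    rw [← tsum_neg]
    refine tsum_congr fun k => ?_
    have h4 : cross h (h - k) = -cross h k := by simp [cross]; ring
    have h5 : -(h - k) = k - h := by ring
    have h6 : h - k - h = -k := by ring
    simp only [Equiv.subLeft_apply, h4, h5, h6]
    push_cast
    ring
  exact self_eq_neg.1 h3

/-! ### Size of the symmetrized kernel -/

/-- Split the difference as `a^{-δ}(b - a) + (a^{-δ} - b^{-δ}) a`. Each part is at most `a^{-δ}(b -
a)`; the second uses `(a/b)^δ ≥ a/b`, which is where `δ ≤ 1` enters. -/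
theorem abs_rpow_mul_sub_le {δ a b : ℝ} (hδ : 0 < δ) (hδ' : δ ≤ 1) (ha : 0 < a) (hab : a ≤ b) :
    |a ^ (-δ) * b - b ^ (-δ) * a| ≤ 2 * a ^ (-δ) * (b - a) := by
  have hb : 0 < b := ha.trans_le hab
  have h1 : b ^ (-δ) ≤ a ^ (-δ) := Real.rpow_le_rpow_of_nonpos ha hab (by linarith)
  have hap : 0 < a ^ (-δ) := Real.rpow_pos_of_pos ha _
  have hbp : 0 < b ^ (-δ) := Real.rpow_pos_of_pos hb _
  have h2 : a ^ (-δ) * (a / b) ≤ b ^ (-δ) := by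
    have h3 : a / b ≤ (a / b) ^ δ := by
      have h4 := Real.rpow_le_rpow_of_exponent_ge (div_pos ha hb) ((div_le_one hb).2 hab) hδ'
      rwa [Real.rpow_one] at h4
    calc _ ≤ a ^ (-δ) * (a / b) ^ δ := by gcongr
      _ = b ^ (-δ) := by
        rw [Real.div_rpow ha.le hb.le, Real.rpow_neg ha.le, Real.rpow_neg hb.le]
        have := Real.rpow_pos_of_pos ha δ
        have := Real.rpow_pos_of_pos hb δ
        field_simp
  rw [abs_of_nonneg (sub_nonneg.2 (by gcongr))]
  have h5 : a ^ (-δ) * a - b ^ (-δ) * a ≤ a ^ (-δ) * (b - a) := by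
    have h6 : b ^ (-δ) * a ≥ a ^ (-δ) * (a / b) * a := by gcongr
    have h7 : a - a / b * a ≤ b - a := by
      have : b - a - (a - a / b * a) = (b - a) ^ 2 / b := by field_simp
      have h8 : 0 ≤ (b - a) ^ 2 / b := by positivity
      linarith
    nlinarith
  linarith

/-- Here `a` and `b` are the smaller and larger of `|h|` and `|k-h|`, `c = |k|` and `x` is the cross
product. The kernel is at most `c a^{1-δ}`. After squaring, `a²` is weakened to `b²` so that the
factor `a² b²` appears, which later cancels against the Gaussian variances. -/
theorem sq_min_bound {δ a b c x : ℝ} (hδ : 0 < δ) (hδ' : δ ≤ 1) (ha : 0 < a) (hc : 0 < c)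
    (hab : a ≤ b) (hba : b - a ≤ c) (hx : |x| ≤ a * c) :
    (c ^ (-1 : ℝ) * (x * (a ^ (-δ) * b - b ^ (-δ) * a)) / 2) ^ 2 ≤
      c ^ 2 * (a ^ 2 * b ^ 2 * a ^ (-(2 + 2 * δ))) := by
  have hb : 0 < b := ha.trans_le hab
  have h1 := abs_rpow_mul_sub_le hδ hδ' ha hab
  have hap : 0 < a ^ (-δ) := Real.rpow_pos_of_pos ha _
  have h2 : |c ^ (-1 : ℝ) * (x * (a ^ (-δ) * b - b ^ (-δ) * a)) / 2| ≤ a * (a ^ (-δ) * c) := by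
    rw [abs_div, abs_mul, abs_mul, Real.rpow_neg_one, abs_of_pos (inv_pos.2 hc), abs_two]
    calc _ ≤ c⁻¹ * ((a * c) * (2 * a ^ (-δ) * c)) / 2 := by
          gcongr
          exact h1.trans (by gcongr)
      _ = _ := by field_simp
  have h3 : a ^ (-(2 + 2 * δ)) = (a ^ 2)⁻¹ * (a ^ (-δ)) ^ 2 := by
    rw [← Real.rpow_natCast (a ^ (-δ)), ← Real.rpow_mul ha.le, ← Real.rpow_natCast a,
      ← Real.rpow_neg ha.le, ← Real.rpow_add ha]
    congr 1
    push_cast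
    ring
  calc _ = |c ^ (-1 : ℝ) * (x * (a ^ (-δ) * b - b ^ (-δ) * a)) / 2| ^ 2 := (sq_abs _).symm
    _ ≤ (a * (a ^ (-δ) * c)) ^ 2 := by gcongr
    _ = c ^ 2 * (a ^ 2 * (a ^ (-δ)) ^ 2) := by ring
    _ ≤ c ^ 2 * (b ^ 2 * (a ^ (-δ)) ^ 2) := by gcongr
    _ = _ := by rw [h3]; field_simp

/-- The smaller of `|h|` and `|k-h|` governs the bound. Adding both powers covers the two cases with
a symmetric expression that is summable in `h`. -/
theorem symmKernel_sq_le {δ : ℝ} (hδ : 0 < δ) (hδ' : δ ≤ 1) {k h : Freq} (hk : k ≠ 0) (hh : h ≠ 0)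
    (hkh : k - h ≠ 0) :
    symmKernel δ k h ^ 2 ≤ absFreq k ^ 2 * (absFreq h ^ 2 * absFreq (k - h) ^ 2 *
      (absFreq h ^ (-(2 + 2 * δ)) + absFreq (k - h) ^ (-(2 + 2 * δ)))) := by
  have h1 : symmKernel δ k h = -(absFreq k ^ (-1 : ℝ) * (cross h k *
      (absFreq h ^ (-δ) * absFreq (k - h) - absFreq (k - h) ^ (-δ) * absFreq h)) / 2) := by
    have : k - (k - h) = h := by ring
    simp only [symmKernel, kernel, cross_sub_left, this]
    ring
  have h2 : symmKernel δ k h = -(absFreq k ^ (-1 : ℝ) * (cross (k - h) k *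
      (absFreq (k - h) ^ (-δ) * absFreq h - absFreq h ^ (-δ) * absFreq (k - h))) / 2) := by
    rw [h1, cross_sub_left]
    ring
  have ha := absFreq_pos hh
  have hb := absFreq_pos hkh
  have hc := absFreq_pos hk
  have hd := abs_le.1 (abs_absFreq_sub_le h k)
  have hap : 0 < absFreq h ^ (-(2 + 2 * δ)) := Real.rpow_pos_of_pos ha _
  have hbp : 0 < absFreq (k - h) ^ (-(2 + 2 * δ)) := Real.rpow_pos_of_pos hb _
  rcases le_total (absFreq h) (absFreq (k - h)) with hab | hab
  · rw [h1, neg_sq]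
    refine (sq_min_bound hδ hδ' ha hc hab hd.2 (abs_cross_le h k)).trans ?_
    gcongr
    linarith
  · rw [h2, neg_sq]
    refine (sq_min_bound hδ hδ' hb hc hab (by linarith) (abs_cross_le (k - h) k)).trans ?_
    rw [mul_comm (absFreq (k - h) ^ 2)]
    gcongr
    linarith

/-! ### The truncated equation as a conservative vector field -/

/-- The frequencies of the box in the half lattice. -/
abbrev Half (N : ℕ) : Type := {k : Freq // k ∈ halfLattice ∧ k ∈ box N}

instance (N : ℕ) : Finite (Half N) := ((finite_box N).subset fun _ h => h.2).to_subtype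

instance (N : ℕ) : Fintype (Half N) := Fintype.ofFinite _

instance (N : ℕ) : DecidableEq (Half N) := Classical.decEq _

/-- The phase space of the truncated equation. -/
abbrev Phase (N : ℕ) : Type := Half N → ℂ

/-- The coefficients in `Half N`. -/
def restrictHalf (N : ℕ) (ψ : Freq → ℂ) : Phase N := fun k => ψ k

open Classical in
/-- Extension by zero to the frequency lattice. -/
def zeroExtension (N : ℕ) (x : Phase N) : Freq → ℂ := fun k =>
  if h : k ∈ halfLattice ∧ k ∈ box N then x ⟨k, h⟩ else 0

/-- The trigonometric polynomial with given coefficients in `Half N`. -/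
def trigPoly (N : ℕ) : Phase N →ₗ[ℝ] (Freq → ℂ) where
  toFun x := hermitianExtension (zeroExtension N x)
  map_add' x y := by
    funext k
    simp only [hermitianExtension, zeroExtension, Pi.add_apply]
    split_ifs <;> simp
  map_smul' c x := by
    funext k
    simp only [hermitianExtension, zeroExtension, Pi.smul_apply, RingHom.id_apply]
    split_ifs <;> simp

theorem isHermitian_trigPoly {N : ℕ} (x : Phase N) : IsHermitian (trigPoly N x) :=
  isHermitian_hermitianExtension _

theorem trigPoly_apply_coe {N : ℕ} (x : Phase N) (k : Half N) : trigPoly N x k = x k := by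
  change hermitianExtension (zeroExtension N x) k = x k
  rw [hermitianExtension_of_mem k.2.1, zeroExtension, dif_pos k.2]

theorem trigPoly_restrictHalf {N : ℕ} {ψ : Freq → ℂ} (hψ : IsHermitian ψ) :
    trigPoly N (restrictHalf N ψ) = proj N ψ := by
  refine (hψ.proj N).hermitianExtension_eq fun k hk => ?_
  by_cases h : k ∈ box N
  · rw [zeroExtension, dif_pos ⟨hk, h⟩, proj_of_mem h]; rfl
  · rw [zeroExtension, dif_neg fun h' => h h'.2, proj_of_notMem h]

theorem restrictHalf_trigPoly {N : ℕ} (x : Phase N) : restrictHalf N (trigPoly N x) = x :=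
  funext fun k => trigPoly_apply_coe x k

theorem proj_trigPoly {N : ℕ} (x : Phase N) : proj N (trigPoly N x) = trigPoly N x := by
  rw [← trigPoly_restrictHalf (isHermitian_trigPoly x), restrictHalf_trigPoly]

theorem trigPoly_of_notMem {N : ℕ} (x : Phase N) {k : Freq} (hk : k ∉ box N) :
    trigPoly N x k = 0 := by
  rw [← proj_trigPoly, proj_of_notMem hk]

/-- The Fourier coefficient at `k` as a continuous linear functional. -/
def trigCoeff (N : ℕ) (k : Freq) : Phase N →L[ℝ] ℂ :=
  LinearMap.toContinuousLinearMap (LinearMap.proj k ∘ₗ trigPoly N)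

theorem trigCoeff_apply {N : ℕ} (k : Freq) (x : Phase N) : trigCoeff N k x = trigPoly N x k := rfl

theorem sum_boxFinset {M : Type*} [AddCommMonoid M] (N : ℕ) (g : Freq → M) :
    ∑ k ∈ boxFinset N, g k = g 0 + ∑ k : Half N, (g k + g (-k)) := by
  classical
  have h0 : (0 : Freq) ∈ boxFinset N := by simp [box]
  have hsplit : boxFinset N = insert 0 ((boxFinset N).filter (· ∈ halfLattice) ∪
      (boxFinset N).filter (fun k => -k ∈ halfLattice)) := by
    ext k
    simp only [Finset.mem_insert, Finset.mem_union, Finset.mem_filter]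
    constructor
    · intro h
      rcases eq_or_ne k 0 with hk | hk
      · exact Or.inl hk
      · exact Or.inr ((mem_halfLattice_or hk).imp (⟨h, ·⟩) (⟨h, ·⟩))
    · rintro (rfl | h | h)
      · exact h0
      · exact h.1
      · exact h.1
  have hdisj : Disjoint ((boxFinset N).filter (· ∈ halfLattice))
      ((boxFinset N).filter (fun k => -k ∈ halfLattice)) := by
    refine Finset.disjoint_left.2 fun k hk hk' => ?_
    exact neg_notMem_halfLattice (Finset.mem_filter.1 hk).2 (Finset.mem_filter.1 hk').2
  have hn0 : (0 : Freq) ∉ (boxFinset N).filter (· ∈ halfLattice) ∪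
      (boxFinset N).filter (fun k => -k ∈ halfLattice) := by
    have h : (0 : Freq) ∉ halfLattice := fun h => ne_zero_of_mem_halfLattice h rfl
    simp [h]
  rw [hsplit, Finset.sum_insert hn0, Finset.sum_union hdisj, Finset.sum_add_distrib]
  congr 1
  congr 1
  · refine Finset.sum_bij' (fun k hk => (⟨k, (Finset.mem_filter.1 hk).2,
      mem_boxFinset.1 (Finset.mem_filter.1 hk).1⟩ : Half N)) (fun k _ => k) ?_ ?_ ?_ ?_ ?_
    · simp
    · intro k _
      simpa using k.2.symm
    · simp
    · simp
    · simp
  · refine Finset.sum_bij' (fun k hk => (⟨-k, (Finset.mem_filter.1 hk).2,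
      neg_mem_box.2 (mem_boxFinset.1 (Finset.mem_filter.1 hk).1)⟩ : Half N))
      (fun k _ => -k) ?_ ?_ ?_ ?_ ?_
    · simp
    · intro k _
      simpa [neg_mem_box] using k.2.symm
    · simp
    · simp
    · simp

/-- The truncated nonlinearity on the phase space. -/
def truncField (δ : ℝ) (N : ℕ) : Phase N → Phase N := fun x =>
  restrictHalf N (truncNonlinearity δ N (trigPoly N x))

theorem trigPoly_truncField (δ : ℝ) (N : ℕ) (x : Phase N) :
    trigPoly N (truncField δ N x) = truncNonlinearity δ N (trigPoly N x) := by
  rw [truncField, trigPoly_restrictHalf (isHermitian_truncNonlinearity (isHermitian_trigPoly x)),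
    truncNonlinearity, proj_proj]

/-- Half of the squared `H¹` norm. -/
def energy (N : ℕ) : Phase N → ℝ := fun x => ∑ k : Half N, absFreq k ^ 2 * ‖x k‖ ^ 2

/-- A real basis of the phase space. -/
def phaseBasis (N : ℕ) : Module.Basis (Σ _ : Half N, Fin 2) ℝ (Phase N) :=
  Pi.basis fun _ => Complex.basisOneI

theorem truncNonlinearity_trigPoly {δ : ℝ} {N : ℕ} (x : Phase N) {k : Freq} (hk : k ∈ box N) :
    truncNonlinearity δ N (trigPoly N x) k =
      ∑ h ∈ boxFinset N, (kernel δ k h : ℂ) * (trigCoeff N h x * trigCoeff N (k - h) x) := by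
  rw [truncNonlinearity_eq hk, proj_trigPoly]; rfl

theorem contDiff_truncField (δ : ℝ) (N : ℕ) : ContDiff ℝ 1 (truncField δ N) := by
  refine contDiff_pi.2 fun k => ?_
  have : (fun x => truncField δ N x k) = fun x => ∑ h ∈ boxFinset N,
      (kernel δ k h : ℂ) * (trigCoeff N h x * trigCoeff N (k - h) x) :=
    funext fun x => truncNonlinearity_trigPoly x k.2.2
  rw [this]
  refine ContDiff.sum fun h _ => contDiff_const.mul ?_
  exact (trigCoeff N h).contDiff.mul (trigCoeff N _).contDiff

theorem contDiff_energy (N : ℕ) : ContDiff ℝ 1 (energy N) :=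
  ContDiff.sum fun k _ => contDiff_const.mul ((contDiff_apply ℝ ℂ k).norm_sq ℝ)

theorem fderiv_energy {N : ℕ} (x v : Phase N) :
    fderiv ℝ (energy N) x v = ∑ k : Half N, absFreq k ^ 2 * (2 * (conj (x k) * v k).re) := by
  have h1 : ∀ k : Half N, HasFDerivAt (fun y : Phase N => absFreq k ^ 2 * ‖y k‖ ^ 2)
      (absFreq k ^ 2 • (2 • (innerSL ℝ (x k)).comp (ContinuousLinearMap.proj k))) x := fun k =>
    (((ContinuousLinearMap.proj (R := ℝ) (φ := fun _ : Half N => ℂ) k).hasFDerivAt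
      (x := x)).norm_sq).const_mul _
  have h2 := HasFDerivAt.fun_sum (u := Finset.univ) fun k (_ : k ∈ Finset.univ) => h1 k
  rw [show fderiv ℝ (energy N) x = _ from h2.fderiv]
  simp only [sum_apply, smul_apply, ContinuousLinearMap.comp_apply, smul_eq_mul, nsmul_eq_mul,
    Nat.cast_ofNat, innerSL_apply_apply, Complex.inner, ContinuousLinearMap.proj_apply]
  exact Finset.sum_congr rfl fun k _ => by rw [mul_comm (v k)]

theorem fderiv_energy_truncField (δ : ℝ) {N : ℕ} (x : Phase N) :
    fderiv ℝ (energy N) x (truncField δ N x) = 0 := by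
  have h := sum_conj_mul_truncNonlinearity (δ := δ) (N := N) (isHermitian_trigPoly x)
  have hB := isHermitian_truncNonlinearity (δ := δ) (N := N) (isHermitian_trigPoly x)
  rw [sum_boxFinset] at h
  have h' := congrArg Complex.re h
  rw [fderiv_energy]
  simp only [absFreq_zero, Complex.add_re, Complex.re_sum] at h'
  rw [Complex.zero_re] at h'
  rw [← h']
  simp only [truncNonlinearity_zero, mul_zero, Complex.zero_re, zero_add]
  refine Finset.sum_congr rfl fun k _ => ?_
  rw [absFreq_neg, hB.2, (isHermitian_trigPoly x).2, Complex.re_ofReal_mul, Complex.re_ofReal_mul,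
    trigPoly_apply_coe]
  change _ = absFreq k ^ 2 * (conj (x k) * truncField δ N x k).re +
    absFreq k ^ 2 * (conj (conj (x k)) * conj (truncField δ N x k)).re
  rw [← map_mul, Complex.conj_re]
  ring

theorem norm_sq_le_energy {N : ℕ} (x : Phase N) (k : Half N) : ‖x k‖ ^ 2 ≤ energy N x := by
  have h1 : absFreq k ^ 2 * ‖x k‖ ^ 2 ≤ energy N x :=
    Finset.single_le_sum (f := fun k : Half N => absFreq k ^ 2 * ‖x k‖ ^ 2)
      (fun k _ => by positivity) (Finset.mem_univ k)
  have h2 : 1 ≤ absFreq k ^ 2 := one_le_pow₀ (one_le_absFreq (ne_zero_of_mem_halfLattice k.2.1))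
  nlinarith [sq_nonneg ‖x k‖]

theorem isBounded_energy_le (N : ℕ) (R : ℝ) : Bornology.IsBounded {x | energy N x ≤ R} := by
  refine isBounded_iff_forall_norm_le.2 ⟨Real.sqrt R, fun x hx => ?_⟩
  exact (pi_norm_le_iff_of_nonneg (Real.sqrt_nonneg _)).2 fun k =>
    Real.le_sqrt_of_sq_le ((norm_sq_le_energy x k).trans hx)

theorem trigPoly_single_of_ne {N : ℕ} (k : Half N) (c : ℂ) {h : Freq} (h1 : h ≠ k) (h2 : h ≠ -k) :
    trigPoly N (Pi.single k c) h = 0 := by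
  have key : ∀ l : Freq, l ≠ k → zeroExtension N (Pi.single k c) l = 0 := fun l hl => by
    rw [zeroExtension]
    split_ifs with h
    · exact Pi.single_eq_of_ne (fun h' => hl (congrArg Subtype.val h')) _
    · rfl
  change hermitianExtension _ h = 0
  rw [hermitianExtension, key h h1, key (-h) fun h' => h2 (by rw [← h', neg_neg])]
  simp

/-- The component of the nonlinearity at `k` does not depend on the coefficients at `±k`. -/
theorem truncField_add_single (δ : ℝ) {N : ℕ} (x : Phase N) (k : Half N) (c : ℂ) :
    truncField δ N (x + Pi.single k c) k = truncField δ N x k := by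
  change truncNonlinearity δ N (trigPoly N _) k = truncNonlinearity δ N (trigPoly N x) k
  rw [truncNonlinearity_trigPoly _ k.2.2, truncNonlinearity_trigPoly _ k.2.2]
  refine Finset.sum_congr rfl fun h _ => ?_
  -- If `h` is parallel to `k` the kernel vanishes. Otherwise neither `h` nor `k - h` is parallel to
  -- `k`, so neither equals `±k`.
  by_cases hc : cross h k = 0
  · simp [kernel, hc]
  have key : ∀ l : Freq, cross l k ≠ 0 → trigCoeff N l (x + Pi.single k c) = trigCoeff N l x := by
    intro l hl
    rw [map_add, trigCoeff_apply l (Pi.single k c), trigPoly_single_of_ne, add_zero]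
    · rintro rfl; simp at hl
    · rintro rfl; simp at hl
  rw [key h hc, key (k - h) (by rw [cross_sub_left]; exact neg_ne_zero.2 hc)]

/-- Every diagonal entry of the Jacobian vanishes by itself, since each component is independent of
its own coordinate. -/
theorem divergence_truncField (δ : ℝ) {N : ℕ} (x : Phase N) :
    ∑ j, (phaseBasis N).repr (fderiv ℝ (truncField δ N) x (phaseBasis N j)) j = 0 := by
  refine Finset.sum_eq_zero fun j _ => ?_
  obtain ⟨k, i⟩ := j
  have h1 : phaseBasis N ⟨k, i⟩ = Pi.single k (Complex.basisOneI i) := by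
    rw [phaseBasis, Pi.basis_apply]
  have h2 : fderiv ℝ (truncField δ N) x (phaseBasis N ⟨k, i⟩) k = 0 := by
    have h3 := ((contDiff_truncField δ N).differentiable (by simp) x).hasFDerivAt.hasLineDerivAt
      (phaseBasis N ⟨k, i⟩)
    have h4 := (hasDerivAt_pi.1 h3) k
    have h5 : (fun t : ℝ => truncField δ N (x + t • phaseBasis N ⟨k, i⟩) k) =
        fun _ => truncField δ N x k := by
      funext t
      rw [h1, ← Pi.single_smul, truncField_add_single]
    rw [h5] at h4
    exact h4.unique (hasDerivAt_const _ _)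
  rw [phaseBasis, Pi.basis_repr]
  rw [phaseBasis] at h2
  rw [h2]
  simp

theorem isConservative_truncField (δ : ℝ) (N : ℕ) :
    IsConservative (phaseBasis N) (truncField δ N) (energy N) where
  field := contDiff_truncField δ N
  quantity := contDiff_energy N
  conserved := fderiv_energy_truncField δ
  bounded := isBounded_energy_le N
  divergence := divergence_truncField δ

/-! ### The law of one Fourier coefficient -/

/-- The law of a complex number with independent standard Gaussian real and imaginary parts. -/
def stdLaw : Measure ℂ :=
  ((gaussianReal 0 1).prod (gaussianReal 0 1)).map fun p => ⟨p.1, p.2⟩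

instance : IsProbabilityMeasure stdLaw :=
  Measure.isProbabilityMeasure_map measurable_mk_complex.aemeasurable

/-- The standard deviation of the real part of the coefficient at `k`. -/
def stdDev (β : ℝ) (k : Freq) : ℝ := Real.sqrt (1 / (4 * β * absFreq k ^ 2))

theorem stdDev_sq {β : ℝ} (hβ : 0 < β) (k : Freq) :
    stdDev β k ^ 2 = 1 / (4 * β * absFreq k ^ 2) :=
  Real.sq_sqrt (by positivity)

/-- Scaling reduces all moments to those of one law. The identity includes `k = 0`: division by zero
makes the variance and `stdDev` zero, and both sides are the point mass at the origin. -/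
theorem coordLaw_eq_map {β : ℝ} (hβ : 0 < β) (k : Freq) :
    coordLaw β k = stdLaw.map fun z => (stdDev β k : ℂ) * z := by
  have h1 : gaussianReal 0 (1 / (4 * β * absFreq k ^ 2)).toNNReal =
      (gaussianReal 0 1).map (stdDev β k * ·) := by
    rw [gaussianReal_map_const_mul, mul_zero, mul_one]
    congr 1
    ext
    rw [Real.coe_toNNReal _ (by positivity), ← stdDev_sq hβ]
    rfl
  rw [coordLaw, stdLaw, h1, Measure.map_prod_map _ _ (by fun_prop) (by fun_prop),
    Measure.map_map measurable_mk_complex (by fun_prop),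
    Measure.map_map (by fun_prop) measurable_mk_complex]
  congr 1
  funext p
  apply Complex.ext <;> simp

/-- Multiplication by `i` sends `(x, y)` to `(-y, x)`: a swap and a reflection. This quarter turn is
the only rotational symmetry used in the orthogonality argument. -/
theorem stdLaw_map_I_mul : stdLaw.map (fun z => Complex.I * z) = stdLaw := by
  have h1 : ((gaussianReal 0 1).prod (gaussianReal 0 1)).map (fun p : ℝ × ℝ => (-p.2, p.1)) =
      (gaussianReal 0 1).prod (gaussianReal 0 1) := by
    have h2 : (fun p : ℝ × ℝ => (-p.2, p.1)) = (Prod.map (fun x => -x) id) ∘ Prod.swap := rfl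
    rw [h2, ← Measure.map_map (by fun_prop) measurable_swap, Measure.prod_swap,
      ← Measure.map_prod_map _ _ (by fun_prop) measurable_id, gaussianReal_map_neg, neg_zero,
      Measure.map_id]
  conv_rhs => rw [stdLaw, ← h1, Measure.map_map measurable_mk_complex (by fun_prop)]
  rw [stdLaw, Measure.map_map (by fun_prop) measurable_mk_complex]
  congr 1
  funext p
  apply Complex.ext <;> simp

theorem measurePreserving_I_mul {β : ℝ} (hβ : 0 < β) (k : Freq) :
    MeasurePreserving (fun z => Complex.I * z) (coordLaw β k) (coordLaw β k) := by
  refine ⟨by fun_prop, ?_⟩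
  rw [coordLaw_eq_map hβ]
  conv_rhs => rw [← stdLaw_map_I_mul]
  rw [Measure.map_map (by fun_prop) (by fun_prop), Measure.map_map (by fun_prop) (by fun_prop)]
  congr 1
  funext z
  simp only [Function.comp_apply]
  ring

theorem integrable_norm_pow_stdLaw (n : ℕ) : Integrable (fun z : ℂ => ‖z‖ ^ n) stdLaw := by
  rw [stdLaw, integrable_map_measure (by fun_prop) measurable_mk_complex.aemeasurable]
  have hg : MemLp id n (gaussianReal 0 1) := by
    exact_mod_cast memLp_id_gaussianReal' (μ := 0) (v := 1) (n : ℝ≥0∞) (by simp)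
  have hi : MemLp (fun x : ℝ => x) n (gaussianReal 0 1) := hg
  have h1 : MemLp (fun p : ℝ × ℝ => ‖p.1‖ + ‖p.2‖) n
      ((gaussianReal 0 1).prod (gaussianReal 0 1)) :=
    (hi.norm.comp_fst _).add (hi.norm.comp_snd _)
  have hc : Measurable fun z : ℂ => ‖z‖ ^ n := by fun_prop
  refine (h1.integrable_norm_pow').mono' (hc.comp measurable_mk_complex).aestronglyMeasurable
    (ae_of_all _ fun p => ?_)
  simp only [Function.comp_apply, norm_pow, norm_norm]
  gcongr
  rw [Real.norm_of_nonneg (by positivity)]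
  exact Complex.norm_le_abs_re_add_abs_im _

/-- Absolute moments of the standard complex Gaussian law. -/
def stdMoment (n : ℕ) : ℝ := ∫ z, ‖z‖ ^ n ∂stdLaw

theorem stdMoment_nonneg (n : ℕ) : 0 ≤ stdMoment n := integral_nonneg fun _ => by positivity

theorem integrable_norm_pow_coordLaw {β : ℝ} (hβ : 0 < β) (k : Freq) (n : ℕ) :
    Integrable (fun z : ℂ => ‖z‖ ^ n) (coordLaw β k) := by
  rw [coordLaw_eq_map hβ, integrable_map_measure (by fun_prop) (by fun_prop)]
  refine ((integrable_norm_pow_stdLaw n).const_mul (‖(stdDev β k : ℂ)‖ ^ n)).congr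
    (ae_of_all _ fun z => ?_)
  simp [mul_pow]

theorem integral_norm_pow_coordLaw {β : ℝ} (hβ : 0 < β) (k : Freq) (n : ℕ) :
    ∫ z, ‖z‖ ^ n ∂coordLaw β k = stdDev β k ^ n * stdMoment n := by
  rw [coordLaw_eq_map hβ, integral_map (by fun_prop) (by fun_prop), stdMoment,
    ← integral_const_mul]
  refine integral_congr_ae (ae_of_all _ fun z => ?_)
  simp only [norm_mul, mul_pow, Complex.norm_real]
  rw [Real.norm_of_nonneg (show 0 ≤ stdDev β k from Real.sqrt_nonneg _)]

/-- The normalizing constant of the density of the coefficient at `k`. -/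
def normConst (β : ℝ) (k : Freq) : ℝ :=
  (Real.sqrt (2 * Real.pi * (1 / (4 * β * absFreq k ^ 2)).toNNReal))⁻¹ ^ 2

/-- The density of the coefficient at `k`. -/
def coordDensity (β : ℝ) (k : Freq) (z : ℂ) : ℝ :=
  normConst β k * Real.exp (-(2 * β * (absFreq k ^ 2 * ‖z‖ ^ 2)))

theorem coordDensity_nonneg (β : ℝ) (k : Freq) (z : ℂ) : 0 ≤ coordDensity β k z := by
  rw [coordDensity, normConst]; positivity

theorem measurable_coordDensity (β : ℝ) (k : Freq) : Measurable (coordDensity β k) := by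
  unfold coordDensity; fun_prop

theorem coordLaw_eq_withDensity {β : ℝ} (hβ : 0 < β) {k : Freq} (hk : k ≠ 0) :
    coordLaw β k = volume.withDensity fun z => ENNReal.ofReal (coordDensity β k z) := by
  have hkp := absFreq_pos hk
  set v : ℝ≥0 := (1 / (4 * β * absFreq k ^ 2)).toNNReal with hv
  have hvr : (v : ℝ) = 1 / (4 * β * absFreq k ^ 2) := Real.coe_toNNReal _ (by positivity)
  have hv0 : v ≠ 0 := by
    rw [← NNReal.coe_ne_zero, hvr]; positivity
  have hpdf : ∀ p : ℝ × ℝ, gaussianPDF 0 v p.1 * gaussianPDF 0 v p.2 =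
      ENNReal.ofReal (coordDensity β k ⟨p.1, p.2⟩) := fun p => by
    rw [gaussianPDF, gaussianPDF, ← ENNReal.ofReal_mul (gaussianPDFReal_nonneg _ _ _)]
    congr 1
    rw [gaussianPDFReal, gaussianPDFReal, coordDensity, normConst, ← hv]
    have h2 : ‖(⟨p.1, p.2⟩ : ℂ)‖ ^ 2 = p.1 ^ 2 + p.2 ^ 2 := by
      rw [Complex.sq_norm, Complex.normSq_mk]; ring
    rw [mul_mul_mul_comm, ← Real.exp_add, h2, ← sq]
    congr 2
    rw [hvr]
    field_simp
    ring
  rw [coordLaw, ← hv, gaussianReal_of_var_ne_zero _ hv0, prod_withDensity (by fun_prop) (by fun_prop)]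
  simp_rw [hpdf]
  have hmp := Complex.volume_preserving_equiv_real_prod.symm
  have hm : (fun p : ℝ × ℝ => (⟨p.1, p.2⟩ : ℂ)) = Complex.measurableEquivRealProd.symm := rfl
  have hd := (measurable_coordDensity β k).ennreal_ofReal
  ext s hs
  rw [Measure.map_apply measurable_mk_complex hs, withDensity_apply _ hs,
    withDensity_apply _ (measurable_mk_complex hs), hm,
    ← hmp.setLIntegral_comp_preimage hs hd]
  rfl

theorem integrable_coordDensity {β : ℝ} (hβ : 0 < β) {k : Freq} (hk : k ≠ 0) :
    Integrable (coordDensity β k) := by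
  refine ⟨(measurable_coordDensity β k).aestronglyMeasurable, ?_⟩
  have h : ∫⁻ z, ENNReal.ofReal (coordDensity β k z) = 1 := by
    rw [← setLIntegral_univ, ← withDensity_apply _ MeasurableSet.univ,
      ← coordLaw_eq_withDensity hβ hk, measure_univ]
  rw [hasFiniteIntegral_iff_ofReal (ae_of_all _ (coordDensity_nonneg β k)), h]
  exact ENNReal.one_lt_top

/-- It suffices to test on products of measurable sets. There the indicator distributes over the
factors, and Fubini for products of integrable functions applies. -/
theorem pi_withDensity_ofReal {ι : Type*} [Fintype ι] {f : ι → ℂ → ℝ} (hf : ∀ i, Integrable (f i))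
    (h0 : ∀ i z, 0 ≤ f i z) :
    Measure.pi (fun i => volume.withDensity fun z => ENNReal.ofReal (f i z)) =
      volume.withDensity fun x : ι → ℂ => ENNReal.ofReal (∏ i, f i (x i)) := by
  have : ∀ i, IsFiniteMeasure (volume.withDensity fun z => ENNReal.ofReal (f i z)) := fun i =>
    isFiniteMeasure_withDensity_ofReal (hf i).2
  refine Measure.pi_eq fun s hs => ?_
  have h1 : ∀ x : ι → ℂ, (univ.pi s).indicator (fun x => ENNReal.ofReal (∏ i, f i (x i))) x =
      ENNReal.ofReal (∏ i, (s i).indicator (f i) (x i)) := fun x => by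
    by_cases hx : x ∈ univ.pi s
    · rw [indicator_of_mem hx]
      congr 1
      exact Finset.prod_congr rfl fun i _ => (indicator_of_mem (hx i trivial) _).symm
    · rw [indicator_of_notMem hx]
      obtain ⟨i, hi⟩ : ∃ i, x i ∉ s i := by simpa using hx
      rw [Finset.prod_eq_zero (Finset.mem_univ i) (indicator_of_notMem hi _), ENNReal.ofReal_zero]
  have hi0 : ∀ i z, 0 ≤ (s i).indicator (f i) z := fun i z => indicator_nonneg (fun z _ => h0 i z) z
  rw [withDensity_apply _ (MeasurableSet.univ_pi hs), ← lintegral_indicator (MeasurableSet.univ_pi hs)]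
  simp_rw [h1]
  have hprod : Integrable (fun x : ι → ℂ => ∏ i, (s i).indicator (f i) (x i)) volume :=
    Integrable.fintype_prod fun i => (hf i).indicator (hs i)
  rw [← ofReal_integral_eq_lintegral_ofReal hprod (ae_of_all _ fun x => Finset.prod_nonneg fun i _ => hi0 i _),
    integral_fintype_prod_volume_eq_prod,
    ENNReal.ofReal_prod_of_nonneg fun i _ => integral_nonneg (hi0 i)]
  refine Finset.prod_congr rfl fun i _ => ?_
  rw [withDensity_apply _ (hs i), integral_indicator (hs i),
    ofReal_integral_eq_lintegral_ofReal (hf i).integrableOn (ae_of_all _ (h0 i))]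

/-- The law of the coefficients in `Half N`. -/
def phaseLaw (β : ℝ) (N : ℕ) : Measure (Phase N) := Measure.pi fun k : Half N => coordLaw β k

instance (β : ℝ) (N : ℕ) : IsProbabilityMeasure (phaseLaw β N) := by
  unfold phaseLaw; infer_instance

/-- The exponents of the coordinate densities add up to `-2β` times `energy`. The density is thus a
function of the conserved quantity, so invariance of Lebesgue measure carries over to the Gaussian
law. -/
theorem phaseLaw_eq_withDensity {β : ℝ} (hβ : 0 < β) (N : ℕ) :
    phaseLaw β N = volume.withDensity fun x => ENNReal.ofReal
      ((∏ k : Half N, normConst β k) * Real.exp (-(2 * β * energy N x))) := by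
  have h1 : ∀ k : Half N, (k : Freq) ≠ 0 := fun k => ne_zero_of_mem_halfLattice k.2.1
  have h2 : (fun k : Half N => coordLaw β k) = fun k : Half N =>
      volume.withDensity fun z => ENNReal.ofReal (coordDensity β k z) :=
    funext fun k => coordLaw_eq_withDensity hβ (h1 k)
  rw [phaseLaw, h2, pi_withDensity_ofReal (fun k => integrable_coordDensity hβ (h1 k))
    (fun k => coordDensity_nonneg β k)]
  congr 1
  funext x
  congr 1
  simp only [coordDensity, Finset.prod_mul_distrib, energy, Finset.mul_sum]
  rw [← Real.exp_sum, Finset.sum_neg_distrib]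

/-- Observables do not grow in mean along the truncated flow under the Gaussian law. -/
theorem lintegral_phaseLaw_flow_le {β δ T : ℝ} (hβ : 0 < β) (hT : 0 ≤ T) {N : ℕ} {f : Phase N → ℝ}
    (hf : ContDiff ℝ 1 f) (hf0 : ∀ x, 0 ≤ f x) {t : ℝ} (ht : t ∈ Icc 0 T) :
    ∫⁻ x, ENNReal.ofReal (f ((isConservative_truncField δ N).flow hT t x)) ∂phaseLaw β N ≤
      ∫⁻ x, ENNReal.ofReal (f x) ∂phaseLaw β N := by
  set H := isConservative_truncField δ N
  set D : Phase N → ℝ := fun x =>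
    (∏ k : Half N, normConst β k) * Real.exp (-(2 * β * energy N x)) with hD
  have hD0 : ∀ x, 0 ≤ D x := fun x =>
    mul_nonneg (Finset.prod_nonneg fun k _ => by unfold normConst; positivity) (Real.exp_pos _).le
  have hDc : ContDiff ℝ 1 D :=
    contDiff_const.mul ((contDiff_const.mul (contDiff_energy N)).neg.exp)
  have hflow : Continuous fun x => H.flow hT t x :=
    (continuous_eval_const (F := C(Icc (0 : ℝ) T, Phase N)) (⟨t, ht⟩ : Icc (0 : ℝ) T)).comp
      (H.continuous_flowPath hT)
  have hDf : ∀ x, D (H.flow hT t x) = D x := fun x => by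
    simp only [hD, H.quantity_flow hT x ht]
  have key := H.lintegral_comp_flow_le (μ := volume) hT (hf.mul hDc)
    (fun x => mul_nonneg (hf0 x) (hD0 x)) ht
  have hfm : Measurable fun x => ENNReal.ofReal (f (H.flow hT t x)) :=
    (hf.continuous.comp hflow).measurable.ennreal_ofReal
  rw [phaseLaw_eq_withDensity hβ,
    lintegral_withDensity_eq_lintegral_mul _ hDc.continuous.measurable.ennreal_ofReal hfm,
    lintegral_withDensity_eq_lintegral_mul _ hDc.continuous.measurable.ennreal_ofReal
      hf.continuous.measurable.ennreal_ofReal]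
  refine (le_of_eq ?_).trans (key.trans (le_of_eq ?_))
  · refine lintegral_congr fun x => ?_
    rw [Pi.mul_apply, hDf, mul_comm (f _), ENNReal.ofReal_mul (hD0 x)]
  · refine lintegral_congr fun x => ?_
    rw [Pi.mul_apply, mul_comm (f _), ENNReal.ofReal_mul (hD0 x)]

/-! ### The second moment of the nonlinearity -/

/-- The Euclidean length dominates the sup norm, for which the lattice sum is known from Eisenstein
series. At `k = 0` the left side is `0` by the convention for real powers. -/
theorem summable_absFreq_rpow {p : ℝ} (hp : 2 < p) : Summable fun k : Freq => absFreq k ^ (-p) := by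
  have h1 := (finTwoArrowEquiv ℤ).symm.summable_iff.2
    (EisensteinSeries.summable_one_div_norm_rpow hp)
  refine Summable.of_nonneg_of_le (fun k => Real.rpow_nonneg (absFreq_nonneg k) _) (fun k => ?_) h1
  simp only [Function.comp_apply]
  rcases eq_or_ne k 0 with rfl | hk
  · rw [absFreq_zero, Real.zero_rpow (by linarith)]
    positivity
  · refine Real.rpow_le_rpow_of_nonpos ?_ ?_ (by linarith)
    · refine norm_pos_iff.2 fun h => hk ?_
      exact Prod.ext (congrFun h 0) (congrFun h 1)
    · refine (pi_norm_le_iff_of_nonneg (absFreq_nonneg k)).2 fun i => ?_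
      rw [Int.norm_eq_abs]
      refine Real.le_sqrt_of_sq_le ?_
      fin_cases i
      · simp [sq_nonneg]
      · simp [sq_nonneg]

theorem exists_half_eq {N : ℕ} {h : Freq} (hh : h ≠ 0) (hN : h ∈ box N) :
    ∃ j : Half N, (j : Freq) = h ∨ (j : Freq) = -h := by
  rcases mem_halfLattice_or hh with h' | h'
  · exact ⟨⟨h, h', hN⟩, Or.inl rfl⟩
  · exact ⟨⟨-h, h', neg_mem_box.2 hN⟩, Or.inr rfl⟩

theorem norm_trigPoly_eq {N : ℕ} {h : Freq} {j : Half N} (hj : (j : Freq) = h ∨ (j : Freq) = -h)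
    (x : Phase N) : ‖trigPoly N x h‖ = ‖x j‖ := by
  rcases hj with hj | hj
  · rw [← hj, trigPoly_apply_coe]
  · rw [← trigPoly_apply_coe x j, hj, (isHermitian_trigPoly x).2, RCLike.norm_conj]

theorem absFreq_eq_of_eq_or {h l : Freq} (hj : l = h ∨ l = -h) : absFreq l = absFreq h := by
  rcases hj with rfl | rfl
  · rfl
  · exact absFreq_neg h

theorem continuous_trigPoly_apply {N : ℕ} (h : Freq) : Continuous fun x => trigPoly N x h :=
  (trigCoeff N h).continuous

section Moments

variable {β : ℝ} {N : ℕ}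

theorem trigPoly_eq_zero {h : Freq} (hh : h = 0 ∨ h ∉ box N) (x : Phase N) :
    trigPoly N x h = 0 := by
  rcases hh with rfl | hh
  · exact (isHermitian_trigPoly x).1
  · exact trigPoly_of_notMem x hh

theorem integrable_norm_pow_trigPoly (hβ : 0 < β) (h : Freq) (n : ℕ) :
    Integrable (fun x : Phase N => ‖trigPoly N x h‖ ^ n) (phaseLaw β N) := by
  by_cases hh : h = 0 ∨ h ∉ box N
  · simp_rw [trigPoly_eq_zero hh]
    exact integrable_const _
  · push Not at hh
    obtain ⟨j, hj⟩ := exists_half_eq hh.1 hh.2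
    simp_rw [norm_trigPoly_eq hj]
    exact (measurePreserving_eval (fun k : Half N => coordLaw β k) j).integrable_comp_of_integrable
      (integrable_norm_pow_coordLaw hβ j n)

theorem integral_norm_pow_trigPoly_le (hβ : 0 < β) (h : Freq) {n : ℕ} (hn : n ≠ 0) :
    ∫ x, ‖trigPoly N x h‖ ^ n ∂phaseLaw β N ≤ stdDev β h ^ n * stdMoment n := by
  by_cases hh : h = 0 ∨ h ∉ box N
  · simp_rw [trigPoly_eq_zero hh, norm_zero, zero_pow hn, integral_zero]
    exact mul_nonneg (pow_nonneg (Real.sqrt_nonneg _) _) (stdMoment_nonneg n)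
  · push Not at hh
    obtain ⟨j, hj⟩ := exists_half_eq hh.1 hh.2
    simp_rw [norm_trigPoly_eq hj]
    have h1 := (measurePreserving_eval (fun k : Half N => coordLaw β k) j).map_eq
    have h2 : ∫ x, ‖x j‖ ^ n ∂phaseLaw β N = ∫ z, ‖z‖ ^ n ∂coordLaw β j := by
      rw [← h1, integral_map (measurable_pi_apply j).aemeasurable (by fun_prop)]
      rfl
    rw [h2, integral_norm_pow_coordLaw hβ, stdDev, absFreq_eq_of_eq_or hj, stdDev]

/-- The product of two coefficients whose frequencies add up to `k`. -/
def pairProd (N : ℕ) (k h : Freq) (x : Phase N) : ℂ := trigPoly N x h * trigPoly N x (k - h)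

theorem continuous_pairProd (k h : Freq) : Continuous (pairProd N k h) :=
  (continuous_trigPoly_apply h).mul (continuous_trigPoly_apply _)

theorem pairProd_sub (k h : Freq) : pairProd N k (k - h) = pairProd N k h := by
  funext x
  rw [pairProd, pairProd, sub_sub_cancel, mul_comm]

theorem integrable_norm_sq_pairProd (hβ : 0 < β) (k h : Freq) :
    Integrable (fun x => ‖pairProd N k h x‖ ^ 2) (phaseLaw β N) := by
  refine ((integrable_norm_pow_trigPoly hβ h 4).add
    (integrable_norm_pow_trigPoly hβ (k - h) 4)).mono'
    ((continuous_pairProd k h).norm.pow 2).aestronglyMeasurable (ae_of_all _ fun x => ?_)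
  rw [Real.norm_of_nonneg (by positivity), pairProd, norm_mul, Pi.add_apply]
  nlinarith [sq_nonneg (‖trigPoly N x h‖ ^ 2 - ‖trigPoly N x (k - h)‖ ^ 2),
    sq_nonneg (‖trigPoly N x h‖ ^ 2), sq_nonneg (‖trigPoly N x (k - h)‖ ^ 2)]

theorem integrable_pairProd_mul_conj (hβ : 0 < β) (k h h' : Freq) :
    Integrable (fun x => pairProd N k h x * conj (pairProd N k h' x)) (phaseLaw β N) := by
  refine ((integrable_norm_sq_pairProd hβ k h).add (integrable_norm_sq_pairProd hβ k h')).mono'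
    ((continuous_pairProd k h).mul (Complex.continuous_conj.comp
      (continuous_pairProd k h'))).aestronglyMeasurable (ae_of_all _ fun x => ?_)
  rw [norm_mul, RCLike.norm_conj, Pi.add_apply]
  nlinarith [sq_nonneg (‖pairProd N k h x‖ - ‖pairProd N k h' x‖),
    sq_nonneg ‖pairProd N k h x‖, sq_nonneg ‖pairProd N k h' x‖]

/-- Multiplication of one coordinate by `i`. -/
def rotate (j : Half N) (x : Phase N) : Phase N := fun i => if i = j then Complex.I * x i else x i

/-- The factor by which `rotate j` multiplies the coefficient at `l`. -/
def rotateFactor (j : Half N) (l : Freq) : ℂ :=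
  if l = j then Complex.I else if l = -j then -Complex.I else 1

theorem trigPoly_rotate (j : Half N) (x : Phase N) (l : Freq) :
    trigPoly N (rotate j x) l = rotateFactor j l * trigPoly N x l := by
  rw [rotateFactor]
  split_ifs with h1 h2
  · rw [h1, trigPoly_apply_coe, trigPoly_apply_coe, rotate, if_pos rfl]
  · rw [h2, (isHermitian_trigPoly _).2, (isHermitian_trigPoly _).2, trigPoly_apply_coe,
      trigPoly_apply_coe, rotate, if_pos rfl, map_mul, Complex.conj_I]
  · have : rotate j x = x + Pi.single j ((Complex.I - 1) * x j) := by
      funext i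
      rw [rotate, Pi.add_apply]
      split_ifs with hi
      · subst hi
        rw [Pi.single_eq_same]; ring
      · rw [Pi.single_eq_of_ne hi, add_zero]
    rw [this, map_add, Pi.add_apply, trigPoly_single_of_ne j _ h1 h2, add_zero, one_mul]

theorem measurePreserving_rotate (hβ : 0 < β) (j : Half N) :
    MeasurePreserving (rotate j) (phaseLaw β N) (phaseLaw β N) := by
  refine measurePreserving_pi (f := fun i z => if i = j then Complex.I * z else z) _ _ fun i => ?_
  by_cases h : i = j
  · simp only [h, if_true]
    exact measurePreserving_I_mul hβ _
  · simp only [h, if_false]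
    exact MeasurePreserving.id _

theorem rotateFactor_of_ne {j : Half N} {h l : Freq} (hj : (j : Freq) = h ∨ (j : Freq) = -h)
    (h1 : l ≠ h) (h2 : l ≠ -h) : rotateFactor j l = 1 := by
  rcases hj with hj | hj
  · rw [rotateFactor, hj, if_neg h1, if_neg h2]
  · rw [rotateFactor, hj, neg_neg, if_neg h2, if_neg h1]

theorem rotateFactor_eq {j : Half N} {h : Freq} (hh : h ≠ 0)
    (hj : (j : Freq) = h ∨ (j : Freq) = -h) :
    (rotateFactor j h = Complex.I ∧ rotateFactor j (-h) = -Complex.I) ∨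
      (rotateFactor j h = -Complex.I ∧ rotateFactor j (-h) = Complex.I) := by
  have hne : h ≠ -h := fun h' => hh <| by
    have h1 := congrArg Prod.fst h'
    have h2 := congrArg Prod.snd h'
    simp only [Prod.fst_neg, Prod.snd_neg] at h1 h2
    exact Prod.ext (by change h.1 = 0; omega) (by change h.2 = 0; omega)
  rcases hj with hj | hj
  · left
    simp [rotateFactor, hj, hne.symm]
  · right
    simp [rotateFactor, hj, hne]

/-- Multiplying the coefficient at `h` by `±i`, and that at `-h` by the conjugate, preserves the law
and multiplies the integrand by a constant `τ ≠ 1`; hence the integral is zero. The condition on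
`cross` ensures that `h ≠ 0` and that `k - h` is not `±h`, so it is unaffected. -/
theorem integral_pairProd_mul_conj_eq_zero (hβ : 0 < β) {k h h' : Freq} (hc : cross h k ≠ 0)
    (h1 : h' ≠ h) (h2 : h' ≠ k - h) :
    ∫ x, pairProd N k h x * conj (pairProd N k h' x) ∂phaseLaw β N = 0 := by
  have hh : h ≠ 0 := by rintro rfl; simp at hc
  by_cases hN : h ∈ box N
  swap
  · have : ∀ x, pairProd N k h x = 0 := fun x => by
      rw [pairProd, trigPoly_of_notMem x hN, zero_mul]
    simp_rw [this, zero_mul, integral_zero]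
  obtain ⟨j, hj⟩ := exists_half_eq hh hN
  have hkh : k - h ≠ h := fun h' => hc <| by rw [← cross_sub_right, h', cross_self]
  have hkh' : k - h ≠ -h := fun h' => hc <| by
    rw [← cross_sub_right, h', cross_neg_right, cross_self, neg_zero]
  have h3 : k - h' ≠ h := fun h'' => h2 <| by rw [← h'', sub_sub_cancel]
  set F : Phase N → ℂ := fun x => pairProd N k h x * conj (pairProd N k h' x) with hF
  have hFc : Continuous F := (continuous_pairProd k h).mul
    (Complex.continuous_conj.comp (continuous_pairProd k h'))
  set τ : ℂ := rotateFactor j h * conj (rotateFactor j h' * rotateFactor j (k - h')) with hτ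
  have hrot : ∀ x, F (rotate j x) = τ * F x := fun x => by
    simp only [hF, pairProd, trigPoly_rotate, map_mul, hτ, rotateFactor_of_ne hj hkh hkh']
    ring
  have hinv : ∫ x, F x ∂phaseLaw β N = τ * ∫ x, F x ∂phaseLaw β N := by
    have hm := measurePreserving_rotate (N := N) hβ j
    calc ∫ x, F x ∂phaseLaw β N = ∫ x, F x ∂(phaseLaw β N).map (rotate j) := by rw [hm.map_eq]
      _ = ∫ x, F (rotate j x) ∂phaseLaw β N :=
        integral_map hm.measurable.aemeasurable hFc.aestronglyMeasurable
      _ = _ := by simp_rw [hrot, integral_const_mul]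
  -- Write `r = ±i` for the factor at `h`. Neither `h'` nor `k - h'` equals `h`, so each contributes
  -- `1` or, after conjugation, `r`. Thus `τ` is `r`, `r²` or `r³`, never `1`.
  have hne : τ ≠ 1 := by
    have hl : ∀ l, l ≠ h → rotateFactor j l = 1 ∨ rotateFactor j l = rotateFactor j (-h) :=
      fun l hl => by
        by_cases hl' : l = -h
        · right; rw [hl']
        · left; exact rotateFactor_of_ne hj hl hl'
    rw [hτ]
    rcases rotateFactor_eq hh hj with ⟨e1, e2⟩ | ⟨e1, e2⟩ <;> rcases hl h' h1 with e3 | e3 <;>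
      rcases hl (k - h') h3 with e4 | e4 <;> rw [e3, e4, e1] <;> (try rw [e2]) <;>
      intro h0 <;> have h5 := congrArg Complex.re h0 <;> norm_num at h5
  have : (1 - τ) * ∫ x, F x ∂phaseLaw β N = 0 := by
    rw [sub_mul, one_mul, ← hinv, sub_self]
  exact (mul_eq_zero.1 this).resolve_left (sub_ne_zero.2 hne.symm)

/-- The weighted inequality `2 (uv)² ≤ (a²/b²) u⁴ + (b²/a²) v⁴` reduces to fourth moments and avoids
discussing whether the two coefficients are independent. The weights make both contributions equal,
and `16 β²` comes from the squared variances `1/(4β|l|²)`. -/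
theorem integral_norm_sq_pairProd_le (hβ : 0 < β) {k h : Freq} (hh : h ≠ 0) (hkh : k - h ≠ 0) :
    ∫ x, ‖pairProd N k h x‖ ^ 2 ∂phaseLaw β N ≤
      stdMoment 4 / (16 * β ^ 2) / (absFreq h ^ 2 * absFreq (k - h) ^ 2) := by
  have ha := absFreq_pos hh
  have hb := absFreq_pos hkh
  set a := absFreq h
  set b := absFreq (k - h)
  have h1 : ∫ x, ‖pairProd N k h x‖ ^ 2 ∂phaseLaw β N ≤
      ∫ x, (a ^ 2 / b ^ 2 / 2 * ‖trigPoly N x h‖ ^ 4 +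
        b ^ 2 / a ^ 2 / 2 * ‖trigPoly N x (k - h)‖ ^ 4) ∂phaseLaw β N := by
    refine integral_mono (integrable_norm_sq_pairProd hβ k h)
      (((integrable_norm_pow_trigPoly hβ h 4).const_mul _).add
        ((integrable_norm_pow_trigPoly hβ (k - h) 4).const_mul _)) fun x => ?_
    simp only [pairProd, norm_mul]
    set u := ‖trigPoly N x h‖
    set v := ‖trigPoly N x (k - h)‖
    have : a ^ 2 / b ^ 2 / 2 * u ^ 4 + b ^ 2 / a ^ 2 / 2 * v ^ 4 - (u * v) ^ 2 =
        (a / b * u ^ 2 - b / a * v ^ 2) ^ 2 / 2 := by field_simp; ring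
    have h2 : 0 ≤ (a / b * u ^ 2 - b / a * v ^ 2) ^ 2 / 2 := by positivity
    linarith
  have hs : ∀ l, stdDev β l ^ 4 = (1 / (4 * β * absFreq l ^ 2)) ^ 2 := fun l => by
    rw [← stdDev_sq hβ]; ring
  refine h1.trans ?_
  rw [integral_add ((integrable_norm_pow_trigPoly hβ h 4).const_mul _)
    ((integrable_norm_pow_trigPoly hβ (k - h) 4).const_mul _), integral_const_mul,
    integral_const_mul]
  calc _ ≤ a ^ 2 / b ^ 2 / 2 * (stdDev β h ^ 4 * stdMoment 4) +
        b ^ 2 / a ^ 2 / 2 * (stdDev β (k - h) ^ 4 * stdMoment 4) := by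
        gcongr
        · exact integral_norm_pow_trigPoly_le hβ h (by norm_num)
        · exact integral_norm_pow_trigPoly_le hβ (k - h) (by norm_num)
    _ = _ := by
        rw [show stdDev β h ^ 4 = (1 / (4 * β * a ^ 2)) ^ 2 from hs h,
          show stdDev β (k - h) ^ 4 = (1 / (4 * β * b ^ 2)) ^ 2 from hs _]
        field_simp
        ring

theorem symmKernel_sub (δ : ℝ) (k h : Freq) : symmKernel δ k (k - h) = symmKernel δ k h := by
  rw [symmKernel, symmKernel, sub_sub_cancel, add_comm]

theorem symmKernel_eq_zero {δ : ℝ} {k h : Freq} (hc : cross h k = 0) : symmKernel δ k h = 0 := by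
  simp [symmKernel, kernel, cross_sub_left, hc]

theorem norm_integral_pairProd_le (k h : Freq) :
    ‖∫ x, pairProd N k h x * conj (pairProd N k h x) ∂phaseLaw β N‖ ≤
      ∫ x, ‖pairProd N k h x‖ ^ 2 ∂phaseLaw β N := by
  refine (norm_integral_le_integral_norm _).trans (le_of_eq ?_)
  refine integral_congr_ae (ae_of_all _ fun x => ?_)
  simp only [norm_mul, RCLike.norm_conj]
  ring

/-- In the expanded square, orthogonality leaves only `h' = h` and `h' = k - h`. These give the same
product and the same kernel, hence the factor `2`. -/
theorem integral_norm_sq_truncNonlinearity_le_sum (hβ : 0 < β) {δ : ℝ} {k : Freq}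
    (hk : k ∈ box N) :
    ∫ x, ‖truncNonlinearity δ N (trigPoly N x) k‖ ^ 2 ∂phaseLaw β N ≤
      ∑ h ∈ boxFinset N, 2 * (symmKernel δ k h ^ 2 *
        ∫ x, ‖pairProd N k h x‖ ^ 2 ∂phaseLaw β N) := by
  set a : Freq → ℝ := symmKernel δ k with ha
  set g : Freq → ℝ := fun h => ∫ x, ‖pairProd N k h x‖ ^ 2 ∂phaseLaw β N with hg
  have hg0 : ∀ h, 0 ≤ g h := fun h => integral_nonneg fun x => by positivity
  have h1 : ∀ x : Phase N, truncNonlinearity δ N (trigPoly N x) k =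
      ∑ h ∈ boxFinset N, (a h : ℂ) * pairProd N k h x := fun x => by
    rw [truncNonlinearity_eq_symm hk, proj_trigPoly]; rfl
  have h2 : ∀ x : Phase N, ((‖truncNonlinearity δ N (trigPoly N x) k‖ ^ 2 : ℝ) : ℂ) =
      ∑ h ∈ boxFinset N, ∑ h' ∈ boxFinset N,
        ((a h * a h' : ℝ) : ℂ) * (pairProd N k h x * conj (pairProd N k h' x)) := fun x => by
    rw [Complex.ofReal_pow, ← Complex.mul_conj', h1, map_sum, Finset.sum_mul_sum]
    refine Finset.sum_congr rfl fun h _ => Finset.sum_congr rfl fun h' _ => ?_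
    rw [map_mul, Complex.conj_ofReal]
    push_cast
    ring
  have hint : ∀ h h', Integrable (fun x => ((a h * a h' : ℝ) : ℂ) *
      (pairProd N k h x * conj (pairProd N k h' x))) (phaseLaw β N) := fun h h' =>
    (integrable_pairProd_mul_conj hβ k h h').const_mul _
  have h3 : ((∫ x, ‖truncNonlinearity δ N (trigPoly N x) k‖ ^ 2 ∂phaseLaw β N : ℝ) : ℂ) =
      ∑ h ∈ boxFinset N, ∑ h' ∈ boxFinset N, ((a h * a h' : ℝ) : ℂ) *
        ∫ x, pairProd N k h x * conj (pairProd N k h' x) ∂phaseLaw β N := by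
    rw [← integral_complex_ofReal]
    simp_rw [h2]
    rw [integral_finsetSum _ fun h _ => integrable_finsetSum _ fun h' _ => hint h h']
    refine Finset.sum_congr rfl fun h _ => ?_
    rw [integral_finsetSum _ fun h' _ => hint h h']
    exact Finset.sum_congr rfl fun h' _ => integral_const_mul _ _
  -- A sum of two conditionals, rather than a disjunction, makes the double sum collapse termwise;
  -- it only overcounts if `h = k - h`.
  have h4 : ∀ h h', ‖((a h * a h' : ℝ) : ℂ) *
      ∫ x, pairProd N k h x * conj (pairProd N k h' x) ∂phaseLaw β N‖ ≤
      (if h' = h then a h ^ 2 * g h else 0) + (if h' = k - h then a h ^ 2 * g h else 0) := by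
    intro h h'
    have hp : 0 ≤ a h ^ 2 * g h := mul_nonneg (sq_nonneg _) (hg0 h)
    have hp1 : 0 ≤ (if h' = h then a h ^ 2 * g h else 0) := by split_ifs <;> simp [hp]
    have hp2 : 0 ≤ (if h' = k - h then a h ^ 2 * g h else 0) := by split_ifs <;> simp [hp]
    have hdiag : ‖((a h * a h : ℝ) : ℂ) *
        ∫ x, pairProd N k h x * conj (pairProd N k h x) ∂phaseLaw β N‖ ≤ a h ^ 2 * g h := by
      rw [norm_mul, Complex.norm_real, Real.norm_of_nonneg (mul_self_nonneg _), sq]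
      exact mul_le_mul_of_nonneg_left (norm_integral_pairProd_le k h) (mul_self_nonneg _)
    by_cases e1 : h' = h
    · subst e1
      rw [if_pos rfl]
      linarith
    by_cases e2 : h' = k - h
    · have e3 : a h' = a h := by rw [e2]; exact symmKernel_sub δ k h
      rw [e3, e2, pairProd_sub, if_pos rfl]
      rw [e2] at hp1
      linarith
    · by_cases hc : cross h k = 0
      · have : a h = 0 := symmKernel_eq_zero hc
        rw [this]
        simp
      · rw [integral_pairProd_mul_conj_eq_zero hβ hc e1 e2, mul_zero, norm_zero]
        positivity
  have h5 : ∫ x, ‖truncNonlinearity δ N (trigPoly N x) k‖ ^ 2 ∂phaseLaw β N =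
      ‖((∫ x, ‖truncNonlinearity δ N (trigPoly N x) k‖ ^ 2 ∂phaseLaw β N : ℝ) : ℂ)‖ := by
    rw [Complex.norm_real, Real.norm_of_nonneg (integral_nonneg fun x => by positivity)]
  rw [h5, h3]
  refine (norm_sum_le _ _).trans (Finset.sum_le_sum fun h _ => (norm_sum_le _ _).trans ?_)
  refine (Finset.sum_le_sum fun h' _ => h4 h h').trans ?_
  have hp : 0 ≤ a h ^ 2 * g h := mul_nonneg (sq_nonneg _) (hg0 h)
  rw [Finset.sum_add_distrib, Finset.sum_ite_eq', Finset.sum_ite_eq', two_mul]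
  refine add_le_add ?_ ?_ <;> split_ifs <;> first | exact le_rfl | exact hp

/-- The second moment of the nonlinearity is bounded by `C |k|²`, uniformly in the truncation. -/
theorem exists_integral_norm_sq_truncNonlinearity_le (hβ : 0 < β) {δ : ℝ} (hδ : 0 < δ)
    (hδ' : δ ≤ 1) : ∃ C : ℝ, 0 ≤ C ∧ ∀ (N : ℕ) (k : Freq),
      ∫ x, ‖truncNonlinearity δ N (trigPoly N x) k‖ ^ 2 ∂phaseLaw β N ≤ C * absFreq k ^ 2 := by
  -- The exponent exceeds `2`, the threshold for summability on `ℤ²`, precisely because `δ > 0`.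
  set p := 2 + 2 * δ with hp
  have hsum : Summable fun k : Freq => absFreq k ^ (-p) := summable_absFreq_rpow (by linarith)
  have hpos : ∀ k : Freq, 0 ≤ absFreq k ^ (-p) := fun k => Real.rpow_nonneg (absFreq_nonneg k) _
  set S := ∑' k : Freq, absFreq k ^ (-p)
  have hS0 : 0 ≤ S := tsum_nonneg hpos
  set C₀ := stdMoment 4 / (16 * β ^ 2) with hC₀
  have hC₀0 : 0 ≤ C₀ := div_nonneg (stdMoment_nonneg 4) (by positivity)
  -- The factor `4` combines the `2` from the pairs `h, k - h` with the two lattice sums, each at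
  -- most `S`.
  refine ⟨4 * C₀ * S, by positivity, fun N k => ?_⟩
  by_cases hk : k ∈ box N
  swap
  · simp_rw [truncNonlinearity_of_notMem hk, norm_zero, zero_pow two_ne_zero, integral_zero]
    positivity
  refine (integral_norm_sq_truncNonlinearity_le_sum hβ hk).trans ?_
  have h1 : ∀ h, 2 * (symmKernel δ k h ^ 2 * ∫ x, ‖pairProd N k h x‖ ^ 2 ∂phaseLaw β N) ≤
      2 * C₀ * absFreq k ^ 2 * (absFreq h ^ (-p) + absFreq (k - h) ^ (-p)) := fun h => by
    by_cases hc : cross h k = 0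
    · rw [symmKernel_eq_zero hc]
      have := hpos h
      have := hpos (k - h)
      simp only [ne_eq, OfNat.ofNat_ne_zero, not_false_eq_true, zero_pow, zero_mul, mul_zero]
      positivity
    · have hh : h ≠ 0 := by rintro rfl; simp at hc
      have hk0 : k ≠ 0 := by rintro rfl; simp at hc
      have hkh : k - h ≠ 0 := fun h' => hc <| by rw [← cross_sub_right, h', cross_zero_right]
      have ha := absFreq_pos hh
      have hb := absFreq_pos hkh
      have := hpos h
      have := hpos (k - h)
      calc _ ≤ 2 * ((absFreq k ^ 2 * (absFreq h ^ 2 * absFreq (k - h) ^ 2 *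
            (absFreq h ^ (-p) + absFreq (k - h) ^ (-p)))) *
            (C₀ / (absFreq h ^ 2 * absFreq (k - h) ^ 2))) := by
            gcongr
            · exact symmKernel_sq_le hδ hδ' hk0 hh hkh
            · exact integral_norm_sq_pairProd_le hβ hh hkh
        _ = _ := by field_simp
  refine (Finset.sum_le_sum fun h _ => h1 h).trans ?_
  rw [← Finset.mul_sum, Finset.sum_add_distrib]
  have h2 : ∑ h ∈ boxFinset N, absFreq h ^ (-p) ≤ S := hsum.sum_le_tsum _ fun h _ => hpos h
  have h3 : ∑ h ∈ boxFinset N, absFreq (k - h) ^ (-p) ≤ S := by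
    have h4 : Summable fun h => absFreq (k - h) ^ (-p) := (Equiv.subLeft k).summable_iff.2 hsum
    refine (h4.sum_le_tsum _ fun h _ => hpos _).trans (le_of_eq ?_)
    exact (Equiv.subLeft k).tsum_eq fun h => absFreq h ^ (-p)
  calc _ ≤ 2 * C₀ * absFreq k ^ 2 * (S + S) := by gcongr
    _ = _ := by ring

end Moments

/-! ### The Gaussian measure on `X^σ` -/

/-- The squared `H^s` norm as an extended nonnegative number. -/
def sobolevSum (s : ℝ) (ψ : Freq → ℂ) : ℝ≥0∞ :=
  ∑' k, ENNReal.ofReal (absFreq k ^ (2 * s) * ‖ψ k‖ ^ 2)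

theorem sobolev_term_nonneg (s : ℝ) (ψ : Freq → ℂ) (k : Freq) :
    0 ≤ absFreq k ^ (2 * s) * ‖ψ k‖ ^ 2 :=
  mul_nonneg (Real.rpow_nonneg (absFreq_nonneg k) _) (sq_nonneg _)

theorem measurable_sobolevSum (s : ℝ) : Measurable (sobolevSum s) := by
  unfold sobolevSum
  fun_prop

theorem summable_iff_sobolevSum_ne_top {s : ℝ} {ψ : Freq → ℂ} :
    (Summable fun k => absFreq k ^ (2 * s) * ‖ψ k‖ ^ 2) ↔ sobolevSum s ψ ≠ ∞ := by
  refine ⟨fun h => h.tsum_ofReal_ne_top, fun h => ?_⟩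
  refine (ENNReal.summable_toReal h).congr fun k => ?_
  exact ENNReal.toReal_ofReal (sobolev_term_nonneg s ψ k)

theorem isSobolev_iff {s : ℝ} {ψ : Freq → ℂ} :
    IsSobolev s ψ ↔ IsHermitian ψ ∧ sobolevSum s ψ ≠ ∞ := by
  rw [IsSobolev, IsHermitian, summable_iff_sobolevSum_ne_top, and_assoc]

theorem rpow_absFreq_mono {s s' : ℝ} (h : s ≤ s') {k : Freq} (hk : k ≠ 0) :
    absFreq k ^ (2 * s) ≤ absFreq k ^ (2 * s') :=
  Real.rpow_le_rpow_of_exponent_le (one_le_absFreq hk) (by linarith)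

theorem sobolev_term_mono {s s' : ℝ} (h : s ≤ s') {ψ : Freq → ℂ} (h0 : ψ 0 = 0) (k : Freq) :
    absFreq k ^ (2 * s) * ‖ψ k‖ ^ 2 ≤ absFreq k ^ (2 * s') * ‖ψ k‖ ^ 2 := by
  rcases eq_or_ne k 0 with rfl | hk
  · simp [h0]
  · exact mul_le_mul_of_nonneg_right (rpow_absFreq_mono h hk) (sq_nonneg _)

theorem sobolevSum_mono {s s' : ℝ} (h : s ≤ s') {ψ : Freq → ℂ} (h0 : ψ 0 = 0) :
    sobolevSum s ψ ≤ sobolevSum s' ψ :=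
  ENNReal.tsum_le_tsum fun k => ENNReal.ofReal_le_ofReal (sobolev_term_mono h h0 k)

theorem isSobolev_mono {s s' : ℝ} (h : s ≤ s') {ψ : Freq → ℂ} (hψ : IsSobolev s' ψ) :
    IsSobolev s ψ := by
  rw [isSobolev_iff] at *
  exact ⟨hψ.1, ne_top_of_le_ne_top hψ.2 (sobolevSum_mono h hψ.1.1)⟩

theorem measurableSet_isHermitian : MeasurableSet {ψ : Freq → ℂ | IsHermitian ψ} := by
  have : {ψ : Freq → ℂ | IsHermitian ψ} = {ψ | ψ 0 = 0} ∩ ⋂ k, {ψ | ψ (-k) = conj (ψ k)} := by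
    ext ψ
    simp [IsHermitian]
  rw [this]
  refine (measurableSet_eq_fun (measurable_pi_apply 0) measurable_const).inter
    (MeasurableSet.iInter fun k => measurableSet_eq_fun (measurable_pi_apply (-k)) ?_)
  exact Complex.continuous_conj.measurable.comp (measurable_pi_apply k)

/-- Sobolev spaces decrease in the exponent, since `|k| ≥ 1` for `k ≠ 0`. The sequence `σ - 1/(n+1)`
therefore replaces the uncountable intersection. -/
theorem measurableSet_xSpace (σ : ℝ) :
    MeasurableSet {ψ : Freq → ℂ | ∀ s < σ, IsSobolev s ψ} := by
  have : {ψ : Freq → ℂ | ∀ s < σ, IsSobolev s ψ} = {ψ | IsHermitian ψ} ∩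
      ⋂ n : ℕ, {ψ | sobolevSum (σ - 1 / (n + 1)) ψ ≠ ∞} := by
    ext ψ
    simp only [mem_ofPred_eq, mem_inter_iff, mem_iInter]
    constructor
    · intro h
      refine ⟨(isSobolev_iff.1 (h (σ - 1) (by linarith))).1, fun n => ?_⟩
      have hn : (0 : ℝ) < 1 / (n + 1) := by positivity
      exact (isSobolev_iff.1 (h (σ - 1 / (n + 1)) (by linarith))).2
    · rintro ⟨h1, h2⟩ s hs
      obtain ⟨n, hn⟩ := exists_nat_one_div_lt (sub_pos.2 hs)
      exact isSobolev_mono (by linarith) (isSobolev_iff.2 ⟨h1, h2 n⟩)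
  rw [this]
  refine measurableSet_isHermitian.inter (MeasurableSet.iInter fun n => ?_)
  exact (measurableSet_eq_fun (measurable_sobolevSum _) measurable_const).compl

theorem measurableEmbedding_coeff (σ : ℝ) : MeasurableEmbedding (XSpace.coeff (σ := σ)) :=
  MeasurableEmbedding.subtype_coe (measurableSet_xSpace σ)

theorem range_coeff (σ : ℝ) :
    range (XSpace.coeff (σ := σ)) = {ψ : Freq → ℂ | ∀ s < σ, IsSobolev s ψ} :=
  Subtype.range_coe

theorem XSpace.isHermitian {σ : ℝ} (ψ : XSpace σ) : IsHermitian ψ.coeff :=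
  (isSobolev_iff.1 (ψ.2 (σ - 1) (by linarith))).1

theorem lintegral_norm_sq_gaussianCoeff_le {β : ℝ} (hβ : 0 < β) (k : Freq) :
    ∫⁻ ψ, ENNReal.ofReal (‖ψ k‖ ^ 2) ∂gaussianCoeff β ≤
      ENNReal.ofReal (stdDev β k ^ 2 * stdMoment 2) := by
  have key : ∀ l : Freq, l = k ∨ l = -k → ∫⁻ z, ENNReal.ofReal (‖z l‖ ^ 2)
      ∂Measure.infinitePi (coordLaw β) = ENNReal.ofReal (stdDev β k ^ 2 * stdMoment 2) := by
    intro l hl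
    have h1 : stdDev β k = stdDev β l := by rw [stdDev, stdDev, absFreq_eq_of_eq_or hl]
    rw [h1, ← integral_norm_pow_coordLaw hβ, ofReal_integral_eq_lintegral_ofReal
      (integrable_norm_pow_coordLaw hβ l 2) (ae_of_all _ fun z => by positivity)]
    exact (measurePreserving_eval_infinitePi (coordLaw β) l).lintegral_comp
      (f := fun z : ℂ => ENNReal.ofReal (‖z‖ ^ 2)) (by fun_prop)
  rw [gaussianCoeff, lintegral_map (by fun_prop) measurable_hermitianExtension]
  by_cases h1 : k ∈ halfLattice
  · refine (lintegral_mono fun z => ?_).trans (key k (Or.inl rfl)).le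
    rw [hermitianExtension_of_mem h1]
  · refine (lintegral_mono fun z => ?_).trans (key (-k) (Or.inr rfl)).le
    rw [hermitianExtension, if_neg h1]
    split_ifs
    · rw [RCLike.norm_conj]
    · simp

/-- The variance of the coefficient at `k` is of order `|k|^{-2}`, and `∑ |k|^{2s-2}` converges on
`ℤ²` for `s < 0`. The threshold `-2` of the theorem comes from the nonlinearity, not from the
Gaussian measure. -/
theorem lintegral_sobolevSum_gaussianCoeff_lt_top {β : ℝ} (hβ : 0 < β) {s : ℝ} (hs : s < 0) :
    ∫⁻ ψ, sobolevSum s ψ ∂gaussianCoeff β < ∞ := by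
  simp only [sobolevSum]
  rw [lintegral_tsum fun k => (show Measurable fun ψ : Freq → ℂ =>
    ENNReal.ofReal (absFreq k ^ (2 * s) * ‖ψ k‖ ^ 2) by fun_prop).aemeasurable]
  have hsum : Summable fun k : Freq => stdMoment 2 / (4 * β) * absFreq k ^ (-(2 - 2 * s)) :=
    (summable_absFreq_rpow (by linarith)).mul_left _
  refine (ENNReal.tsum_le_tsum fun k => ?_).trans_lt hsum.tsum_ofReal_lt_top
  have h1 : ∀ ψ : Freq → ℂ, ENNReal.ofReal (absFreq k ^ (2 * s) * ‖ψ k‖ ^ 2) =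
      ENNReal.ofReal (absFreq k ^ (2 * s)) * ENNReal.ofReal (‖ψ k‖ ^ 2) := fun ψ =>
    ENNReal.ofReal_mul (Real.rpow_nonneg (absFreq_nonneg k) _)
  simp_rw [h1]
  rw [lintegral_const_mul _ (by fun_prop)]
  refine (mul_le_mul_right (lintegral_norm_sq_gaussianCoeff_le hβ k) _).trans (le_of_eq ?_)
  rw [← ENNReal.ofReal_mul (Real.rpow_nonneg (absFreq_nonneg k) _), stdDev_sq hβ]
  congr 1
  rcases eq_or_ne k 0 with rfl | hk
  · rw [absFreq_zero, Real.zero_rpow (show 2 * s ≠ 0 by linarith),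
      Real.zero_rpow (show -(2 - 2 * s) ≠ 0 by linarith)]
    simp
  · have hk' := absFreq_pos hk
    have h2 : absFreq k ^ (-(2 - 2 * s)) = absFreq k ^ (2 * s) / absFreq k ^ 2 := by
      rw [← Real.rpow_natCast (absFreq k) 2, ← Real.rpow_sub hk']
      congr 1
      push_cast
      ring
    rw [h2]
    field_simp

theorem ae_mem_xSpace {β : ℝ} (hβ : 0 < β) {σ : ℝ} (hσ : σ < 0) :
    ∀ᵐ ψ ∂gaussianCoeff β, ψ ∈ {ψ : Freq → ℂ | ∀ s < σ, IsSobolev s ψ} := by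
  have h1 : ∀ᵐ ψ ∂gaussianCoeff β, IsHermitian ψ := by
    rw [gaussianCoeff, ae_map_iff measurable_hermitianExtension.aemeasurable
      measurableSet_isHermitian]
    exact ae_of_all _ isHermitian_hermitianExtension
  filter_upwards [h1, ae_lt_top (measurable_sobolevSum σ)
    (lintegral_sobolevSum_gaussianCoeff_lt_top hβ hσ).ne] with ψ h2 h3 s hs
  exact isSobolev_mono hs.le (isSobolev_iff.2 ⟨h2, h3.ne⟩)

/-- Restricting to `X^σ` loses no mass, because almost every Gaussian sequence lies in it. -/
theorem map_coeff_rho {β : ℝ} (hβ : 0 < β) {σ : ℝ} (hσ : σ < 0) :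
    (rho β σ).map XSpace.coeff = gaussianCoeff β := by
  rw [rho, (measurableEmbedding_coeff σ).map_comap, range_coeff]
  exact Measure.restrict_eq_self_of_ae_mem (ae_mem_xSpace hβ hσ)

theorem isProbabilityMeasure_rho {β : ℝ} (hβ : 0 < β) {σ : ℝ} (hσ : σ < 0) :
    IsProbabilityMeasure (rho β σ) := by
  constructor
  rw [← preimage_univ (f := XSpace.coeff), ← Measure.map_apply
    (measurableEmbedding_coeff σ).measurable MeasurableSet.univ, map_coeff_rho hβ hσ, measure_univ]

theorem measurable_restrictHalf (N : ℕ) : Measurable (restrictHalf N) :=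
  measurable_pi_lambda _ fun k => measurable_pi_apply (k : Freq)

theorem map_restrictHalf_gaussianCoeff (β : ℝ) (N : ℕ) :
    (gaussianCoeff β).map (restrictHalf N) = phaseLaw β N := by
  rw [gaussianCoeff, Measure.map_map (measurable_restrictHalf N) measurable_hermitianExtension]
  have h1 : restrictHalf N ∘ hermitianExtension =
      ({k | k ∈ halfLattice ∧ k ∈ box N} : Set Freq).domRestrict := by
    funext z k
    exact hermitianExtension_of_mem k.2.1
  rw [h1, Measure.infinitePi_map_restrict']
  exact Measure.infinitePi_eq_pi fun k : Half N => coordLaw β k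

/-- The coefficients in `Half N` have law `phaseLaw` under `rho`. -/
theorem measurePreserving_restrictHalf {β : ℝ} (hβ : 0 < β) {σ : ℝ} (hσ : σ < 0) (N : ℕ) :
    MeasurePreserving (fun ψ : XSpace σ => restrictHalf N ψ.coeff) (rho β σ) (phaseLaw β N) := by
  refine ⟨(measurable_restrictHalf N).comp (measurableEmbedding_coeff σ).measurable, ?_⟩
  rw [← map_restrictHalf_gaussianCoeff, ← map_coeff_rho hβ hσ,
    Measure.map_map (measurable_restrictHalf N) (measurableEmbedding_coeff σ).measurable]
  rfl

/-! ### Compactness in `H^s` and in `C([0, T], H^s)` -/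

theorem Hs.isHermitian {s : ℝ} (f : Hs s) : IsHermitian f.coeff :=
  ⟨f.isSobolev.1, f.isSobolev.2.1⟩

theorem Hs.coeff_injective {s : ℝ} : Function.Injective (Hs.coeff (s := s)) :=
  Subtype.val_injective

theorem Hs.coeff_sub {s : ℝ} (f g : Hs s) : (f - g).coeff = f.coeff - g.coeff := rfl

theorem Hs.sum_le_norm_sq {s : ℝ} (f : Hs s) (F : Finset Freq) :
    ∑ k ∈ F, absFreq k ^ (2 * s) * ‖f.coeff k‖ ^ 2 ≤ ‖f‖ ^ 2 := by
  rw [Hs.norm_sq]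
  exact f.isSobolev.2.2.sum_le_tsum F fun k _ => sobolev_term_nonneg s _ k

theorem Hs.norm_sq_le {s A : ℝ} (f : Hs s)
    (h : ∀ F : Finset Freq, ∑ k ∈ F, absFreq k ^ (2 * s) * ‖f.coeff k‖ ^ 2 ≤ A) :
    ‖f‖ ^ 2 ≤ A := by
  rw [Hs.norm_sq]
  exact f.isSobolev.2.2.tsum_le_of_sum_le h

theorem Hs.continuous_coeff {s : ℝ} (k : Freq) : Continuous fun f : Hs s => f.coeff k := by
  rcases eq_or_ne k 0 with rfl | hk
  · simp_rw [(Hs.isHermitian _).1]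
    exact continuous_const
  have hpos : 0 < absFreq k ^ s := Real.rpow_pos_of_pos (absFreq_pos hk) s
  have hle : ∀ f : Hs s, ‖f.coeff k‖ ≤ (absFreq k ^ s)⁻¹ * ‖f‖ := fun f => by
    have h1 := f.sum_le_norm_sq {k}
    rw [Finset.sum_singleton, ← norm_weighted_sq] at h1
    have h2 := pow_le_pow_iff_left₀ (norm_nonneg _) (norm_nonneg f) two_ne_zero |>.1 h1
    rw [weighted, norm_mul, Complex.norm_real, Real.norm_of_nonneg hpos.le] at h2
    rwa [← div_eq_inv_mul, le_div_iff₀ hpos, mul_comm]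
  refine LipschitzWith.continuous (K := ((absFreq k ^ s)⁻¹).toNNReal)
    (LipschitzWith.of_dist_le_mul fun f g => ?_)
  rw [Real.coe_toNNReal _ (inv_nonneg.2 hpos.le), dist_eq_norm, dist_eq_norm]
  exact hle (f - g)

theorem isSobolev_trigPoly (s : ℝ) {N : ℕ} (x : Phase N) : IsSobolev s (trigPoly N x) := by
  refine ⟨(isHermitian_trigPoly x).1, (isHermitian_trigPoly x).2, ?_⟩
  refine summable_of_ne_finset_zero (s := boxFinset N) fun k hk => ?_
  rw [trigPoly_of_notMem x fun h => hk (mem_boxFinset.2 h)]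
  simp

/-- The trigonometric polynomial with given coefficients as an element of `H^s`. -/
def trigHs (s : ℝ) (N : ℕ) : Phase N →ₗ[ℝ] Hs s where
  toFun x := ⟨trigPoly N x, isSobolev_trigPoly s x⟩
  map_add' x y := Subtype.ext (map_add (trigPoly N) x y)
  map_smul' c x := Subtype.ext (map_smul (trigPoly N) c x)

theorem coeff_trigHs {s : ℝ} {N : ℕ} (x : Phase N) : (trigHs s N x).coeff = trigPoly N x := rfl

theorem continuous_trigHs (s : ℝ) (N : ℕ) : Continuous (trigHs s N) :=
  LinearMap.continuous_of_finiteDimensional _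

theorem lt_absFreq_of_notMem_box {N : ℕ} {k : Freq} (hk : k ∉ box N) : (N : ℝ) + 1 ≤ absFreq k := by
  have h : (N : ℤ) + 1 ≤ |k.1| ∨ (N : ℤ) + 1 ≤ |k.2| := by
    have h' : (N : ℤ) < max |k.1| |k.2| := not_le.1 hk
    simpa [lt_max_iff, Int.add_one_le_iff] using h'
  refine Real.le_sqrt_of_sq_le ?_
  rcases h with h | h
  · have h' : (N : ℝ) + 1 ≤ |(k.1 : ℝ)| := by exact_mod_cast h
    have : ((N : ℝ) + 1) ^ 2 ≤ |(k.1 : ℝ)| ^ 2 := by gcongr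
    rw [sq_abs] at this
    nlinarith [sq_nonneg (k.2 : ℝ)]
  · have h' : (N : ℝ) + 1 ≤ |(k.2 : ℝ)| := by exact_mod_cast h
    have : ((N : ℝ) + 1) ^ 2 ≤ |(k.2 : ℝ)| ^ 2 := by gcongr
    rw [sq_abs] at this
    nlinarith [sq_nonneg (k.1 : ℝ)]

/-- Approximation by Fourier truncation, with a rate. -/
theorem norm_sub_trigHs_sq_le {s s' R : ℝ} (hs : s < s') (f : Hs s)
    (h : ∀ F : Finset Freq, ∑ k ∈ F, absFreq k ^ (2 * s') * ‖f.coeff k‖ ^ 2 ≤ R) (N : ℕ) :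
    ‖f - trigHs s N (restrictHalf N f.coeff)‖ ^ 2 ≤ ((N : ℝ) + 1) ^ (2 * (s - s')) * R := by
  refine Hs.norm_sq_le _ fun F => ?_
  have hpos : 0 ≤ ((N : ℝ) + 1) ^ (2 * (s - s')) := by positivity
  refine le_trans ?_ (mul_le_mul_of_nonneg_left (h F) hpos)
  rw [Finset.mul_sum]
  refine Finset.sum_le_sum fun k _ => ?_
  rw [Hs.coeff_sub, coeff_trigHs, trigPoly_restrictHalf f.isHermitian, Pi.sub_apply]
  by_cases hk : k ∈ box N
  · rw [proj_of_mem hk, sub_self, norm_zero, zero_pow two_ne_zero, mul_zero]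
    exact mul_nonneg hpos (sobolev_term_nonneg s' _ k)
  · rw [proj_of_notMem hk, sub_zero, ← mul_assoc]
    have hN := lt_absFreq_of_notMem_box hk
    have hN0 : (0 : ℝ) < (N : ℝ) + 1 := by positivity
    have h1 : absFreq k ^ (2 * s) = absFreq k ^ (2 * (s - s')) * absFreq k ^ (2 * s') := by
      rw [← Real.rpow_add (hN0.trans_le hN)]
      congr 1
      ring
    rw [h1]
    have h2 : absFreq k ^ (2 * (s - s')) ≤ ((N : ℝ) + 1) ^ (2 * (s - s')) :=
      Real.rpow_le_rpow_of_nonpos hN0 hN (by linarith)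
    have h3 : 0 ≤ absFreq k ^ (2 * s') := Real.rpow_nonneg (absFreq_nonneg k) _
    gcongr

theorem tendsto_rate {s s' : ℝ} (hs : s < s') (R : ℝ) :
    Tendsto (fun N : ℕ => ((N : ℝ) + 1) ^ (2 * (s - s')) * R) atTop (𝓝 0) := by
  have h1 : Tendsto (fun x : ℝ => x ^ (-(2 * (s' - s)))) atTop (𝓝 0) :=
    tendsto_rpow_neg_atTop (by linarith)
  have h2 : Tendsto (fun N : ℕ => (N : ℝ) + 1) atTop atTop :=
    tendsto_atTop_add_const_right _ _ tendsto_natCast_atTop_atTop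
  have h3 := (h1.comp h2).mul_const R
  rw [zero_mul] at h3
  refine h3.congr fun N => ?_
  simp only [Function.comp_apply]
  congr 2
  ring

/-- Balls of `H^{s'}` are compact in `H^s` for `s < s'`. -/
theorem isCompact_ellipsoid {s s' : ℝ} (hs : s < s') (R : ℝ) : IsCompact {f : Hs s |
    ∀ F : Finset Freq, ∑ k ∈ F, absFreq k ^ (2 * s') * ‖f.coeff k‖ ^ 2 ≤ R} := by
  -- Bounds on all finite partial sums are closed under coefficientwise convergence, and they
  -- already imply membership in `H^{s'}`. By Tychonoff, `E` is compact in the product topology.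
  set E : Set (Freq → ℂ) := {ψ | IsHermitian ψ ∧
    ∀ F : Finset Freq, ∑ k ∈ F, absFreq k ^ (2 * s') * ‖ψ k‖ ^ 2 ≤ R} with hE
  have hclosed : IsClosed E := by
    have h1 : E = {ψ | ψ 0 = 0} ∩ (⋂ k, {ψ | ψ (-k) = conj (ψ k)}) ∩
        ⋂ F : Finset Freq, {ψ | ∑ k ∈ F, absFreq k ^ (2 * s') * ‖ψ k‖ ^ 2 ≤ R} := by
      ext ψ
      simp [hE, IsHermitian]
    rw [h1]
    refine ((isClosed_eq (continuous_apply 0) continuous_const).inter (isClosed_iInter fun k =>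
      isClosed_eq (continuous_apply (-k)) (Complex.continuous_conj.comp (continuous_apply k)))).inter
      (isClosed_iInter fun F => isClosed_le (by fun_prop) continuous_const)
  have hsub : E ⊆ univ.pi fun k =>
      Metric.closedBall (0 : ℂ) (Real.sqrt ((absFreq k ^ (2 * s'))⁻¹ * R)) := by
    rintro ψ ⟨h1, h2⟩ k -
    rw [mem_closedBall_zero_iff]
    rcases eq_or_ne k 0 with rfl | hk
    · rw [h1.1, norm_zero]
      exact Real.sqrt_nonneg _
    · refine Real.le_sqrt_of_sq_le ?_
      have h3 := h2 {k}
      rw [Finset.sum_singleton] at h3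
      have hpos : 0 < absFreq k ^ (2 * s') := Real.rpow_pos_of_pos (absFreq_pos hk) _
      rwa [← div_eq_inv_mul, le_div_iff₀ hpos, mul_comm]
  have hcomp : IsCompact E :=
    (isCompact_univ_pi fun k => isCompact_closedBall _ _).of_isClosed_subset hclosed hsub
  have hsob : ∀ ψ ∈ E, IsSobolev s ψ := fun ψ hψ => by
    refine isSobolev_mono hs.le ⟨hψ.1.1, hψ.1.2, ?_⟩
    exact summable_of_sum_le (fun k => sobolev_term_nonneg s' ψ k) hψ.2
  let j : E → Hs s := fun ψ => ⟨ψ.1, hsob ψ.1 ψ.2⟩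
  -- On `E` the inclusion into `H^s` is a uniform limit of Fourier truncations, each continuous in
  -- finitely many coefficients. Hence it is continuous from the product topology, and its image is
  -- compact.
  have hj : Continuous j := by
    have hunif : TendstoUniformly
        (fun (N : ℕ) (ψ : E) => trigHs s N (restrictHalf N ψ.1)) j atTop := by
      rw [Metric.tendstoUniformly_iff]
      intro ε hε
      filter_upwards [(tendsto_rate hs R).eventually_lt_const (show (0 : ℝ) < ε ^ 2 by positivity)]
        with N hN ψ
      rw [dist_eq_norm]
      refine lt_of_pow_lt_pow_left₀ 2 hε.le (lt_of_le_of_lt ?_ hN)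
      exact norm_sub_trigHs_sq_le hs (j ψ) ψ.2.2 N
    refine hunif.continuous (Frequently.of_forall fun N => (continuous_trigHs s N).comp ?_)
    exact continuous_pi fun k => (continuous_apply (k : Freq)).comp continuous_subtype_val
  have : CompactSpace E := isCompact_iff_compactSpace.1 hcomp
  convert isCompact_range hj using 1
  ext f
  constructor
  · intro hf
    exact ⟨⟨f.coeff, f.isHermitian, hf⟩, rfl⟩
  · rintro ⟨ψ, rfl⟩
    exact ψ.2.2

/-- Paths that start in the ball of radius `R^{1/2}` of `H^{s'}` and are Hölder continuous of
exponent `1/2` with constant `R^{1/2}` in `H^{s'}`. -/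
def holderPaths (T s s' R : ℝ) : Set C(Icc (0 : ℝ) T, Hs s) :=
  {u | ∀ F : Finset Freq,
    (∀ t : Icc (0 : ℝ) T, (t : ℝ) = 0 → ∑ k ∈ F, absFreq k ^ (2 * s') * ‖(u t).coeff k‖ ^ 2 ≤ R) ∧
    ∀ t τ : Icc (0 : ℝ) T, ∑ k ∈ F, absFreq k ^ (2 * s') * ‖(u t).coeff k - (u τ).coeff k‖ ^ 2 ≤
      R * |(t : ℝ) - τ|}

theorem sum_norm_add_sq_le (w : Freq → ℝ) (hw : ∀ k, 0 ≤ w k) (F : Finset Freq) (f g : Freq → ℂ) :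
    ∑ k ∈ F, w k * ‖f k‖ ^ 2 ≤
      2 * ∑ k ∈ F, w k * ‖g k‖ ^ 2 + 2 * ∑ k ∈ F, w k * ‖f k - g k‖ ^ 2 := by
  rw [Finset.mul_sum, Finset.mul_sum, ← Finset.sum_add_distrib]
  refine Finset.sum_le_sum fun k _ => ?_
  have h1 : ‖f k‖ ≤ ‖g k‖ + ‖f k - g k‖ := by
    simpa using norm_add_le (g k) (f k - g k)
  have h2 : ‖f k‖ ^ 2 ≤ 2 * ‖g k‖ ^ 2 + 2 * ‖f k - g k‖ ^ 2 := by
    have : ‖f k‖ ^ 2 ≤ (‖g k‖ + ‖f k - g k‖) ^ 2 := by gcongr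
    nlinarith [sq_nonneg (‖g k‖ - ‖f k - g k‖)]
  nlinarith [hw k]

/-- Arzelà–Ascoli: the Hölder bound gives equicontinuity, and together with the bound at time `0` it
confines all values to one ellipsoid, compact in `H^s`. -/
theorem isCompact_holderPaths {T s s' : ℝ} (hT : 0 ≤ T) (hs : s < s') (R : ℝ) :
    IsCompact (holderPaths T s s' R) := by
  let P : (Icc (0 : ℝ) T → Hs s) → Prop := fun g => ∀ F : Finset Freq,
    (∀ t : Icc (0 : ℝ) T, (t : ℝ) = 0 → ∑ k ∈ F, absFreq k ^ (2 * s') * ‖(g t).coeff k‖ ^ 2 ≤ R) ∧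
    ∀ t τ : Icc (0 : ℝ) T, ∑ k ∈ F, absFreq k ^ (2 * s') * ‖(g t).coeff k - (g τ).coeff k‖ ^ 2 ≤
      R * |(t : ℝ) - τ|
  have hmod : ∀ g, P g → ∀ t τ : Icc (0 : ℝ) T, ‖g t - g τ‖ ^ 2 ≤ R * |(t : ℝ) - τ| := fun g hg t τ =>
    Hs.norm_sq_le _ fun F => (Finset.sum_le_sum fun k _ =>
      sobolev_term_mono hs.le (g t - g τ).isHermitian.1 k).trans ((hg F).2 t τ)
  have hR : ∀ g, P g → 0 ≤ R := fun g hg => by simpa using (hg ∅).1 ⟨0, left_mem_Icc.2 hT⟩ rfl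
  have hδ : ∀ ε > 0, ∃ δ > 0, ∀ g, P g → ∀ t τ : Icc (0 : ℝ) T, dist t τ < δ →
      dist (g t) (g τ) < ε := fun ε hε => by
    refine ⟨ε ^ 2 / (|R| + 1), by positivity, fun g hg t τ h => ?_⟩
    rw [dist_eq_norm]
    refine lt_of_pow_lt_pow_left₀ 2 hε.le ((hmod g hg t τ).trans_lt ?_)
    rw [lt_div_iff₀ (by positivity), Subtype.dist_eq, Real.dist_eq] at h
    have h1 : R ≤ |R| := le_abs_self R
    have h2 : 0 ≤ |(t : ℝ) - τ| := abs_nonneg _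
    nlinarith
  refine ArzelaAscoli.isCompact_of_equicontinuous _ ?_ ?_
  -- Compactness of the image is needed in the topology of pointwise convergence. The conditions
  -- already force continuity, so the image is the set of all functions satisfying them, which is
  -- pointwise closed.
  · have himage : ContinuousMap.toFun '' holderPaths T s s' R = {g | P g} := by
      ext g
      constructor
      · rintro ⟨u, hu, rfl⟩
        exact hu
      · intro hg
        refine ⟨⟨g, Metric.continuous_iff.2 fun t ε hε => ?_⟩, hg, rfl⟩
        obtain ⟨δ, hδ0, h⟩ := hδ ε hε
        exact ⟨δ, hδ0, fun τ hτ => h g hg τ t hτ⟩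
    rw [himage]
    -- The radius comes from `‖g t‖² ≤ 2 ‖g 0‖² + 2 ‖g t - g 0‖²` with the bounds `R` and `R T`.
    refine (isCompact_univ_pi fun _ => isCompact_ellipsoid hs (2 * R + 2 * (R * T)))
      |>.of_isClosed_subset ?_ ?_
    · have hc : ∀ (t : Icc (0 : ℝ) T) k, Continuous fun g : Icc (0 : ℝ) T → Hs s => (g t).coeff k := fun t k =>
        (Hs.continuous_coeff k).comp (continuous_apply t)
      simp only [P, ofPred_forall, ofPred_and]
      refine isClosed_iInter fun F => IsClosed.inter ?_ ?_
      · refine isClosed_iInter fun t => isClosed_iInter fun _ => isClosed_le ?_ continuous_const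
        exact continuous_finsetSum _ fun k _ => continuous_const.mul ((hc t k).norm.pow 2)
      · refine isClosed_iInter fun t => isClosed_iInter fun τ => isClosed_le ?_ continuous_const
        exact continuous_finsetSum _ fun k _ =>
          continuous_const.mul (((hc t k).sub (hc τ k)).norm.pow 2)
    · rintro g hg t - F
      have hR0 := hR g hg
      have h1 := sum_norm_add_sq_le (fun k => absFreq k ^ (2 * s'))
        (fun k => Real.rpow_nonneg (absFreq_nonneg k) _) F (g t).coeff
        (g ⟨0, left_mem_Icc.2 hT⟩).coeff
      have h2 := (hg F).1 ⟨0, left_mem_Icc.2 hT⟩ rfl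
      have h3 := (hg F).2 t ⟨0, left_mem_Icc.2 hT⟩
      have h4 : |(t : ℝ) - 0| ≤ T := by rw [sub_zero, abs_of_nonneg t.2.1]; exact t.2.2
      have h5 : R * |(t : ℝ) - 0| ≤ R * T := by gcongr
      linarith
  · refine Metric.equicontinuous_of_continuity_modulus (fun r => Real.sqrt (|R| * r)) ?_ _ ?_
    · have : Continuous fun r => Real.sqrt (|R| * r) := by fun_prop
      simpa using this.tendsto 0
    · rintro t τ ⟨u, hu⟩
      rw [dist_eq_norm]
      refine Real.le_sqrt_of_sq_le ((hmod u hu t τ).trans ?_)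
      rw [Subtype.dist_eq, Real.dist_eq]
      gcongr
      exact le_abs_self R

/-! ### Existence, uniqueness and measurability of the truncated flow -/

section Flow

variable {δ T s : ℝ} {N : ℕ}

/-- An element of `X^σ` as an element of `H^s`, `s < σ`. -/
def XSpace.toHs {σ : ℝ} (hs : s < σ) (ψ : XSpace σ) : Hs s := ⟨ψ.coeff, ψ.2 s hs⟩

/-- A path in the phase space as a path in `H^s`. -/
def liftPath (T s : ℝ) (N : ℕ) (p : C(Icc (0 : ℝ) T, Phase N)) : C(Icc (0 : ℝ) T, Hs s) :=
  (⟨trigHs s N, continuous_trigHs s N⟩ : C(Phase N, Hs s)).comp p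

theorem continuous_liftPath (T s : ℝ) (N : ℕ) : Continuous (liftPath T s N) :=
  ContinuousMap.continuous_postcomp _

/-- The flow of the truncated equation on the phase space. -/
def phaseFlow (δ : ℝ) (N : ℕ) (hT : 0 ≤ T) : Phase N → C(Icc (0 : ℝ) T, Phase N) :=
  (isConservative_truncField δ N).flowPath hT

theorem continuous_phaseFlow (δ : ℝ) (N : ℕ) (hT : 0 ≤ T) : Continuous (phaseFlow δ N hT) :=
  (isConservative_truncField δ N).continuous_flowPath hT

theorem phaseFlow_zero (hT : 0 ≤ T) (x : Phase N) :
    phaseFlow δ N hT x ⟨0, left_mem_Icc.2 hT⟩ = x :=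
  (isConservative_truncField δ N).flow_zero hT x

/-- The flow of the truncated equation: the coefficients in the box evolve by `phaseFlow`, the
other ones are constant. -/
def truncFlow (δ : ℝ) (N : ℕ) (hT : 0 ≤ T) {σ : ℝ} (hs : s < σ) (ψ : XSpace σ) :
    C(Icc (0 : ℝ) T, Hs s) :=
  liftPath T s N (phaseFlow δ N hT (restrictHalf N ψ.coeff)) +
    ContinuousMap.const _ (ψ.toHs hs - trigHs s N (restrictHalf N ψ.coeff))

variable {σ : ℝ} {hs : s < σ} {hT : 0 ≤ T}

theorem coeff_truncFlow (ψ : XSpace σ) (t : Icc (0 : ℝ) T) :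
    (truncFlow δ N hT hs ψ t).coeff =
      trigPoly N (phaseFlow δ N hT (restrictHalf N ψ.coeff) t) + (ψ.coeff - proj N ψ.coeff) := by
  rw [← trigPoly_restrictHalf ψ.isHermitian]
  rfl

theorem proj_add_sub (x : Phase N) (ψ : Freq → ℂ) :
    proj N (trigPoly N x + (ψ - proj N ψ)) = trigPoly N x := by
  funext k
  by_cases hk : k ∈ box N
  · simp [proj_of_mem hk]
  · rw [proj_of_notMem hk, trigPoly_of_notMem x hk]

theorem hasDerivWithinAt_phaseFlow (x : Phase N) (t : Icc (0 : ℝ) T) (k : Freq) :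
    HasDerivWithinAt (IccExtend hT fun τ => trigPoly N (phaseFlow δ N hT x τ) k)
      (truncNonlinearity δ N (trigPoly N (phaseFlow δ N hT x t)) k) (Icc 0 T) t := by
  have h1 := (isConservative_truncField δ N).isODESol_flow hT x t t.2
  have h2 := (trigCoeff N k).hasFDerivAt.comp_hasDerivWithinAt (t : ℝ) h1
  rw [trigCoeff_apply, trigPoly_truncField] at h2
  refine h2.congr (fun τ hτ => ?_) ?_
  · rw [IccExtend_of_mem _ _ hτ]; rfl
  · rw [IccExtend_of_mem _ _ t.2]; rfl

theorem isTruncatedSolution_truncFlow (ψ : XSpace σ) :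
    IsTruncatedSolution δ N hT ψ.coeff (truncFlow δ N hT hs ψ) where
  initial := by
    rw [coeff_truncFlow, phaseFlow_zero, trigPoly_restrictHalf ψ.isHermitian, add_sub_cancel]
  equation t k := by
    rw [← truncNonlinearity_proj, coeff_truncFlow, proj_add_sub]
    refine ((hasDerivWithinAt_phaseFlow (hT := hT) (restrictHalf N ψ.coeff) t k).add_const
      ((ψ.coeff - proj N ψ.coeff) k)).congr (fun τ hτ => ?_) ?_
    · rw [IccExtend_of_mem _ _ hτ, IccExtend_of_mem _ _ hτ, coeff_truncFlow]; rfl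
    · rw [IccExtend_of_mem _ _ t.2, IccExtend_of_mem _ _ t.2, coeff_truncFlow]; rfl

/-- The coefficients in the box solve the finite-dimensional equation, whose solutions are unique;
those outside have zero derivative and keep their initial value. -/
theorem eq_truncFlow {ψ : XSpace σ} {u : C(Icc (0 : ℝ) T, Hs s)}
    (hu : IsTruncatedSolution δ N hT ψ.coeff u) : u = truncFlow δ N hT hs ψ := by
  have hode : IsODESol (truncField δ N) T
      (fun t => restrictHalf N (u (projIcc 0 T hT t)).coeff) := by
    intro t ht
    refine hasDerivWithinAt_pi.2 fun k => ?_
    have h1 := hu.equation ⟨t, ht⟩ k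
    change HasDerivWithinAt _ (truncField δ N (restrictHalf N (u (projIcc 0 T hT t)).coeff) k) _ _
    rw [projIcc_of_mem hT ht, truncField, trigPoly_restrictHalf (Hs.isHermitian _),
      truncNonlinearity_proj]
    exact h1
  have hflow : ∀ t : Icc (0 : ℝ) T,
      restrictHalf N (u t).coeff = phaseFlow δ N hT (restrictHalf N ψ.coeff) t := fun t => by
    have := (isConservative_truncField δ N).eq_of_isODESol hode
      ((isConservative_truncField δ N).isODESol_flow hT (restrictHalf N ψ.coeff)) ?_ t.2
    · simp only [projIcc_val] at this
      exact this
    · rw [projIcc_left, hu.initial, IsConservative.flow_zero]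
  ext t
  refine Hs.coeff_injective (funext fun k => ?_)
  rw [coeff_truncFlow, ← hflow t, trigPoly_restrictHalf (Hs.isHermitian _)]
  by_cases hk : k ∈ box N
  · simp [proj_of_mem hk]
  · rw [Pi.add_apply, Pi.sub_apply, proj_of_notMem hk, proj_of_notMem hk, zero_add, sub_zero]
    have hd : ∀ t ∈ Icc (0 : ℝ) T,
        HasDerivWithinAt (IccExtend hT fun τ => (u τ).coeff k) 0 (Icc 0 T) t := fun t ht => by
      have := hu.equation ⟨t, ht⟩ k
      rwa [truncNonlinearity_of_notMem hk] at this
    have := constant_of_has_deriv_right_zero (fun t ht => (hd t ht).continuousWithinAt)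
      (fun t ht => hasDerivWithinAt_Ici_of_Icc (hd t (Ico_subset_Icc_self ht)) ht) t t.2
    rw [IccExtend_of_mem _ _ t.2, IccExtend_left, hu.initial] at this
    exact this

theorem tendsto_trigHs_restrictHalf (ψ : XSpace σ) :
    Tendsto (fun M => trigHs s M (restrictHalf M ψ.coeff)) atTop (𝓝 (ψ.toHs hs)) := by
  obtain ⟨s', h1, h2⟩ := exists_between hs
  have hsum := (ψ.2 s' h2).2.2
  rw [tendsto_iff_dist_tendsto_zero]
  have h3 : ∀ M : ℕ, dist (trigHs s M (restrictHalf M ψ.coeff)) (ψ.toHs hs) ^ 2 ≤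
      ((M : ℝ) + 1) ^ (2 * (s - s')) * ∑' k, absFreq k ^ (2 * s') * ‖ψ.coeff k‖ ^ 2 := fun M => by
    rw [dist_comm, dist_eq_norm]
    exact norm_sub_trigHs_sq_le h1 (ψ.toHs hs)
      (fun F => hsum.sum_le_tsum F fun k _ => sobolev_term_nonneg s' _ k) M
  have h4 := squeeze_zero (fun M => sq_nonneg _) h3 (tendsto_rate h1 _)
  have h5 := (Real.continuous_sqrt.tendsto 0).comp h4
  rw [Real.sqrt_zero] at h5
  exact h5.congr fun M => Real.sqrt_sq dist_nonneg

/-- The initial datum is replaced by its truncation at level `M`. The path then depends continuously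
on finitely many coefficients, hence measurably, and converges pointwise as `M → ∞`. -/
theorem measurable_truncFlow : Measurable (truncFlow δ N hT hs (σ := σ)) := by
  let G : ∀ M : ℕ, Phase N × Phase M → C(Icc (0 : ℝ) T, Hs s) := fun M p =>
    liftPath T s N (phaseFlow δ N hT p.1) +
      ContinuousMap.const _ (trigHs s M p.2 - trigHs s N p.1)
  have hG : ∀ M, Continuous (G M) := fun M => by
    refine ((continuous_liftPath T s N).comp
      ((continuous_phaseFlow δ N hT).comp continuous_fst)).add
      (ContinuousMap.continuous_const'.comp ?_)
    exact ((continuous_trigHs s M).comp continuous_snd).sub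
      ((continuous_trigHs s N).comp continuous_fst)
  have hr : ∀ M, Measurable fun ψ : XSpace σ => restrictHalf M ψ.coeff := fun M =>
    (measurable_restrictHalf M).comp (measurableEmbedding_coeff σ).measurable
  refine measurable_of_tendsto_metrizable
    (f := fun M ψ => G M (restrictHalf N ψ.coeff, restrictHalf M ψ.coeff))
    (fun M => (hG M).measurable.comp ((hr N).prodMk (hr M))) (tendsto_pi_nhds.2 fun ψ => ?_)
  refine Tendsto.add tendsto_const_nhds ?_
  exact (ContinuousMap.continuous_const'.tendsto _).comp
    ((tendsto_trigHs_restrictHalf (hs := hs) ψ).sub tendsto_const_nhds)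

end Flow

/-! ### Tightness -/

section Tightness

/-- The fundamental theorem of calculus followed by Cauchy–Schwarz in time; this produces the Hölder
exponent `1/2`. -/
theorem norm_sub_sq_le_integral {T : ℝ} {f f' : ℝ → ℂ}
    (hf : ∀ t ∈ Icc 0 T, HasDerivWithinAt f (f' t) (Icc 0 T) t) (hf' : ContinuousOn f' (Icc 0 T))
    {τ t : ℝ} (hτ : τ ∈ Icc 0 T) (ht : t ∈ Icc 0 T) (h : τ ≤ t) :
    ‖f t - f τ‖ ^ 2 ≤ (t - τ) * ∫ x in τ..t, ‖f' x‖ ^ 2 := by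
  rcases h.eq_or_lt with rfl | hlt
  · simp
  have hsub : Icc τ t ⊆ Icc 0 T := Icc_subset_Icc hτ.1 ht.2
  have hc : ContinuousOn f' (uIcc τ t) := by rw [uIcc_of_le h]; exact hf'.mono hsub
  have hi : IntervalIntegrable f' volume τ t := hc.intervalIntegrable
  have hi1 : IntervalIntegrable (fun x => ‖f' x‖) volume τ t := hc.norm.intervalIntegrable
  have hi2 : IntervalIntegrable (fun x => ‖f' x‖ ^ 2) volume τ t :=
    (hc.norm.pow 2).intervalIntegrable
  have hftc : ∫ x in τ..t, f' x = f t - f τ := by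
    refine intervalIntegral.integral_eq_sub_of_hasDeriv_right_of_le h
      (fun x hx => ((hf x (hsub hx)).continuousWithinAt).mono hsub) (fun x hx => ?_) hi
    have hx0 : x ∈ Ico 0 T := ⟨hτ.1.trans hx.1.le, hx.2.trans_le ht.2⟩
    exact (hasDerivWithinAt_Ici_of_Icc (hf x (Ico_subset_Icc_self hx0)) hx0).mono Ioi_subset_Ici_self
  have hn : ‖f t - f τ‖ ≤ ∫ x in τ..t, ‖f' x‖ := by
    rw [← hftc]
    exact intervalIntegral.norm_integral_le_integral_norm h
  set I := ∫ x in τ..t, ‖f' x‖ with hI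
  set J := ∫ x in τ..t, ‖f' x‖ ^ 2 with hJ
  -- With `c` the mean of `‖f'‖`, Cauchy–Schwarz is the nonnegativity of the variance.
  set c := I / (t - τ) with hcdef
  have hL : 0 < t - τ := sub_pos.2 hlt
  have hvar : 0 ≤ ∫ x in τ..t, (‖f' x‖ - c) ^ 2 :=
    intervalIntegral.integral_nonneg h fun x _ => sq_nonneg _
  have hexp : ∫ x in τ..t, (‖f' x‖ - c) ^ 2 = J - 2 * c * I + c ^ 2 * (t - τ) := by
    have : ∀ x, (‖f' x‖ - c) ^ 2 = ‖f' x‖ ^ 2 - 2 * c * ‖f' x‖ + c ^ 2 := fun x => by ring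
    simp_rw [this]
    rw [intervalIntegral.integral_add (hi2.sub (hi1.const_mul _)) intervalIntegrable_const,
      intervalIntegral.integral_sub hi2 (hi1.const_mul _), intervalIntegral.integral_const_mul,
      intervalIntegral.integral_const, smul_eq_mul]
    ring
  have hcI : c * (t - τ) = I := div_mul_cancel₀ _ hL.ne'
  have h1 : I ^ 2 ≤ (t - τ) * J := by
    rw [hexp] at hvar
    have h2 := mul_nonneg hL.le hvar
    have h3 : (t - τ) * (J - 2 * c * I + c ^ 2 * (t - τ)) =
        (t - τ) * J - 2 * (c * (t - τ)) * I + (c * (t - τ)) ^ 2 := by ring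
    rw [h3, hcI] at h2
    nlinarith
  exact (pow_le_pow_left₀ (norm_nonneg _) hn 2).trans h1

variable {β δ T : ℝ} {N : ℕ}

theorem contDiff_norm_sq_truncNonlinearity (δ : ℝ) (N : ℕ) (k : Freq) :
    ContDiff ℝ 1 fun x : Phase N => ‖truncNonlinearity δ N (trigPoly N x) k‖ ^ 2 := by
  have h : ContDiff ℝ 1 fun x : Phase N => truncNonlinearity δ N (trigPoly N x) k := by
    simp_rw [← trigPoly_truncField]
    exact (trigCoeff N k).contDiff.comp (contDiff_truncField δ N)
  exact h.norm_sq ℝ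

theorem integrable_norm_sq_truncNonlinearity (hβ : 0 < β) (δ : ℝ) (N : ℕ) (k : Freq) :
    Integrable (fun x => ‖truncNonlinearity δ N (trigPoly N x) k‖ ^ 2) (phaseLaw β N) := by
  by_cases hk : k ∈ box N
  swap
  · simp_rw [truncNonlinearity_of_notMem hk]
    exact integrable_const _
  have h1 : ∀ x : Phase N, truncNonlinearity δ N (trigPoly N x) k =
      ∑ h ∈ boxFinset N, (kernel δ k h : ℂ) * pairProd N k h x := fun x =>
    truncNonlinearity_trigPoly x hk
  simp_rw [h1]
  have h2 : ∀ h, MemLp (pairProd N k h) 2 (phaseLaw β N) := fun h =>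
    (memLp_two_iff_integrable_sq_norm (continuous_pairProd k h).aestronglyMeasurable).2
      (integrable_norm_sq_pairProd hβ k h)
  have h3 : MemLp (fun x => ∑ h ∈ boxFinset N, (kernel δ k h : ℂ) * pairProd N k h x) 2
      (phaseLaw β N) := memLp_finsetSum _ fun h _ => (h2 h).const_mul _
  exact (memLp_two_iff_integrable_sq_norm h3.1).1 h3

/-- The squared `L²` norm in time of a component of the nonlinearity along the flow. -/
def fieldAction (δ : ℝ) (N : ℕ) (hT : 0 ≤ T) (k : Freq) (x : Phase N) : ℝ≥0∞ :=
  ∫⁻ t in Icc 0 T, ENNReal.ofReal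
    (‖truncNonlinearity δ N (trigPoly N (phaseFlow δ N hT x (projIcc 0 T hT t))) k‖ ^ 2)

theorem measurable_uncurry_fieldAction (hT : 0 ≤ T) (k : Freq) :
    Measurable fun p : Phase N × ℝ => ENNReal.ofReal
      (‖truncNonlinearity δ N (trigPoly N (phaseFlow δ N hT p.1 (projIcc 0 T hT p.2))) k‖ ^ 2) := by
  refine Measurable.ennreal_ofReal (Continuous.measurable ?_)
  refine (contDiff_norm_sq_truncNonlinearity δ N k).continuous.comp ?_
  exact ((continuous_phaseFlow δ N hT).comp continuous_fst).eval
    (continuous_projIcc.comp continuous_snd)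

theorem measurable_fieldAction (hT : 0 ≤ T) (k : Freq) : Measurable (fieldAction δ N hT k) :=
  (measurable_uncurry_fieldAction hT k).lintegral_prod_right'

/-- Tonelli exchanges the time integral with the expectation. At each fixed time the expectation is
bounded by its value at time zero, so integration only costs a factor `T`. -/
theorem lintegral_fieldAction_le (hβ : 0 < β) (hT : 0 ≤ T) {C : ℝ} {k : Freq}
    (hC : ∫ x, ‖truncNonlinearity δ N (trigPoly N x) k‖ ^ 2 ∂phaseLaw β N ≤ C) :
    ∫⁻ x, fieldAction δ N hT k x ∂phaseLaw β N ≤ ENNReal.ofReal (C * T) := by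
  have hswap : ∫⁻ x, fieldAction δ N hT k x ∂phaseLaw β N = ∫⁻ t in Icc 0 T, ∫⁻ x, ENNReal.ofReal
      (‖truncNonlinearity δ N (trigPoly N (phaseFlow δ N hT x (projIcc 0 T hT t))) k‖ ^ 2)
        ∂phaseLaw β N :=
    lintegral_lintegral_swap (measurable_uncurry_fieldAction hT k).aemeasurable
  rw [hswap]
  have hle : ∀ t ∈ Icc 0 T, ∫⁻ x, ENNReal.ofReal
      (‖truncNonlinearity δ N (trigPoly N (phaseFlow δ N hT x (projIcc 0 T hT t))) k‖ ^ 2)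
        ∂phaseLaw β N ≤ ENNReal.ofReal C := fun t ht => by
    rw [projIcc_of_mem hT ht]
    refine (lintegral_phaseLaw_flow_le hβ hT (contDiff_norm_sq_truncNonlinearity δ N k)
      (fun x => sq_nonneg _) ht).trans ?_
    rw [← ofReal_integral_eq_lintegral_ofReal (integrable_norm_sq_truncNonlinearity hβ δ N k)
      (ae_of_all _ fun x => sq_nonneg _)]
    exact ENNReal.ofReal_le_ofReal hC
  have hC0 : 0 ≤ C := (integral_nonneg fun x => sq_nonneg _).trans hC
  refine (setLIntegral_mono measurable_const hle).trans (le_of_eq ?_)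
  rw [setLIntegral_const, Real.volume_Icc, sub_zero, ENNReal.ofReal_mul hC0]

/-- The random constant that controls the path of the truncated flow. -/
def pathBound (δ : ℝ) (N : ℕ) (hT : 0 ≤ T) (s' : ℝ) (ψ : Freq → ℂ) : ℝ≥0∞ :=
  sobolevSum s' ψ + ∑ k ∈ boxFinset N, ENNReal.ofReal (absFreq k ^ (2 * s')) *
    fieldAction δ N hT k (restrictHalf N ψ)

theorem measurable_pathBound (hT : 0 ≤ T) (s' : ℝ) : Measurable (pathBound δ N hT s') := by
  refine (measurable_sobolevSum s').add (Finset.measurable_fun_sum _ fun k _ => ?_)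
  exact ((measurable_fieldAction hT k).comp (measurable_restrictHalf N)).const_mul _

theorem ofReal_norm_sub_sq_le (hT : 0 ≤ T) (x : Phase N) (k : Freq) (t τ : Icc (0 : ℝ) T) :
    ENNReal.ofReal (‖trigPoly N (phaseFlow δ N hT x t) k -
      trigPoly N (phaseFlow δ N hT x τ) k‖ ^ 2) ≤
      ENNReal.ofReal |(t : ℝ) - τ| * fieldAction δ N hT k x := by
  wlog h : τ ≤ t generalizing t τ
  · rw [norm_sub_rev, abs_sub_comm]
    exact this τ t (le_of_not_ge h)
  have h' : (τ : ℝ) ≤ t := h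
  set b : ℝ → ℂ := fun r => truncNonlinearity δ N (trigPoly N (phaseFlow δ N hT x
    (projIcc 0 T hT r))) k with hb
  have hbc : Continuous fun r => ‖b r‖ ^ 2 := (contDiff_norm_sq_truncNonlinearity δ N k).continuous.comp
    ((phaseFlow δ N hT x).continuous.comp continuous_projIcc)
  have hbc' : Continuous b := by
    have : b = fun r => trigCoeff N k (truncField δ N (phaseFlow δ N hT x (projIcc 0 T hT r))) := by
      funext r
      rw [trigCoeff_apply, trigPoly_truncField]
    rw [this]
    exact (trigCoeff N k).continuous.comp ((contDiff_truncField δ N).continuous.comp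
      ((phaseFlow δ N hT x).continuous.comp continuous_projIcc))
  have h1 := norm_sub_sq_le_integral (f := IccExtend hT fun τ => trigPoly N (phaseFlow δ N hT x τ) k)
    (f' := b) (fun r hr => by
      have := hasDerivWithinAt_phaseFlow (δ := δ) (hT := hT) x ⟨r, hr⟩ k
      simp only [hb, projIcc_of_mem hT hr]
      exact this) hbc'.continuousOn τ.2 t.2 h'
  rw [IccExtend_of_mem _ _ t.2, IccExtend_of_mem _ _ τ.2] at h1
  rw [abs_of_nonneg (sub_nonneg.2 h')]
  refine (ENNReal.ofReal_le_ofReal h1).trans ?_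
  rw [ENNReal.ofReal_mul (sub_nonneg.2 h'), intervalIntegral.integral_of_le h',
    ofReal_integral_eq_lintegral_ofReal
      ((hbc.integrableOn_Icc (a := (τ : ℝ)) (b := t)).mono_set Ioc_subset_Icc_self)
      (ae_of_all _ fun r => sq_nonneg _)]
  refine mul_le_mul_right (lintegral_mono_set ?_) _
  exact Ioc_subset_Icc_self.trans (Icc_subset_Icc τ.2.1 t.2.2)

/-- The first part of `pathBound` controls the initial value, the second the increments. Frozen
coefficients cancel in differences, so only box frequencies enter the latter. -/
theorem truncFlow_mem_holderPaths {hT : 0 ≤ T} {s s' σ R : ℝ} {hs : s < σ} (hR : 0 ≤ R)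
    {ψ : XSpace σ} (h : pathBound δ N hT s' ψ.coeff ≤ ENNReal.ofReal R) :
    truncFlow δ N hT hs ψ ∈ holderPaths T s s' R := by
  have hw : ∀ k : Freq, 0 ≤ absFreq k ^ (2 * s') := fun k => Real.rpow_nonneg (absFreq_nonneg k) _
  intro F
  refine ⟨fun t ht => ?_, fun t τ => ?_⟩
  · have ht0 : t = ⟨0, left_mem_Icc.2 hT⟩ := Subtype.ext ht
    rw [ht0, (isTruncatedSolution_truncFlow (hT := hT) (hs := hs) ψ).initial,
      ← ENNReal.ofReal_le_ofReal_iff hR,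
      ENNReal.ofReal_sum_of_nonneg fun k _ => sobolev_term_nonneg s' _ k]
    exact (ENNReal.sum_le_tsum F).trans (le_self_add.trans h)
  · rw [← ENNReal.ofReal_le_ofReal_iff (mul_nonneg hR (abs_nonneg _)),
      ENNReal.ofReal_sum_of_nonneg fun k _ => mul_nonneg (hw k) (sq_nonneg _)]
    set x := restrictHalf N ψ.coeff
    have h1 : ∀ k, ENNReal.ofReal (absFreq k ^ (2 * s') * ‖(truncFlow δ N hT hs ψ t).coeff k -
        (truncFlow δ N hT hs ψ τ).coeff k‖ ^ 2) ≤ if k ∈ boxFinset N then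
          ENNReal.ofReal |(t : ℝ) - τ| *
            (ENNReal.ofReal (absFreq k ^ (2 * s')) * fieldAction δ N hT k x) else 0 := fun k => by
      rw [coeff_truncFlow, coeff_truncFlow, Pi.add_apply, Pi.add_apply, add_sub_add_right_eq_sub]
      split_ifs with hk
      · rw [ENNReal.ofReal_mul (hw k), mul_left_comm]
        exact mul_le_mul_right (ofReal_norm_sub_sq_le hT x k t τ) _
      · rw [mem_boxFinset] at hk
        rw [trigPoly_of_notMem _ hk, trigPoly_of_notMem _ hk]
        simp
    calc _ ≤ ∑ k ∈ F, if k ∈ boxFinset N then ENNReal.ofReal |(t : ℝ) - τ| *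
            (ENNReal.ofReal (absFreq k ^ (2 * s')) * fieldAction δ N hT k x) else 0 :=
          Finset.sum_le_sum fun k _ => h1 k
      _ ≤ ∑ k ∈ boxFinset N, ENNReal.ofReal |(t : ℝ) - τ| *
            (ENNReal.ofReal (absFreq k ^ (2 * s')) * fieldAction δ N hT k x) := by
          rw [← Finset.sum_filter]
          exact Finset.sum_le_sum_of_subset fun k hk => (Finset.mem_filter.1 hk).2
      _ = ENNReal.ofReal |(t : ℝ) - τ| * ∑ k ∈ boxFinset N,
            ENNReal.ofReal (absFreq k ^ (2 * s')) * fieldAction δ N hT k x := by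
          rw [Finset.mul_sum]
      _ ≤ ENNReal.ofReal |(t : ℝ) - τ| * ENNReal.ofReal R :=
          mul_le_mul_right (le_add_self.trans h) _
      _ = _ := by rw [mul_comm, ENNReal.ofReal_mul hR]

/-- The nonlinearity at `k` has second moment at most `C |k|²`, so its weighted sum is controlled by
`∑ |k|^{2s'+2}`, which converges on `ℤ²` when `s' < -2`. Bounding the box sum by the full lattice
sum makes the constant independent of `N`. -/
theorem exists_lintegral_pathBound_le (hβ : 0 < β) (hδ : 0 < δ) (hδ' : δ ≤ 1) (hT : 0 ≤ T)
    {s' : ℝ} (hs' : s' < -2) : ∃ C : ℝ≥0∞, C ≠ ∞ ∧ ∀ N : ℕ,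
      ∫⁻ ψ, pathBound δ N hT s' ψ.coeff ∂rho β (-2) ≤ C := by
  obtain ⟨C, hC0, hC⟩ := exists_integral_norm_sq_truncNonlinearity_le hβ hδ hδ'
  have hw : ∀ k : Freq, 0 ≤ absFreq k ^ (2 * s') := fun k => Real.rpow_nonneg (absFreq_nonneg k) _
  have hσ : (-2 : ℝ) < 0 := by norm_num
  have hsum : Summable fun k : Freq => C * T * absFreq k ^ (-(-(2 * s' + 2))) :=
    (summable_absFreq_rpow (by linarith)).mul_left _
  refine ⟨∫⁻ ψ, sobolevSum s' ψ ∂gaussianCoeff β +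
    ∑' k : Freq, ENNReal.ofReal (C * T * absFreq k ^ (-(-(2 * s' + 2)))), ?_, fun N => ?_⟩
  · exact ENNReal.add_ne_top.2
      ⟨(lintegral_sobolevSum_gaussianCoeff_lt_top hβ (by linarith)).ne, hsum.tsum_ofReal_ne_top⟩
  have hcm := (measurableEmbedding_coeff (-2)).measurable
  have hrm := measurePreserving_restrictHalf hβ hσ N
  simp only [pathBound]
  have hsm : Measurable fun ψ : XSpace (-2) => sobolevSum s' ψ.coeff :=
    (measurable_sobolevSum s').comp hcm
  rw [lintegral_add_left hsm]
  refine add_le_add (le_of_eq ?_) ?_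
  · rw [← map_coeff_rho hβ hσ, lintegral_map (measurable_sobolevSum s') hcm]
  · have hfm : ∀ k, Measurable fun ψ : XSpace (-2) =>
        fieldAction δ N hT k (restrictHalf N ψ.coeff) := fun k =>
      (measurable_fieldAction hT k).comp hrm.measurable
    rw [lintegral_finsetSum _ fun k _ => (hfm k).const_mul _]
    refine (Finset.sum_le_sum fun k _ => ?_).trans (ENNReal.sum_le_tsum (boxFinset N))
    rw [lintegral_const_mul _ (hfm k), hrm.lintegral_comp (measurable_fieldAction hT k)]
    refine (mul_le_mul_right (lintegral_fieldAction_le hβ hT (hC N k)) _).trans (le_of_eq ?_)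
    rw [← ENNReal.ofReal_mul (hw k)]
    congr 1
    rcases eq_or_ne k 0 with rfl | hk
    · rw [absFreq_zero, Real.zero_rpow (show -(-(2 * s' + 2)) ≠ 0 by linarith)]
      simp
    · rw [neg_neg, Real.rpow_add (absFreq_pos hk), Real.rpow_two]
      ring

/-- An intermediate exponent `s < s' < -2` leaves room both for the moment bound in `H^{s'}` and for
the compact embedding into `H^s`. Markov's inequality then bounds the mass outside `holderPaths`. -/
theorem isTightMeasureSet_flowLaw {s : ℝ} (hβ : 0 < β) (hδ : 0 < δ) (hδ' : δ ≤ 1) (hT : 0 ≤ T)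
    (hs : s < -2) :
    IsTightMeasureSet (range fun N => flowLaw β (truncFlow δ N hT hs)) := by
  obtain ⟨s', h1, h2⟩ := exists_between hs
  obtain ⟨C, hC, hCN⟩ := exists_lintegral_pathBound_le hβ hδ hδ' hT h2
  refine isTightMeasureSet_iff_exists_isCompact_measure_compl_le.2 fun ε hε => ?_
  rcases eq_or_ne ε ∞ with rfl | hε'
  · exact ⟨∅, isCompact_empty, fun _ _ => le_top⟩
  have hdiv : C / ε ≠ ∞ := ENNReal.div_ne_top hC hε.ne'
  set R : ℝ := (C / ε).toReal + 1 with hRdef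
  have hR : 0 < R := by positivity
  -- Markov's inequality gives failure probability at most `C / R`. The choice `R = C/ε + 1` makes
  -- this at most `ε`, and the `1` keeps `R` positive even when `C = 0`.
  have hCR : C ≤ ε * ENNReal.ofReal R := by
    have h3 : C / ε ≤ ENNReal.ofReal R := by
      rw [← ENNReal.ofReal_toReal hdiv]
      exact ENNReal.ofReal_le_ofReal (by linarith)
    rwa [ENNReal.div_le_iff hε.ne' hε', mul_comm] at h3
  refine ⟨holderPaths T s s' R, isCompact_holderPaths hT h1 R, ?_⟩
  rintro _ ⟨N, rfl⟩
  have hK := (isCompact_holderPaths (T := T) hT h1 R).isClosed.measurableSet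
  simp only [flowLaw]
  rw [Measure.map_apply measurable_truncFlow hK.compl]
  have hsub : truncFlow δ N hT hs ⁻¹' (holderPaths T s s' R)ᶜ ⊆
      {ψ | ENNReal.ofReal R ≤ pathBound δ N hT s' ψ.coeff} := fun ψ hψ => by
    by_contra h3
    exact hψ (truncFlow_mem_holderPaths hR.le (le_of_lt (not_le.1 h3)))
  refine (measure_mono hsub).trans ?_
  refine (meas_ge_le_lintegral_div ((measurable_pathBound hT s').comp
    (measurableEmbedding_coeff (-2)).measurable).aemeasurable
    (ENNReal.ofReal_pos.2 hR).ne' ENNReal.ofReal_ne_top).trans ?_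
  rw [ENNReal.div_le_iff (ENNReal.ofReal_pos.2 hR).ne' ENNReal.ofReal_ne_top]
  exact (hCN N).trans hCR

end Tightness

end MSQG

end

/-! ### The proposition -/

theorem mainTheorem5 (δ β T s : ℝ) (hδ : 0 < δ) (hδ' : δ ≤ 1) (hβ : 0 < β) (hT : 0 < T)
    (hs : s < -2) :
    (∃! Ψ : ℕ → MSQG.XSpace (-2) → C(Set.Icc (0 : ℝ) T, MSQG.Hs s),
      ∀ N ψ, MSQG.IsTruncatedSolution δ N hT.le ψ.coeff (Ψ N ψ)) ∧
    ∀ Ψ : ℕ → MSQG.XSpace (-2) → C(Set.Icc (0 : ℝ) T, MSQG.Hs s),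
      (∀ N ψ, MSQG.IsTruncatedSolution δ N hT.le ψ.coeff (Ψ N ψ)) →
      (∀ N, Measurable (Ψ N) ∧ MeasureTheory.IsProbabilityMeasure (MSQG.flowLaw β (Ψ N))) ∧
      MeasureTheory.IsTightMeasureSet (Set.range fun N => MSQG.flowLaw β (Ψ N)) := by
  -- Uniqueness for each `N` and each datum identifies any family of solutions with `truncFlow`, so
  -- measurability and tightness need only be known for that family.
  have huniq : ∀ Ψ : ℕ → MSQG.XSpace (-2) → C(Set.Icc (0 : ℝ) T, MSQG.Hs s),
      (∀ N ψ, MSQG.IsTruncatedSolution δ N hT.le ψ.coeff (Ψ N ψ)) →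
      Ψ = fun N => MSQG.truncFlow δ N hT.le hs := fun Ψ hΨ =>
    funext fun N => funext fun ψ => MSQG.eq_truncFlow (hΨ N ψ)
  refine ⟨⟨fun N => MSQG.truncFlow δ N hT.le hs,
    fun N ψ => MSQG.isTruncatedSolution_truncFlow ψ, huniq⟩, fun Ψ hΨ => ?_⟩
  rw [huniq Ψ hΨ]
  refine ⟨fun N => ⟨MSQG.measurable_truncFlow, ?_⟩,
    MSQG.isTightMeasureSet_flowLaw hβ hδ hδ' hT.le hs⟩
  have := MSQG.isProbabilityMeasure_rho (σ := -2) hβ (by norm_num)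
  exact MeasureTheory.Measure.isProbabilityMeasure_map MSQG.measurable_truncFlow.aemeasurable
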